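/- Work over $\mathbb C$. Let $W_4=\langle x_0,\dots,x_3\rangle$ be the space of linear forms on $\pi_3=\mathbb P^3$, let $V_6^\vee=\mathbb C^6$, and regard an element of $W_4\otimes\bigwedge^2V_6$ as a skew-symmetric $6\times6$ matrix $M$ of linear forms, with value $M(z)$ (a skew form on $V_6^\vee$, i.e. an element of $\bigwedge^2V_6$) at $z\in W_4^\vee=\mathbb C^4$. **Parameters.** $\mathcal A'_9$ is the set of triples $(a,b,u)$ with $a=(a_{ijk})_{0\le i<j<k\le4}\in\mathbb C^{10}$, $b=(b_0:\dots:b_4)\in\mathbb P^4$, $u\in\mathbb C$ such that $a_{014}=1$, $a_{ijk}=1$ for $0\le i<j<k\le3$, all $b_i\ne0$, the cubic surface $\sum_{i<j<k}a_{ijk}w_iw_jw_k=0$ with $w_4=\sum_{i=0}^3\frac{b_4}{b_i}w_i$ (in the coordinates $w_0,\dots,w_3$) is smooth, and $u^2+u(1+a_{024}-a_{034})+a_{024}=0$. Put $v=-(1+a_{024}-a_{034})-u$, $e_1=a_{024}+a_{124}-a_{234}$, $e_2=1+a_{124}-a_{134}$, $e_3=(-a_{124}+a_{134}-1)v-a_{124}-a_{024}+a_{234}$,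 $$M_4=\begin{pmatrix}0&u&-1&a_{124}&e_1&e_2\\-u&0&0&0&a_{024}&-u\\1&0&0&0&-v&1\\-a_{124}&0&0&0&a_{124}v&-a_{124}\\-e_1&-a_{024}&v&-a_{124}v&0&e_3\\-e_2&u&-1&a_{124}&-e_3&0\end{pmatrix},$$ $$M_{0123}=\begin{pmatrix}0&A\\-A&0\end{pmatrix},\qquad A=\begin{pmatrix}w_0+w_3&w_3&w_3\\w_3&w_1+w_3&w_3\\w_3&w_3&w_2+w_3\end{pmatrix}.$$ For $P\in PGL_4$ let $(w_0,\dots,w_3)^t=P\,(x_0,\dots,x_3)^t$ and $w_4=\sum_{i=0}^3\frac{b_4}{b_i}w_i$, and set $M=M_{0123}+w_4M_4$ (defined up to a scalar, through the choice of a matrix representing $P$). **The maps.** Let $M\in W_4\otimes\bigwedge^2V_6$ have a smooth pfaffian cubic surface $S\subset\pi_3$. *$\Phi_1$.* For a plane $H\subset\pi_3$ consider the set of $3$-dimensional subspaces of $V_6^\vee$ that are isotropic for all $M(z)$, $z\in H$. Suppose that there are exactly five planes $H$ for which this set is the rational cubic curve formed by the planes of a Segre variety $\mathbb P^1\times\mathbb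 P^2\subset\mathbb P^5$. Then $\Phi_1(M)=(S,\{h_0,\dots,h_4\})$, where the $h_i$ are these five planes. *$\Phi_2$.* Suppose that $z\mapsto M(z)$ is injective, with image $W_4^\vee\subset\bigwedge^2V_6$, and that there is a unique $5$-dimensional subspace $W_5^\vee\supset W_4^\vee$ of $\bigwedge^2V_6$ such that $\mathbb P(W_5^\vee)\cap G(2,V_6)$ consists of five linearly independent distinct points $u_0,\dots,u_4$. Then $\Phi_2(M)=(S,\{H_0,\dots,H_4\})$ with $H_i=\pi_3\cap\langle u_j,\ j\ne i\rangle$, as an element of the set $\mathcal H$ of pairs of a smooth cubic surface and a complete pentahedron inscribed in it (five planes forming a projective basis of $\pi_3^\vee$ whose ten triple intersection points lie on the surface). **Theorem.** There is a non-empty, dense, Zariski-open subset of $PGL_4\times\mathcal A'_9$ such that for every $(P,(a,b,u))$ in it (and every choice of homogeneous coordinates of $P$ and $b$) $$\mathrm{Pf}(M)=-\sum_{0\le i<j<k\le4}a_{ijk}w_iw_jw_k$$ (with the sign convention that $\mathrm{Pf}$ is the expansion along the first row, so that its leading term is $+m_{12}m_{34}m_{56}$; the opposite orientation of $V_6$ changes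 the sign), and $$\Phi_1(M)=\Phi_2(M)=(S,\Pi),$$ both maps being defined at $M$, where $S$ is the cubic surface $\sum_{i<j<k}a_{ijk}w_iw_jw_k=0$ and $\Pi$ is the pentahedron formed by the five planes $w_i=0$, $0\le i\le4$. -/

import Mathlib

open scoped LinearAlgebra.Projectivization MatrixGroups

noncomputable section

namespace PfaffianCubic

/-! ### Conventions

`W₄` is the space of linear forms in `x₀, …, x₃` on `ℂ⁴`, so the points of `π₃` are the lines of
`ℂ⁴` and the planes of `π₃` are the 3-dimensional subspaces of `ℂ⁴`.  An element of
`W₄ ⊗ ⋀² V₆` is a skew-symmetric `6 × 6` matrix whose entries are linear forms; its value at a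
point `z` of `ℂ⁴` is a skew form on `V₆^∨ = ℂ⁶`. -/

/-- Polynomials in the coordinates `x₀, …, x₃` of `π₃`. -/
abbrev Poly := MvPolynomial (Fin 4) ℂ

/-- Square matrices of size `6` with polynomial entries. -/
abbrev PolyMatrix := Matrix (Fin 6) (Fin 6) Poly

/-- The linear subspaces of `ℂ⁴`; the planes of `π₃` are those of dimension `3`. -/
abbrev SubspaceC4 := Submodule ℂ (Fin 4 → ℂ)

/-- The value of `M` at the point `z`. -/
def valueAt (M : PolyMatrix) (z : Fin 4 → ℂ) : Matrix (Fin 6) (Fin 6) ℂ :=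
  M.map (MvPolynomial.eval z)

/-- `M` is an element of `W₄ ⊗ ⋀² V₆`. -/
def IsSkewLinear (M : PolyMatrix) : Prop :=
  M.transpose = -M ∧ ∀ i j, (M i j).IsHomogeneous 1

/-- The pfaffian of the `4 × 4` skew-symmetric matrix with rows and columns `a, b, c, d`. -/
def pf4 (M : PolyMatrix) (a b c d : Fin 6) : Poly :=
  M a b * M c d - M a c * M b d + M a d * M b c

/-- The pfaffian of a `6 × 6` skew-symmetric matrix (expansion along the first row). -/
def pf6 (M : PolyMatrix) : Poly :=
  M 0 1 * pf4 M 2 3 4 5 - M 0 2 * pf4 M 1 3 4 5 + M 0 3 * pf4 M 1 2 4 5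
    - M 0 4 * pf4 M 1 2 3 5 + M 0 5 * pf4 M 1 2 3 4

/-! ### Cubic surfaces and inscribed pentahedra -/

/-- The linear system `|𝒪_{π₃}(3)| = ℙ(S³ W₄)` of cubic surfaces. -/
abbrev CubicSurface := ℙ ℂ (MvPolynomial.homogeneousSubmodule (Fin 4) ℂ 3)

/-- The cubic form `f` is an equation of the cubic surface `S`. -/
def IsEquation (f : Poly) (S : CubicSurface) : Prop :=
  ∃ (h : f ∈ MvPolynomial.homogeneousSubmodule (Fin 4) ℂ 3)
    (h0 : (⟨f, h⟩ : MvPolynomial.homogeneousSubmodule (Fin 4) ℂ 3) ≠ 0),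
    S = Projectivization.mk ℂ ⟨f, h⟩ h0

/-- The surface `f = 0` of `π₃` is smooth (jacobian criterion). -/
def IsSmoothForm (f : Poly) : Prop :=
  ∀ z : Fin 4 → ℂ, z ≠ 0 → MvPolynomial.eval z f = 0 →
    ∃ i, MvPolynomial.eval z (MvPolynomial.pderiv i f) ≠ 0

/-- The open set `(W₄ ⊗ ⋀² V₆)^{sm}` of elements whose pfaffian surface is smooth. -/
def smLocus : Set PolyMatrix :=
  {M | IsSkewLinear M ∧ IsSmoothForm (pf6 M)}

/-- `T` is a complete pentahedron: its members are the five planes `ℓᵢ = 0`, where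
`(ℓ₀, …, ℓ₄)` is a projective basis of the dual space `π₃^∨`, i.e. any four of the five forms
are linearly independent. -/
def IsCompletePentahedron (T : Set SubspaceC4) : Prop :=
  ∃ l : Fin 5 → Module.Dual ℂ (Fin 4 → ℂ),
    (∀ i, LinearIndependent ℂ (fun j : {j : Fin 5 // j ≠ i} => l j)) ∧
    T = Set.range (fun i => LinearMap.ker (l i))

/-- The variety `𝓗` of pairs `(S, T)` where `S` is a smooth cubic surface and `T` is a complete
pentahedron inscribed in `S`: the ten points where three of the five planes meet lie on `S`. -/
def inscribedPairs : Set (CubicSurface × Set SubspaceC4) :=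
  {x | IsSmoothForm (x.1.rep : Poly) ∧ IsCompletePentahedron x.2 ∧
    ∀ H₁ ∈ x.2, ∀ H₂ ∈ x.2, ∀ H₃ ∈ x.2, H₁ ≠ H₂ → H₁ ≠ H₃ → H₂ ≠ H₃ →
      ∀ z ∈ H₁ ⊓ H₂ ⊓ H₃, MvPolynomial.eval z (x.1.rep : Poly) = 0}

/-! ### The map `Φ₁`

For `M` with Palatini threefold `X`, the anticanonical map `X → π₃^∨` is the projection to `π₃^∨`
of the incidence `Z₄` of pairs `(A, H)` where `A ⊂ V₆^∨` has dimension `3`, `H` is a plane of `π₃`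
and `A` is isotropic for all the forms `M(z)`, `z ∈ H`.  The five distinguished planes are those
over which the fibre is a rational cubic curve, namely the family of the planes of a Segre
variety `ℙ₁ × ℙ₂ ⊂ ℙ₅`. -/

/-- The fibre over `H` of the isotropic incidence: the 3-dimensional subspaces of `V₆^∨` that are
isotropic for all the forms `M(z)`, `z ∈ H`. -/
def isotropicFibre (M : PolyMatrix) (H : SubspaceC4) : Set (Submodule ℂ (Fin 6 → ℂ)) :=
  {A | Module.finrank ℂ A = 3 ∧
    ∀ z ∈ H, ∀ x ∈ A, ∀ y ∈ A, x ⬝ᵥ (valueAt M z).mulVec y = 0}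

/-- `R` is the family of the planes of a Segre variety `ℙ₁ × ℙ₂ ⊂ ℙ₅`: for some isomorphism
`ℂ³ ⊕ ℂ³ ≃ ℂ⁶`, `(x, y) ↦ s x + t y`, it consists of the subspaces `{c • s x + d • t x | x ∈ ℂ³}`
for `(c, d) ≠ (0, 0)`. -/
def IsSegreFamily (R : Set (Submodule ℂ (Fin 6 → ℂ))) : Prop :=
  ∃ s t : (Fin 3 → ℂ) →ₗ[ℂ] (Fin 6 → ℂ),
    Function.Bijective (s.coprod t) ∧
    R = {A | ∃ c d : ℂ, (c ≠ 0 ∨ d ≠ 0) ∧ A = LinearMap.range (c • s + d • t)}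

/-- `Φ₁` is defined at `M` and `Φ₁(M) = (S, T)`: `S` is the pfaffian surface of `M`, there are
exactly five planes of `π₃` over which the fibre of the isotropic incidence is the rational cubic
of the planes of a Segre variety, and `T` is the set of these planes. -/
structure Phi1Eq (M : PolyMatrix) (S : CubicSurface) (T : Set SubspaceC4) : Prop where
  mem_sm : M ∈ smLocus
  surface : IsEquation (pf6 M) S
  planes : T = {H : SubspaceC4 | Module.finrank ℂ H = 3 ∧ IsSegreFamily (isotropicFibre M H)}
  five : T.ncard = 5

/-! ### The map `Φ₂` -/

/-- The non-zero decomposable elements `x ∧ y` of `⋀² V₆`, i.e. the cone over `G(2, V₆)`. -/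
def IsDecomposable (ω : Matrix (Fin 6) (Fin 6) ℂ) : Prop :=
  ω ≠ 0 ∧ ∃ x y : Fin 6 → ℂ, ω = Matrix.vecMulVec x y - Matrix.vecMulVec y x

/-- `W` is spanned by the linearly independent decomposable elements `u₀, …, u₄`, and these are
the only points of `ℙ(W) ∩ G(2, V₆)`. -/
structure IsFivePoints (W : Submodule ℂ (Matrix (Fin 6) (Fin 6) ℂ))
    (u : Fin 5 → Matrix (Fin 6) (Fin 6) ℂ) : Prop where
  decomposable : ∀ i, IsDecomposable (u i)
  linearIndependent : LinearIndependent ℂ u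
  span_eq : W = Submodule.span ℂ (Set.range u)
  only : ∀ ω ∈ W, IsDecomposable ω → ∃ (i : Fin 5) (c : ℂ), ω = c • u i

/-- The set `𝓤₅` of the 5-dimensional subspaces of `⋀² V₆` whose projectivisation meets
`G(2, V₆)` in five linearly independent distinct points. -/
def U5 : Set (Submodule ℂ (Matrix (Fin 6) (Fin 6) ℂ)) :=
  {W | ∃ u, IsFivePoints W u}

/-- The subspace `W₄^∨` of `⋀² V₆` spanned by the values of `M`. -/
def valueSpan (M : PolyMatrix) : Submodule ℂ (Matrix (Fin 6) (Fin 6) ℂ) :=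
  Submodule.span ℂ (Set.range (valueAt M))

/-- `Φ₂` is defined at `M` and `Φ₂(M) = (S, T)`: `S` is the pfaffian surface of `M`, the space
`W₄^∨` of values of `M` has dimension `4` and lies in a unique element of `𝓤₅`, with points
`u₀, …, u₄`, the planes of `T` are `Hᵢ = π₃ ∩ ⟨uⱼ, j ≠ i⟩`, and `(S, T)` is in `𝓗`. -/
structure Phi2Eq (M : PolyMatrix) (S : CubicSurface) (T : Set SubspaceC4) : Prop where
  mem_sm : M ∈ smLocus
  surface : IsEquation (pf6 M) S
  finrank_valueSpan : Module.finrank ℂ (valueSpan M) = 4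
  unique : ∃! W, W ∈ U5 ∧ valueSpan M ≤ W
  planes : ∃ W u, IsFivePoints W u ∧ valueSpan M ≤ W ∧
    T = {H : SubspaceC4 | ∃ i, ∀ z, z ∈ H ↔ valueAt M z ∈ Submodule.span ℂ (u '' {j | j ≠ i})}
  mem_H : (S, T) ∈ inscribedPairs

/-! ### The parameter space `PGL₄ × 𝓐'₉` -/

/-- The triples of indices `0 ≤ i < j < k ≤ 4`. -/
abbrev Triple := {t : Fin 5 × Fin 5 × Fin 5 // t.1 < t.2.1 ∧ t.2.1 < t.2.2}

/-- The forms `w₀, …, w₃` given by `l`, followed by `w₄ = ∑ᵢ (b₄ / bᵢ) wᵢ`. -/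
def fiveForms (b : Fin 5 → ℂ) (l : Fin 4 → Poly) : Fin 5 → Poly :=
  Fin.snoc (α := fun _ => Poly) l (∑ i : Fin 4, MvPolynomial.C (b 4 / b i.castSucc) * l i)

/-- The cubic form `∑_{i<j<k} a_{ijk} wᵢ wⱼ wₖ`. -/
def tripleCubic (a : Triple → ℂ) (w : Fin 5 → Poly) : Poly :=
  ∑ t : Triple, MvPolynomial.C (a t) * w t.1.1 * w t.1.2.1 * w t.1.2.2

/-- The set `𝓐'₉` of triples `(a, b, u)`, with `a ∈ ℂ¹⁰`, `b ∈ ℙ₄` and `u ∈ ℂ`. -/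
def A9' : Set ((Triple → ℂ) × ℙ ℂ (Fin 5 → ℂ) × ℂ) :=
  {p | p.1 ⟨(0, 1, 4), by decide⟩ = 1 ∧
    (∀ t : Triple, t.1.2.2 ≤ 3 → p.1 t = 1) ∧
    (∀ i, p.2.1.rep i ≠ 0) ∧
    IsSmoothForm (tripleCubic p.1 (fiveForms p.2.1.rep MvPolynomial.X)) ∧
    p.2.2 ^ 2 + p.2.2 * (1 + p.1 ⟨(0, 2, 4), by decide⟩ - p.1 ⟨(0, 3, 4), by decide⟩)
      + p.1 ⟨(0, 2, 4), by decide⟩ = 0}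

/-- The set `PGL₄ × 𝓐'₉` (it will carry its Zariski topology, not a product topology). -/
def ParamSpace : Type := PGL(4, ℂ) × A9'

/-- Homogeneous coordinates of a point `(P, (a, b, u))` of `PGL₄ × 𝓐'₉`: an invertible matrix
representing `P` and a non-zero vector representing `b`. -/
structure HomParam where
  P : GL (Fin 4) ℂ
  a : Triple → ℂ
  b : Fin 5 → ℂ
  u : ℂ
  b_ne_zero : b ≠ 0
  mem_A9' : (a, Projectivization.mk ℂ b b_ne_zero, u) ∈ A9'

/-- The Zariski topology of an affine space: basic open sets are the sets `g ≠ 0`. -/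
abbrev zariskiTopology (ι : Type) : TopologicalSpace (ι → ℂ) :=
  TopologicalSpace.generateFrom
    (Set.range fun g : MvPolynomial ι ℂ => {x | MvPolynomial.eval x g ≠ 0})

namespace HomParam

/-- The point of `PGL₄ × 𝓐'₉` with given homogeneous coordinates. -/
def toParam (q : HomParam) : ParamSpace :=
  (Matrix.ProjGenLinGroup.mk q.P, ⟨(q.a, Projectivization.mk ℂ q.b q.b_ne_zero, q.u), q.mem_A9'⟩)

/-- All the coordinates together, as a point of an affine space of dimension `16 + 10 + 5 + 1`. -/
def coords (q : HomParam) : (Fin 4 × Fin 4) ⊕ Triple ⊕ Fin 5 ⊕ Unit → ℂ :=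
  Sum.elim (fun ij => (q.P : Matrix (Fin 4) (Fin 4) ℂ) ij.1 ij.2)
    (Sum.elim q.a (Sum.elim q.b fun _ => q.u))

instance : TopologicalSpace HomParam :=
  TopologicalSpace.induced coords (zariskiTopology _)

end HomParam

/-- The Zariski topology of `PGL₄ × 𝓐'₉`: the quotient of the Zariski topology of the space of
homogeneous coordinates (by rescaling `P` and `b`). -/
instance : TopologicalSpace ParamSpace :=
  TopologicalSpace.coinduced HomParam.toParam inferInstance

/-! ### The explicit matrix -/

/-- The constant matrix `M₄` attached to `(a, u)`. -/
def matrixM4 (a : Triple → ℂ) (u : ℂ) : Matrix (Fin 6) (Fin 6) ℂ :=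
  let a024 := a ⟨(0, 2, 4), by decide⟩
  let a034 := a ⟨(0, 3, 4), by decide⟩
  let a124 := a ⟨(1, 2, 4), by decide⟩
  let a134 := a ⟨(1, 3, 4), by decide⟩
  let a234 := a ⟨(2, 3, 4), by decide⟩
  let v := -(1 + a024 - a034) - u
  let e1 := a024 + a124 - a234
  let e2 := 1 + a124 - a134
  let e3 := (-a124 + a134 - 1) * v - a124 - a024 + a234
  !![0, u, -1, a124, e1, e2;
     -u, 0, 0, 0, a024, -u;
     1, 0, 0, 0, -v, 1;
     -a124, 0, 0, 0, a124 * v, -a124;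
     -e1, -a024, v, -(a124 * v), 0, e3;
     -e2, u, -1, a124, -e3, 0]

/-- The matrix `M₀₁₂₃` of linear forms. -/
def matrixM0123 (w : Fin 5 → Poly) : PolyMatrix :=
  !![0, 0, 0, w 0 + w 3, w 3, w 3;
     0, 0, 0, w 3, w 1 + w 3, w 3;
     0, 0, 0, w 3, w 3, w 2 + w 3;
     -w 0 - w 3, -w 3, -w 3, 0, 0, 0;
     -w 3, -w 1 - w 3, -w 3, 0, 0, 0;
     -w 3, -w 3, -w 2 - w 3, 0, 0, 0]

namespace HomParam

/-- The linear forms `w₀, …, w₄`: `(w₀, …, w₃) = P (x₀, …, x₃)` and `w₄ = ∑ᵢ (b₄ / bᵢ) wᵢ`. -/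
def w (q : HomParam) : Fin 5 → Poly :=
  fiveForms q.b fun i =>
    ∑ j, MvPolynomial.C ((q.P : Matrix (Fin 4) (Fin 4) ℂ) i j) * MvPolynomial.X j

/-- The cubic form `∑_{i<j<k} a_{ijk} wᵢ wⱼ wₖ` on `π₃`. -/
def cubic (q : HomParam) : Poly := tripleCubic q.a q.w

/-- The set of the five planes `wᵢ = 0` of `π₃`. -/
def pentahedron (q : HomParam) : Set SubspaceC4 :=
  {H : SubspaceC4 | ∃ i, ∀ z, z ∈ H ↔ MvPolynomial.eval z (q.w i) = 0}

/-- The explicit skew-symmetric matrix `M = M₀₁₂₃ + w₄ M₄`. -/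
def M (q : HomParam) : PolyMatrix :=
  matrixM0123 q.w + q.w 4 • (matrixM4 q.a q.u).map MvPolynomial.C

end HomParam

end PfaffianCubic

end

noncomputable section

namespace PfaffianCubic

/-! Put `v = -(1 + a₀₂₄ - a₀₃₄) - u`. The quadratic equation for `u` says `u v = a₀₂₄`, which is
what makes `M₄` decomposable. Since `M₀₁₂₃` combines `e₀∧e₃`, `e₁∧e₄`, `e₂∧e₅` and
`(e₀+e₁+e₂)∧(e₃+e₄+e₅)`, this gives `M = ∑ wᵢ uᵢ` with five fixed decomposable forms `uᵢ`
(`valueAt_M`) and one relation among the `wᵢ`, all of whose coefficients are nonzero. The pfaffian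
is then squarefree in the `wᵢ`, and the theorem becomes a statement about the configuration `u₀, …,
u₄`. The open set is `General`: all `a_{ijk}` are nonzero, so that any three of the five pairs of
linear forms are independent, and `det σ ≠ 0`. Here `ℂ⁶ = ℂ² ⊗ ℂ³`, with index pairs `{k, k+3}`, and
`⋀²ℂ⁶ = S²ℂ²⊗⋀²ℂ³ ⊕ ⋀²ℂ²⊗S²ℂ³`. The points `u₀, …, u₃` lie in the second summand, and `σ` is the
component of `u₄` in the first.

`Φ₁`. Over `wₘ = 0` only four of the `uᵢ` survive, and their pairs of forms are four projections `ℂ⁶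
→ ℂ²`, any three of which split `ℂ⁶`. A common isotropic 3-space must then be `a ⊗ ℂ³` in an adapted
splitting (`isSegreFamily_of_projections`). Conversely, a Segre family over a plane `h = 0` makes
`𝔰𝔩₂` act by infinitesimal symmetries of `M` restricted to that plane, so each such `X` moves `M(z)`
by `h(z) N(X)`. As `X` is traceless the pfaffian does not move to first order, hence `M(z) ∧ M(z) ∧
N = 0` and `N` is orthogonal to all `uᵢ ∧ uⱼ`. These `N` form a five-dimensional space and `X ↦ N`
is injective. Linear algebra shows that a three-dimensional family is possible only if `h` is
proportional to some `wᵢ` (`plane_of_deformation`).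

`Φ₂`. The only decomposable forms in `⟨u₀, …, u₄⟩` are multiples of the `uᵢ`, and none lies in the
space `V` of values of `M`. If another five-point space `W` contains `V`, then `W = V ⊕ ℂω` for one
of its points `ω`, and decomposability of the other points forces `ω ∧ V` to be orthogonal to every
`N` as above. Such an `ω` already lies in `⟨u₀, …, u₄⟩` (`exists_eq_sum_of_pfPolar`).

Density is obtained by moving `u, v, a₁₂₄, e₁, e₂` along a line towards one general configuration.
These five numbers are free parameters, and smoothness survives for small times. -/

/-! ### The polar form of the pfaffian -/

/-- The coefficient of the wedge product `A ∧ B` at the indices `a, b, c, d`. -/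
def wedge4 (A B : Matrix (Fin 6) (Fin 6) ℂ) (a b c d : Fin 6) : ℂ :=
  A a b * B c d + B a b * A c d - A a c * B b d - B a c * A b d + A a d * B b c + B a d * A b c

/-- The symmetric trilinear form `A ∧ B ∧ C` on skew-symmetric matrices. -/
def pfPolar (A B C : Matrix (Fin 6) (Fin 6) ℂ) : ℂ :=
  C 0 1 * wedge4 A B 2 3 4 5 - C 0 2 * wedge4 A B 1 3 4 5 + C 0 3 * wedge4 A B 1 2 4 5
    - C 0 4 * wedge4 A B 1 2 3 5 + C 0 5 * wedge4 A B 1 2 3 4 + C 1 2 * wedge4 A B 0 3 4 5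
    - C 1 3 * wedge4 A B 0 2 4 5 + C 1 4 * wedge4 A B 0 2 3 5 - C 1 5 * wedge4 A B 0 2 3 4
    + C 2 3 * wedge4 A B 0 1 4 5 - C 2 4 * wedge4 A B 0 1 3 5 + C 2 5 * wedge4 A B 0 1 3 4
    + C 3 4 * wedge4 A B 0 1 2 5 - C 3 5 * wedge4 A B 0 1 2 4 + C 4 5 * wedge4 A B 0 1 2 3

/-- Infinitesimal form of `Pf(gᵀ M g) = det g · Pf M`: the derivative at the identity in the
direction `X` is `tr X · Pf M`. -/
theorem pfPolar_congruence (M X : Matrix (Fin 6) (Fin 6) ℂ) (hM : M.transpose = -M)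
    (hX : X.trace = 0) : pfPolar M M (X.transpose * M + M * X) = 0 := by
  have h : ∀ i j, M i j = -M j i := fun i j => by
    have := congrFun (congrFun hM j) i
    simpa using this
  have hd : ∀ i, M i i = 0 := fun i => by
    have := h i i
    linear_combination this / 2
  have hX5 : X 5 5 = -(X 0 0 + X 1 1 + X 2 2 + X 3 3 + X 4 4) := by
    simp only [Matrix.trace, Fin.sum_univ_succ, Matrix.diag] at hX
    simp at hX
    linear_combination hX
  simp only [pfPolar, wedge4, Matrix.add_apply, Matrix.mul_apply, Matrix.transpose_apply,
    Fin.sum_univ_six, hd, h 1 0, h 2 0, h 3 0, h 4 0, h 2 1, h 3 1, h 4 1, h 5 1, h 3 2,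
    h 4 2, h 5 2, h 4 3, h 5 3, h 5 4, hX5]
  ring

theorem pfPolar_add_left (A A' B C : Matrix (Fin 6) (Fin 6) ℂ) :
    pfPolar (A + A') B C = pfPolar A B C + pfPolar A' B C := by
  simp only [pfPolar, wedge4, Matrix.add_apply]; ring

theorem pfPolar_smul_left (r : ℂ) (A B C : Matrix (Fin 6) (Fin 6) ℂ) :
    pfPolar (r • A) B C = r * pfPolar A B C := by
  simp only [pfPolar, wedge4, Matrix.smul_apply, smul_eq_mul]; ring

theorem pfPolar_comm (A B C : Matrix (Fin 6) (Fin 6) ℂ) : pfPolar A B C = pfPolar B A C := by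
  simp only [pfPolar, wedge4]; ring

theorem pfPolar_add_mid (A B B' C : Matrix (Fin 6) (Fin 6) ℂ) :
    pfPolar A (B + B') C = pfPolar A B C + pfPolar A B' C := by
  rw [pfPolar_comm, pfPolar_add_left, pfPolar_comm B, pfPolar_comm B']

theorem pfPolar_smul_mid (r : ℂ) (A B C : Matrix (Fin 6) (Fin 6) ℂ) :
    pfPolar A (r • B) C = r * pfPolar A B C := by
  rw [pfPolar_comm, pfPolar_smul_left, pfPolar_comm B]

theorem pfPolar_smul_right (r : ℂ) (A B C : Matrix (Fin 6) (Fin 6) ℂ) :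
    pfPolar A B (r • C) = r * pfPolar A B C := by
  simp only [pfPolar, Matrix.smul_apply, smul_eq_mul]; ring

/-- The decomposable skew form `x ∧ y`. -/
def linePoint (x y : Fin 6 → ℂ) : Matrix (Fin 6) (Fin 6) ℂ :=
  Matrix.vecMulVec x y - Matrix.vecMulVec y x

theorem linePoint_apply (x y : Fin 6 → ℂ) (a b : Fin 6) :
    linePoint x y a b = x a * y b - y a * x b := by
  simp [linePoint, Matrix.vecMulVec_apply]

theorem wedge4_linePoint_self (x y : Fin 6 → ℂ) (a b c d : Fin 6) :
    wedge4 (linePoint x y) (linePoint x y) a b c d = 0 := by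
  simp only [wedge4, linePoint_apply]; ring

theorem pfPolar_linePoint_self (x y : Fin 6 → ℂ) (C : Matrix (Fin 6) (Fin 6) ℂ) :
    pfPolar (linePoint x y) (linePoint x y) C = 0 := by
  simp only [pfPolar, wedge4_linePoint_self]; ring

theorem linePoint_transpose (x y : Fin 6 → ℂ) : (linePoint x y).transpose = -linePoint x y := by
  ext a b
  simp only [Matrix.transpose_apply, Matrix.neg_apply, linePoint_apply]; ring

/-! ### The five points -/

/-- The parameters `u, v, a₁₂₄, e₁, e₂` of the five points. -/
structure Config where
  u : ℂ
  v : ℂ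
  k : ℂ
  e₁ : ℂ
  e₂ : ℂ

namespace Config

/-- The first of the two linear forms spanning each of the five lines. -/
def fst (c : Config) : Fin 5 → Fin 6 → ℂ :=
  ![![1, 0, 0, 0, 0, 0], ![0, 1, 0, 0, 0, 0], ![0, 0, 1, 0, 0, 0], ![1, 1, 1, 0, 0, 0],
    ![0, -c.u, 1, -c.k, -c.e₁, -c.e₂]]

/-- The second of the two linear forms spanning each of the five lines. -/
def snd (c : Config) : Fin 5 → Fin 6 → ℂ :=
  ![![0, 0, 0, 1, 0, 0], ![0, 0, 0, 0, 1, 0], ![0, 0, 0, 0, 0, 1], ![0, 0, 0, 1, 1, 1],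
    ![1, 0, 0, 0, -c.v, 1]]

/-- The five decomposable skew forms `u₀, …, u₄`. -/
def pt (c : Config) (i : Fin 5) : Matrix (Fin 6) (Fin 6) ℂ := linePoint (c.fst i) (c.snd i)

/-- The symmetric parts of the off-diagonal blocks of `u₄`, as binary quadratic forms. -/
def sigma (c : Config) : Matrix (Fin 3) (Fin 3) ℂ :=
  !![0, c.v - c.u, -c.e₁ - c.v * c.e₂;
     1, -c.e₂, c.k;
     c.u, c.e₁, c.k * c.v]

/-- The configuration is general. -/
structure General (c : Config) : Prop where
  u_ne : c.u ≠ 0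
  v_ne : c.v ≠ 0
  u1_ne : 1 + c.u ≠ 0
  v1_ne : 1 + c.v ≠ 0
  k_ne : c.k ≠ 0
  a134_ne : 1 + c.k - c.e₂ ≠ 0
  a234_ne : c.u * c.v + c.k - c.e₁ ≠ 0
  det_ne : c.sigma.det ≠ 0

theorem pt_skew (c : Config) (i : Fin 5) (a b : Fin 6) : c.pt i a b = -c.pt i b a := by
  simp only [pt, linePoint_apply]; ring

theorem pt_transpose (c : Config) (i : Fin 5) : (c.pt i).transpose = -c.pt i :=
  linePoint_transpose _ _

theorem pt_apply (c : Config) (i : Fin 5) (a b : Fin 6) :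
    c.pt i a b = c.fst i a * c.snd i b - c.snd i a * c.fst i b := linePoint_apply _ _ _ _

/-- The pairing of `σₗ` with the `k`-th off-diagonal block of `N`. -/
def coord (c : Config) (N : Matrix (Fin 6) (Fin 6) ℂ) (k l : Fin 3) : ℂ :=
  (![![N 1 2, N 1 5, N 4 5], ![-N 0 2, -N 0 5, -N 3 5], ![N 0 1, N 0 4, N 3 4]] k 2) * c.sigma l 0
  - (![![N 1 2, N 1 5, N 4 5], ![-N 0 2, -N 0 5, -N 3 5], ![N 0 1, N 0 4, N 3 4]] k 1) * c.sigma l 1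
  + (![![N 1 2, N 1 5, N 4 5], ![-N 0 2, -N 0 5, -N 3 5], ![N 0 1, N 0 4, N 3 4]] k 0) * c.sigma l 2

/-- The linear equations on `N` expressing `uᵢ ∧ uⱼ ∧ N = 0` for all `i, j`. -/
structure Orthogonal (c : Config) (N : Matrix (Fin 6) (Fin 6) ℂ) : Prop where
  skew : ∀ a b, N a b = -N b a
  h03 : N 0 3 = 0
  h14 : N 1 4 = 0
  h25 : N 2 5 = 0
  h24 : N 2 4 = -N 1 5
  h23 : N 2 3 = -N 0 5
  h13 : N 1 3 = -N 0 4
  coord_diag : ∀ k, c.coord N k k = 0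
  coord_sum : c.coord N 0 1 + c.coord N 0 2 + c.coord N 1 0 + c.coord N 1 2 + c.coord N 2 0
    + c.coord N 2 1 = 0

/-- In `2 × 2` blocks indexed by the pairs `{k, k+3}`: the products among `u₀, u₁, u₂` kill the
diagonal blocks of `N`, their products with `u₃` make the off-diagonal blocks symmetric, and the
products of `u₀, …, u₃` with `u₄` give the last four equations. -/
theorem orthogonal_of_pfPolar (c : Config) (N : Matrix (Fin 6) (Fin 6) ℂ)
    (hN : N.transpose = -N) (h : ∀ i j, pfPolar (c.pt i) (c.pt j) N = 0) : c.Orthogonal N := by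
  have hs : ∀ i j, N i j = -N j i := fun i j => by
    have := congrFun (congrFun hN j) i
    simpa using this
  have h01 := h 0 1
  have h02 := h 0 2
  have h12 := h 1 2
  have h30 := h 3 0
  have h31 := h 3 1
  have h32 := h 3 2
  have h40 := h 4 0
  have h41 := h 4 1
  have h42 := h 4 2
  have h43 := h 4 3
  clear h
  simp [pfPolar, wedge4, pt_apply, fst, snd] at h01 h02 h12 h30 h31 h32 h40 h41 h42 h43
  have h24 : N 2 4 = -N 1 5 := by linear_combination h30 + h02 + h01
  have h23 : N 2 3 = -N 0 5 := by linear_combination h31 + h12 + h01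
  have h13 : N 1 3 = -N 0 4 := by linear_combination h32 + h12 + h02
  simp only [h24, h23, h13, h01, h02, h12] at h40 h41 h42 h43
  have hk : ∀ k, c.coord N k k = 0 := by
    intro k
    fin_cases k <;> simp [coord, sigma]
    · linear_combination h40
    · linear_combination h41
    · linear_combination h42
  refine ⟨hs, h12, h02, h01, h24, h23, h13, hk, ?_⟩
  have h0 := hk 0
  have h1 := hk 1
  have h2 := hk 2
  simp [coord, sigma] at h0 h1 h2 ⊢
  linear_combination h43 - h0 - h1 - h2

end Config

/-! ### ### Dimension counts and polarization -/

/-- Two linear forms on `ℂ³` have a common nonzero zero. Hence a three-dimensional family is never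
pinned down by two linear conditions. -/
theorem not_injective_prod_of_dual {φ ψ : Module.Dual ℂ (Fin 3 → ℂ)}
    (h : ∀ x, φ x = 0 → ψ x = 0 → x = 0) : False := by
  have hi : Function.Injective (LinearMap.prod φ ψ) := by
    rw [injective_iff_map_eq_zero]
    intro x hx
    rw [LinearMap.prod_apply] at hx
    exact h x (congrArg Prod.fst hx) (congrArg Prod.snd hx)
  have := LinearMap.finrank_le_finrank_of_injective hi
  simp at this

/-- A system of linear equations on a `3 × 3` matrix with zero diagonal has at most two degrees of
freedom, except for special coefficients. -/
theorem exists_two_entries (d : Fin 3 → ℂ)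
    (h1 : ¬ ∃ i, ∀ j, j ≠ i → d j = 0) (h2 : ¬ (d 0 = d 1 ∧ d 1 = d 2)) :
    ∃ k l k' l' : Fin 3, ∀ n : Fin 3 → Fin 3 → ℂ, (∀ k, n k k = 0) →
      n 0 1 + n 0 2 + n 1 0 + n 1 2 + n 2 0 + n 2 1 = 0 →
      (∀ l, d 0 * n 0 l + d 1 * n 1 l + d 2 * n 2 l = 0) →
      n k l = 0 → n k' l' = 0 → ∀ i j, n i j = 0 := by
  have key : ∀ n : Fin 3 → Fin 3 → ℂ, (∀ k, n k k = 0) → n 0 1 = 0 → n 0 2 = 0 → n 1 0 = 0 →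
      n 1 2 = 0 → n 2 0 = 0 → n 2 1 = 0 → ∀ i j, n i j = 0 := by
    intro n hd h01 h02 h10 h12 h20 h21 i j
    have h00 := hd 0
    have h11 := hd 1
    have h22 := hd 2
    fin_cases i <;> fin_cases j <;> assumption
  have hcase : (d 0 ≠ 0 ∧ d 1 ≠ 0) ∨ (d 0 ≠ 0 ∧ d 2 ≠ 0) ∨ (d 1 ≠ 0 ∧ d 2 ≠ 0) := by
    by_contra hc
    apply h1
    by_cases h0 : d 0 = 0
    · by_cases h1 : d 1 = 0
      · exact ⟨2, by simp [Fin.forall_fin_succ, h0, h1]⟩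
      · refine ⟨1, ?_⟩
        have : d 2 = 0 := by tauto
        simp [Fin.forall_fin_succ, h0, this]
    · refine ⟨0, ?_⟩
      have h1 : d 1 = 0 := by tauto
      have h2 : d 2 = 0 := by tauto
      simp [Fin.forall_fin_succ, h1, h2]
  have hne : d 1 ≠ d 2 ∨ d 0 ≠ d 2 ∨ d 0 ≠ d 1 := by
    by_contra hc
    push Not at hc
    exact h2 ⟨hc.2.2, hc.1⟩
  have finish : ∀ k l k' l' : Fin 3, (∀ n : Fin 3 → Fin 3 → ℂ,
      n 0 1 + n 0 2 + n 1 0 + n 1 2 + n 2 0 + n 2 1 = 0 →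
      d 1 * n 1 0 + d 2 * n 2 0 = 0 → d 0 * n 0 1 + d 2 * n 2 1 = 0 →
      d 0 * n 0 2 + d 1 * n 1 2 = 0 → n k l = 0 → n k' l' = 0 →
      n 0 1 = 0 ∧ n 0 2 = 0 ∧ n 1 0 = 0 ∧ n 1 2 = 0 ∧ n 2 0 = 0 ∧ n 2 1 = 0) →
      ∃ k l k' l' : Fin 3, ∀ n : Fin 3 → Fin 3 → ℂ, (∀ k, n k k = 0) →
      n 0 1 + n 0 2 + n 1 0 + n 1 2 + n 2 0 + n 2 1 = 0 →
      (∀ l, d 0 * n 0 l + d 1 * n 1 l + d 2 * n 2 l = 0) →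
      n k l = 0 → n k' l' = 0 → ∀ i j, n i j = 0 := by
    intro k l k' l' h
    refine ⟨k, l, k', l', fun n hd hs hl ha hb => ?_⟩
    have hl0 := hl 0
    have hl1 := hl 1
    have hl2 := hl 2
    rw [hd] at hl0 hl1 hl2
    obtain ⟨a1, a2, a3, a4, a5, a6⟩ := h n hs (by linear_combination hl0)
      (by linear_combination hl1) (by linear_combination hl2) ha hb
    exact key n hd a1 a2 a3 a4 a5 a6
  -- The equation for column `l` ties together its two off-diagonal entries. Two nonzero and two
  -- distinct coefficients make the condition on the sum independent of the three column equations,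
  -- and they decide which two entries to prescribe.
  rcases hne with hne | hne | hne
  · by_cases h0 : d 0 = 0
    · exact finish 0 1 0 2 (by intro n; grind)
    · exact finish 2 1 1 2 (by intro n; grind)
  · by_cases h0 : d 1 = 0
    · exact finish 1 0 1 2 (by intro n; grind)
    · exact finish 2 0 0 2 (by intro n; grind)
  · by_cases h0 : d 2 = 0
    · exact finish 2 0 2 1 (by intro n; grind)
    · exact finish 1 0 0 1 (by intro n; grind)

/-- A quadratic form multiplied by a nonzero linear form `h` vanishes only if the quadratic form
does. Evaluating at `x` and at `x ± z₀` isolates the mixed term, so that `h z₀` can be cancelled;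
polarization does the rest. -/
theorem pfPolar_eq_zero_of_mul {M : (Fin 4 → ℂ) → Matrix (Fin 6) (Fin 6) ℂ}
    {h : (Fin 4 → ℂ) → ℂ} {N : Matrix (Fin 6) (Fin 6) ℂ}
    (hMa : ∀ x y, M (x + y) = M x + M y) (hMs : ∀ (r : ℂ) x, M (r • x) = r • M x)
    (hha : ∀ x y, h (x + y) = h x + h y) (hhs : ∀ (r : ℂ) x, h (r • x) = r * h x)
    {z₀ : Fin 4 → ℂ} (hz₀ : h z₀ ≠ 0) (hM : ∀ z, h z * pfPolar (M z) (M z) N = 0)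
    (x y : Fin 4 → ℂ) : pfPolar (M x) (M y) N = 0 := by
  have h0 : pfPolar (M z₀) (M z₀) N = 0 := (mul_eq_zero.mp (hM z₀)).resolve_left hz₀
  have hsq : ∀ x, pfPolar (M x) (M x) N = 0 := by
    intro x
    have e0 := hM x
    have e1 := hM (x + z₀)
    have e2 := hM (x + (-1 : ℂ) • z₀)
    simp only [hMa, hMs, hha, hhs, pfPolar_add_left, pfPolar_add_mid, pfPolar_smul_left,
      pfPolar_smul_mid, h0, pfPolar_comm (M z₀) (M x)] at e1 e2
    have hP : pfPolar (M x) (M z₀) N = 0 := by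
      have : h z₀ * pfPolar (M x) (M z₀) N = 0 := by linear_combination (e1 + e2 - 2 * e0) / 4
      exact (mul_eq_zero.mp this).resolve_left hz₀
    rw [hP] at e1
    have : h z₀ * pfPolar (M x) (M x) N = 0 := by linear_combination e1 - e0
    exact (mul_eq_zero.mp this).resolve_left hz₀
  have e := hsq (x + y)
  simp only [hMa, pfPolar_add_left, pfPolar_add_mid, hsq, pfPolar_comm (M y) (M x)] at e
  linear_combination e / 2

namespace Config

/-- The four-dimensional space spanned by the `uᵢ + βᵢ u₄`, as a family of matrices. -/
def space (c : Config) (β : Fin 4 → ℂ) (i : Fin 4) : Matrix (Fin 6) (Fin 6) ℂ :=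
  c.pt i.castSucc + β i • c.pt 4

/-- Because `uᵢ ∧ uᵢ = 0`, the square of `uᵢ + βᵢ u₄` is `2 βᵢ uᵢ ∧ u₄`. Once these are known to
pair to zero with `N`, the mixed products reduce to `uᵢ ∧ uⱼ`. -/
theorem orthogonal_of_space (c : Config) {β : Fin 4 → ℂ} (hβ : ∀ i, β i ≠ 0)
    {N : Matrix (Fin 6) (Fin 6) ℂ} (hN : N.transpose = -N)
    (h : ∀ i j, pfPolar (c.space β i) (c.space β j) N = 0) : c.Orthogonal N := by
  simp only [space, pfPolar_add_left, pfPolar_add_mid, pfPolar_smul_left, pfPolar_smul_mid] at h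
  have h44 : pfPolar (c.pt 4) (c.pt 4) N = 0 := pfPolar_linePoint_self _ _ _
  have h4 : ∀ i : Fin 4, pfPolar (c.pt i.castSucc) (c.pt 4) N = 0 := by
    intro i
    have e := h i i
    rw [h44, pfPolar_comm (c.pt 4)] at e
    have hii : pfPolar (c.pt i.castSucc) (c.pt i.castSucc) N = 0 := pfPolar_linePoint_self _ _ _
    rw [hii] at e
    have : β i * pfPolar (c.pt i.castSucc) (c.pt 4) N = 0 := by linear_combination e / 2
    exact (mul_eq_zero.mp this).resolve_left (hβ i)
  refine c.orthogonal_of_pfPolar N hN fun i j => ?_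
  induction i using Fin.lastCases with
  | last =>
    induction j using Fin.lastCases with
    | last => exact h44
    | cast j => rw [pfPolar_comm]; exact h4 j
  | cast i =>
    induction j using Fin.lastCases with
    | last => exact h4 i
    | cast j =>
      have e := h i j
      rw [h44, pfPolar_comm (c.pt 4), h4, h4] at e
      linear_combination e

/-- The infinitesimal action of `X` on a skew form. -/
def act (X A : Matrix (Fin 6) (Fin 6) ℂ) : Matrix (Fin 6) (Fin 6) ℂ := X.transpose * A + A * X

theorem act_apply (X A : Matrix (Fin 6) (Fin 6) ℂ) (i j : Fin 6) :
    act X A i j = ∑ k, (X k i * A k j + A i k * X k j) := by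
  simp [act, Matrix.mul_apply, Finset.sum_add_distrib]

theorem act_add (X A B : Matrix (Fin 6) (Fin 6) ℂ) : act X (A + B) = act X A + act X B := by
  simp only [act, mul_add, add_mul]; abel

theorem act_smul (X A : Matrix (Fin 6) (Fin 6) ℂ) (r : ℂ) : act X (r • A) = r • act X A := by
  simp [act]

/-- With `M(z) = ∑ zᵢ (uᵢ + βᵢ u₄)` and `h(z) = ∑ zᵢ βᵢ gᵢ`, the hypothesis reads `X · M(z) = h(z)
N`. Tracelessness of `X` gives `h(z) M(z) ∧ M(z) ∧ N = 0`, and `h ≠ 0` can be cancelled. -/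
theorem orthogonal_of_act (c : Config) {β g : Fin 4 → ℂ} (hβ : ∀ i, β i ≠ 0) (hg : ∃ i, g i ≠ 0)
    {X N : Matrix (Fin 6) (Fin 6) ℂ} (hX : X.trace = 0)
    (h : ∀ i, act X (c.space β i) = (β i * g i) • N) : c.Orthogonal N := by
  obtain ⟨i₀, hi₀⟩ := hg
  have hskew : ∀ i, (c.space β i).transpose = -c.space β i := fun i => by
    simp only [space, Matrix.transpose_add, Matrix.transpose_smul, pt_transpose]
    simp only [smul_neg, neg_add]
  have hN : N.transpose = -N := by
    have e := congrArg Matrix.transpose (h i₀)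
    have e' : (act X (c.space β i₀)).transpose = -act X (c.space β i₀) := by
      simp only [act, Matrix.transpose_add, Matrix.transpose_mul, hskew, Matrix.transpose_transpose,
        neg_mul, mul_neg]
      abel
    rw [e', h, Matrix.transpose_smul, ← smul_neg] at e
    exact (smul_right_injective _ (mul_ne_zero (hβ i₀) hi₀) e).symm
  refine c.orthogonal_of_space hβ hN fun i j => ?_
  have := pfPolar_eq_zero_of_mul (N := N) (M := fun z => ∑ i, z i • c.space β i)
    (h := fun z => ∑ i, z i * (β i * g i)) (z₀ := Pi.single i₀ 1)
    (fun x y => by simp [add_smul, Finset.sum_add_distrib])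
    (fun r x => by simp [Finset.smul_sum, mul_smul])
    (fun x y => by simp [add_mul, Finset.sum_add_distrib])
    (fun r x => by simp [Finset.mul_sum, mul_assoc])
    (by simp [Pi.single_apply, hβ, hi₀]) (fun z => by
      rw [← pfPolar_smul_right, Finset.sum_smul]
      have e : ∑ i, (z i * (β i * g i)) • N = act X (∑ i, z i • c.space β i) := by
        simp only [act, Finset.mul_sum, Finset.sum_mul, ← Finset.sum_add_distrib]
        refine Finset.sum_congr rfl fun i _ => ?_
        rw [mul_smul, ← h i, act]
        simp
      rw [e]
      refine pfPolar_congruence _ _ ?_ hX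
      simp [Matrix.transpose_sum, Matrix.transpose_smul, hskew])
    (Pi.single i 1) (Pi.single j 1)
  simpa [Pi.single_apply] using this

end Config

/-! ### ### Equations satisfied by a deformation -/

namespace Config

/-- `X` acts on the points `uᵢ + βᵢ u₄` of the space by `βᵢ gᵢ N`, with `N` orthogonal. -/
structure Deformation (c : Config) (β g : Fin 4 → ℂ) (X N : Matrix (Fin 6) (Fin 6) ℂ) : Prop where
  orth : c.Orthogonal N
  act_eq : ∀ i, act X (c.space β i) = (β i * g i) • N

namespace Deformation

variable {c : Config} {β g : Fin 4 → ℂ} {X N : Matrix (Fin 6) (Fin 6) ℂ}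

theorem act_apply_eq (h : c.Deformation β g X N) (i : Fin 4) (a b : Fin 6) :
    act X (c.pt i.castSucc) a b + β i * act X (c.pt 4) a b = β i * g i * N a b := by
  have := congrFun (congrFun (h.act_eq i) a) b
  rw [space, act_add, act_smul] at this
  simpa using this

theorem act_four_of_eq_zero (h : c.Deformation β g X N) {i : Fin 4} (hβ : β i ≠ 0) {a b : Fin 6}
    (hab : act X (c.pt i.castSucc) a b = 0) : act X (c.pt 4) a b = g i * N a b := by
  have e := h.act_apply_eq i a b
  rw [hab] at e
  exact mul_left_cancel₀ hβ (by linear_combination e)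

/-- Every term of `X · (e₀ ∧ e₃)` contains `e₀` or `e₃`. Entries outside these indices therefore
give `X · u₄ = g₀ N` there; `u₁` and `u₂` play the same role for their own index pairs. -/
theorem act_zero (X : Matrix (Fin 6) (Fin 6) ℂ) (a b : Fin 6) (ha : a ≠ 0) (ha' : a ≠ 3)
    (hb : b ≠ 0) (hb' : b ≠ 3) : act X (c.pt 0) a b = 0 := by
  revert ha ha' hb hb'
  fin_cases a <;> fin_cases b <;> simp [act_apply, Fin.sum_univ_six, pt_apply, fst, snd]

theorem act_one (X : Matrix (Fin 6) (Fin 6) ℂ) (a b : Fin 6) (ha : a ≠ 1) (ha' : a ≠ 4)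
    (hb : b ≠ 1) (hb' : b ≠ 4) : act X (c.pt 1) a b = 0 := by
  revert ha ha' hb hb'
  fin_cases a <;> fin_cases b <;> simp [act_apply, Fin.sum_univ_six, pt_apply, fst, snd]

theorem act_two (X : Matrix (Fin 6) (Fin 6) ℂ) (a b : Fin 6) (ha : a ≠ 2) (ha' : a ≠ 5)
    (hb : b ≠ 2) (hb' : b ≠ 5) : act X (c.pt 2) a b = 0 := by
  revert ha ha' hb hb'
  fin_cases a <;> fin_cases b <;> simp [act_apply, Fin.sum_univ_six, pt_apply, fst, snd]

theorem act_four₀ (h : c.Deformation β g X N) (hβ : ∀ i, β i ≠ 0) (a b : Fin 6) (ha : a ≠ 0)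
    (ha' : a ≠ 3) (hb : b ≠ 0) (hb' : b ≠ 3) : act X (c.pt 4) a b = g 0 * N a b :=
  h.act_four_of_eq_zero (hβ 0) (act_zero X a b ha ha' hb hb')

theorem act_four₁ (h : c.Deformation β g X N) (hβ : ∀ i, β i ≠ 0) (a b : Fin 6) (ha : a ≠ 1)
    (ha' : a ≠ 4) (hb : b ≠ 1) (hb' : b ≠ 4) : act X (c.pt 4) a b = g 1 * N a b :=
  h.act_four_of_eq_zero (hβ 1) (act_one X a b ha ha' hb hb')

theorem act_four₂ (h : c.Deformation β g X N) (hβ : ∀ i, β i ≠ 0) (a b : Fin 6) (ha : a ≠ 2)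
    (ha' : a ≠ 5) (hb : b ≠ 2) (hb' : b ≠ 5) : act X (c.pt 4) a b = g 2 * N a b :=
  h.act_four_of_eq_zero (hβ 2) (act_two X a b ha ha' hb hb')

/-- The three equations coming from `u₃`. -/
theorem three_eqs (h : c.Deformation β g X N) (hβ : ∀ i, β i ≠ 0) :
    (g 3 - g 2) * N 0 1 - (g 3 - g 1) * N 0 2 + (g 3 - g 0) * N 1 2 = 0 ∧
    (g 3 - g 2) * N 0 4 - (g 3 - g 1) * N 0 5 + (g 3 - g 0) * N 1 5 = 0 ∧
    (g 3 - g 2) * N 3 4 - (g 3 - g 1) * N 3 5 + (g 3 - g 0) * N 4 5 = 0 := by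
  have e := h.act_apply_eq 3
  have Y12 := h.act_four₀ hβ 1 2 (by decide) (by decide) (by decide) (by decide)
  have Y15 := h.act_four₀ hβ 1 5 (by decide) (by decide) (by decide) (by decide)
  have Y45 := h.act_four₀ hβ 4 5 (by decide) (by decide) (by decide) (by decide)
  have Y02 := h.act_four₁ hβ 0 2 (by decide) (by decide) (by decide) (by decide)
  have Y05 := h.act_four₁ hβ 0 5 (by decide) (by decide) (by decide) (by decide)
  have Y35 := h.act_four₁ hβ 3 5 (by decide) (by decide) (by decide) (by decide)
  have Y01 := h.act_four₂ hβ 0 1 (by decide) (by decide) (by decide) (by decide)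
  have Y04 := h.act_four₂ hβ 0 4 (by decide) (by decide) (by decide) (by decide)
  have Y34 := h.act_four₂ hβ 3 4 (by decide) (by decide) (by decide) (by decide)
  have Y14 := h.act_four₀ hβ 1 4 (by decide) (by decide) (by decide) (by decide)
  have e01 := e 0 1
  have e02 := e 0 2
  have e12 := e 1 2
  have e04 := e 0 4
  have e05 := e 0 5
  have e15 := e 1 5
  have e14 := e 1 4
  have e34 := e 3 4
  have e35 := e 3 5
  have e45 := e 4 5
  rw [Y12] at e12
  rw [Y15] at e15
  rw [Y45] at e45
  rw [Y02] at e02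
  rw [Y05] at e05
  rw [Y35] at e35
  rw [Y01] at e01
  rw [Y04] at e04
  rw [Y34] at e34
  rw [Y14, h.orth.h14] at e14
  clear e Y12 Y15 Y45 Y02 Y05 Y35 Y01 Y04 Y34 Y14
  have hc : (Fin.castSucc (3 : Fin 4)) = (3 : Fin 5) := rfl
  simp only [hc, act_apply, Fin.sum_univ_six, pt_apply, fst, snd] at e01 e02 e12 e04 e05 e15 e14 e34 e35 e45
  simp at e01 e02 e12 e04 e05 e15 e14 e34 e35 e45
  -- The three combinations evaluate on pairs of vectors in the common kernel of the two forms of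
  -- `u₃`. There `X · u₃` vanishes, so `X · u₄` agrees with `g₃ N`, while its entries are already
  -- known as multiples of those of `N`.
  refine ⟨mul_left_cancel₀ (hβ 3) ?_, mul_left_cancel₀ (hβ 3) ?_, mul_left_cancel₀ (hβ 3) ?_⟩
  · linear_combination e02 - e01 - e12
  · linear_combination e05 - e04 - e15 + e14
  · linear_combination e35 - e34 - e45

theorem coord_eqs (h : c.Deformation β g X N) (hβ : ∀ i, β i ≠ 0) (l : Fin 3) :
    (g 3 - g 0) * c.coord N 0 l + (g 3 - g 1) * c.coord N 1 l + (g 3 - g 2) * c.coord N 2 l = 0 := by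
  obtain ⟨e1, e2, e3⟩ := h.three_eqs hβ
  simp only [coord, Matrix.cons_val]
  linear_combination c.sigma l 2 * e1 - c.sigma l 1 * e2 + c.sigma l 0 * e3

/-- The equations coming from `u₄`. -/
theorem four_eqs (h : c.Deformation β g X N) (hβ : ∀ i, β i ≠ 0) :
    (- g 2 * N 0 4 - c.u * g 1 * N 0 5 + c.k * g 0 * N 1 2 = 0) ∧
    (g 2 * N 0 1 + c.u * g 1 * N 0 2 + g 0 * N 1 5 + c.e₂ * g 0 * N 1 2 = 0) ∧
    (c.k * g 1 * N 0 2 + g 1 * N 3 5 + c.e₂ * g 1 * N 0 5 = 0) ∧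
    (- c.k * c.v * g 1 * N 0 2 + c.e₁ * g 1 * N 0 5 - c.k * g 0 * N 1 5 + g 2 * N 3 4 = 0) ∧
    (c.v * c.e₂ * g 1 * N 0 2 + c.v * g 1 * N 0 5 + c.e₁ * g 1 * N 0 2 + g 2 * N 0 4
      + c.e₂ * g 0 * N 1 5 + g 0 * N 4 5 = 0) := by
  have Y12 := h.act_four₀ hβ 1 2 (by decide) (by decide) (by decide) (by decide)
  have Y15 := h.act_four₀ hβ 1 5 (by decide) (by decide) (by decide) (by decide)
  have Y24 := h.act_four₀ hβ 2 4 (by decide) (by decide) (by decide) (by decide)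
  have Y25 := h.act_four₀ hβ 2 5 (by decide) (by decide) (by decide) (by decide)
  have Y45 := h.act_four₀ hβ 4 5 (by decide) (by decide) (by decide) (by decide)
  have Y02 := h.act_four₁ hβ 0 2 (by decide) (by decide) (by decide) (by decide)
  have Y03 := h.act_four₁ hβ 0 3 (by decide) (by decide) (by decide) (by decide)
  have Y05 := h.act_four₁ hβ 0 5 (by decide) (by decide) (by decide) (by decide)
  have Y23 := h.act_four₁ hβ 2 3 (by decide) (by decide) (by decide) (by decide)
  have Y35 := h.act_four₁ hβ 3 5 (by decide) (by decide) (by decide) (by decide)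
  have Y01 := h.act_four₂ hβ 0 1 (by decide) (by decide) (by decide) (by decide)
  have Y04 := h.act_four₂ hβ 0 4 (by decide) (by decide) (by decide) (by decide)
  have Y13 := h.act_four₂ hβ 1 3 (by decide) (by decide) (by decide) (by decide)
  have Y34 := h.act_four₂ hβ 3 4 (by decide) (by decide) (by decide) (by decide)
  rw [h.orth.h24] at Y24
  rw [h.orth.h25] at Y25
  rw [h.orth.h03] at Y03
  rw [h.orth.h23] at Y23
  rw [h.orth.h13] at Y13
  simp only [act_apply, Fin.sum_univ_six, pt_apply, fst, snd] at *
  simp at Y12 Y15 Y24 Y25 Y45 Y02 Y03 Y05 Y23 Y35 Y01 Y04 Y13 Y34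
  -- The same device for `u₄`: `X · u₄` vanishes on pairs from the common kernel of the two forms of
  -- `u₄`. For instance the first equation pairs `ε₁ + u ε₂` with `ε₃ + k ε₂`.
  refine ⟨?_, ?_, ?_, ?_, ?_⟩
  · linear_combination -Y13 - c.u * Y23 - c.k * Y12
  · linear_combination -Y01 - c.u * Y02 - Y15 - c.u * Y25 - c.e₂ * Y12
  · linear_combination -c.k * Y02 - Y03 - c.k * Y25 - Y35 + c.e₂ * Y23
  · linear_combination c.k * c.v * Y02 + c.v * Y03 + c.e₁ * Y23 - c.k * Y24 - Y34
  · linear_combination -c.v * c.e₂ * Y02 - c.v * Y05 - c.e₁ * Y02 - c.e₁ * Y25 - Y04 + c.e₂ * Y24 - Y45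

end Deformation

end Config

/-! ### ### Planes with a three-dimensional space of deformations -/

namespace Config

variable {c : Config}

theorem General.eq_zero_of_forall (hc : c.General) {x y z : ℂ}
    (h : ∀ l, c.sigma l 0 * x + c.sigma l 1 * y + c.sigma l 2 * z = 0) : x = 0 ∧ y = 0 ∧ z = 0 := by
  have := Matrix.eq_zero_of_mulVec_eq_zero hc.det_ne (v := ![x, y, z]) (by
    ext l
    simp only [Matrix.mulVec, dotProduct, Fin.sum_univ_three, Pi.zero_apply]
    exact h l)
  exact ⟨congrFun this 0, congrFun this 1, congrFun this 2⟩

theorem Orthogonal.eq_zero {N : Matrix (Fin 6) (Fin 6) ℂ} (h : c.Orthogonal N)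
    (h01 : N 0 1 = 0) (h02 : N 0 2 = 0) (h12 : N 1 2 = 0) (h04 : N 0 4 = 0) (h05 : N 0 5 = 0)
    (h15 : N 1 5 = 0) (h34 : N 3 4 = 0) (h35 : N 3 5 = 0) (h45 : N 4 5 = 0) : N = 0 := by
  have hu : ∀ a b, a < b → N a b = 0 := by
    intro a b hab
    have h03 := h.h03
    have h14 := h.h14
    have h25 := h.h25
    have h24 : N 2 4 = 0 := by rw [h.h24, h15, neg_zero]
    have h23 : N 2 3 = 0 := by rw [h.h23, h05, neg_zero]
    have h13 : N 1 3 = 0 := by rw [h.h13, h04, neg_zero]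
    fin_cases a <;> fin_cases b <;> first | assumption | exact absurd hab (by decide)
  ext a b
  rcases lt_trichotomy a b with hab | rfl | hab
  · exact hu a b hab
  · have := h.skew a a
    simp only [Matrix.zero_apply]
    linear_combination this / 2
  · rw [h.skew, hu b a hab]; simp

theorem Orthogonal.eq_zero_of_coord (hc : c.General) {N : Matrix (Fin 6) (Fin 6) ℂ}
    (h : c.Orthogonal N) (h0 : ∀ k l, c.coord N k l = 0) : N = 0 := by
  have b0 := hc.eq_zero_of_forall (x := N 4 5) (y := -N 1 5) (z := N 1 2) fun l => by
    have := h0 0 l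
    simp only [coord, Matrix.cons_val] at this
    linear_combination this
  have b1 := hc.eq_zero_of_forall (x := -N 3 5) (y := N 0 5) (z := -N 0 2) fun l => by
    have := h0 1 l
    simp only [coord, Matrix.cons_val] at this
    linear_combination this
  have b2 := hc.eq_zero_of_forall (x := N 3 4) (y := -N 0 4) (z := N 0 1) fun l => by
    have := h0 2 l
    simp only [coord, Matrix.cons_val] at this
    linear_combination this
  simp only [neg_eq_zero] at b0 b1 b2
  exact h.eq_zero b2.2.2 b1.2.2 b0.2.2 b2.2.1 b1.2.1 b0.2.1 b2.1 b1.1 b0.1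

/-- Killing `u₀, …, u₃` puts `X` in `𝔰𝔩₂` acting on the factor `ℂ²`. Killing `u₄` then means killing
the three binary quadratic forms `σₗ`, which span `S²ℂ²` because `det σ ≠ 0`. -/
theorem General.eq_zero_of_act (hc : c.General) {X : Matrix (Fin 6) (Fin 6) ℂ}
    (h : ∀ i, act X (c.pt i) = 0) : X = 0 := by
  have e : ∀ i a b, act X (c.pt i) a b = 0 := fun i a b => by rw [h]; rfl
  simp only [act_apply, Fin.sum_univ_six] at e
  have z1 := e 0 0 1
  have z2 := e 0 0 2
  have z3 := e 0 0 4
  have z4 := e 0 0 5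
  have z5 := e 0 3 1
  have z6 := e 0 3 2
  have z7 := e 0 3 4
  have z8 := e 0 3 5
  have z9 := e 0 0 3
  have o1 := e 1 1 0
  have o2 := e 1 1 2
  have o3 := e 1 1 3
  have o4 := e 1 1 5
  have o5 := e 1 4 0
  have o6 := e 1 4 2
  have o7 := e 1 4 3
  have o8 := e 1 4 5
  have o9 := e 1 1 4
  have t1 := e 2 2 0
  have t2 := e 2 2 1
  have t3 := e 2 2 3
  have t4 := e 2 2 4
  have t5 := e 2 5 0
  have t6 := e 2 5 1
  have t7 := e 2 5 3
  have t8 := e 2 5 4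
  have t9 := e 2 2 5
  have r1 := e 3 0 1
  have r2 := e 3 0 2
  have r3 := e 3 0 4
  have r4 := e 3 0 5
  have r7 := e 3 3 4
  have r8 := e 3 3 5
  have f1 := e 4 1 2
  have f5 := e 4 0 2
  have f7 := e 4 3 2
  have f9 := e 4 0 1
  clear e h
  simp [pt_apply, fst, snd] at z1 z2 z3 z4 z5 z6 z7 z8 z9 o1 o2 o3 o4 o5 o6 o7 o8 o9 t1 t2 t3 t4 t5 t6 t7 t8 t9
  simp [pt_apply, fst, snd, z1, z2, z3, z4, z5, z6, z7, z8, o1, o2, o3, o4, o5, o6, o7, o8, t1, t2, t3, t4, t5, t6, t7, t8] at r1 r2 r3 r4 r7 r8 f1 f5 f7 f9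
  -- For `X` in `𝔰𝔩₂`, `2 X₀₀` and `X₃₀` express the leading coefficient of `X · σₗ` through the
  -- coefficients of `σₗ`. It vanishes for all three `l`.
  obtain ⟨ha, hb, -⟩ := hc.eq_zero_of_forall (x := 2 * X 0 0) (y := X 3 0) (z := 0) fun l => by
    fin_cases l <;> simp [sigma]
    · rw [← mul_eq_zero]
      linear_combination f1 - c.v * r1 + c.u * r2
    · linear_combination -f5 - t9 + r4 + c.e₂ * r2
    · linear_combination f9 + c.e₁ * (-r1) - c.u * (o9 - r3)
  have x00 : X 0 0 = 0 := by linear_combination ha / 2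
  have x41 : X 4 1 = 0 := by linear_combination r1 + hb
  have x52 : X 5 2 = 0 := by linear_combination r2 + hb
  have x03 : X 0 3 = 0 := by linear_combination -f7 - c.k * x52
  have x14 : X 1 4 = 0 := by linear_combination x03 - r7
  have x25 : X 2 5 = 0 := by linear_combination x03 - r8
  have x33 : X 3 3 = 0 := by linear_combination z9 - x00
  have x44 : X 4 4 = 0 := by linear_combination r3 - x00
  have x55 : X 5 5 = 0 := by linear_combination r4 - x00
  have x11 : X 1 1 = 0 := by linear_combination o9 - x44
  have x22 : X 2 2 = 0 := by linear_combination t9 - x55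
  ext a b
  fin_cases a <;> fin_cases b <;> assumption

namespace Deformation

variable {β g : Fin 4 → ℂ} {X N : Matrix (Fin 6) (Fin 6) ℂ}

/-- Each entry avoids one of the index pairs `{0,3}`, `{1,4}`, `{2,5}`, so `N = 0` forces `X · u₄ =
0`, and then `X · uᵢ = 0` for every `i`. This makes `X ↦ N` injective on a family of deformations.
-/
theorem eq_zero (h : c.Deformation β g X N) (hc : c.General) (hβ : ∀ i, β i ≠ 0) (hN : N = 0) :
    X = 0 := by
  subst hN
  have h4 : act X (c.pt 4) = 0 := by
    ext a b
    by_cases h0 : a ≠ 0 ∧ a ≠ 3 ∧ b ≠ 0 ∧ b ≠ 3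
    · simpa using h.act_four₀ hβ a b h0.1 h0.2.1 h0.2.2.1 h0.2.2.2
    by_cases h1 : a ≠ 1 ∧ a ≠ 4 ∧ b ≠ 1 ∧ b ≠ 4
    · simpa using h.act_four₁ hβ a b h1.1 h1.2.1 h1.2.2.1 h1.2.2.2
    · have h2 : a ≠ 2 ∧ a ≠ 5 ∧ b ≠ 2 ∧ b ≠ 5 := by revert a b; decide
      simpa using h.act_four₂ hβ a b h2.1 h2.2.1 h2.2.2.1 h2.2.2.2
  refine hc.eq_zero_of_act fun i => ?_
  induction i using Fin.lastCases with
  | last => exact h4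
  | cast i =>
    have := h.act_eq i
    rw [space, act_add, act_smul, h4] at this
    simpa using this

end Deformation

/-- The planes over which there is a three-dimensional space of infinitesimal symmetries are the
five planes of the configuration. -/
theorem General.plane_of_deformation (hc : c.General) {β g : Fin 4 → ℂ} (hβ : ∀ i, β i ≠ 0)
    (X N : (Fin 3 → ℂ) →ₗ[ℂ] Matrix (Fin 6) (Fin 6) ℂ) (hX : Function.Injective X)
    (h : ∀ x, c.Deformation β g (X x) (N x)) :
    (∃ i, ∀ j, j ≠ i → g j = 0) ∨ ∀ i, g i = g 3 := by
  have fin : ∀ φ ψ : Module.Dual ℂ (Matrix (Fin 6) (Fin 6) ℂ),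
      (∀ x, φ (N x) = 0 → ψ (N x) = 0 → N x = 0) → False := fun φ ψ hφψ =>
    not_injective_prod_of_dual (φ := φ ∘ₗ N) (ψ := ψ ∘ₗ N) fun x hx hy =>
      (injective_iff_map_eq_zero X).mp hX x ((h x).eq_zero hc hβ (hφψ x hx hy))
  have entry : ∀ a b, ∃ φ : Module.Dual ℂ (Matrix (Fin 6) (Fin 6) ℂ), ∀ A, φ A = A a b :=
    fun a b => ⟨LinearMap.proj b ∘ₗ LinearMap.proj a, fun A => rfl⟩
  have fin' : ∀ a b a' b', (∀ x, N x a b = 0 → N x a' b' = 0 → N x = 0) → False := by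
    intro a b a' b' hx
    obtain ⟨φ, hφ⟩ := entry a b
    obtain ⟨ψ, hψ⟩ := entry a' b'
    exact fin φ ψ fun x h1 h2 => hx x (by rwa [hφ] at h1) (by rwa [hψ] at h2)
  -- For `d` with two nonzero and two distinct entries, `coord_eqs` cuts the five-dimensional space
  -- of orthogonal `N` down to dimension at most two, against the injectivity of `N`. Only two kinds
  -- of `d` remain: at most one nonzero entry, or all entries equal.
  set d : Fin 3 → ℂ := ![g 3 - g 0, g 3 - g 1, g 3 - g 2] with hd
  by_cases h1 : ∃ i, ∀ j, j ≠ i → d j = 0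
  · obtain ⟨i, hi⟩ := h1
    by_cases h3 : g 3 = 0
    · left
      fin_cases i
      · refine ⟨0, ?_⟩
        have a1 := hi 1 (by decide)
        have a2 := hi 2 (by decide)
        simp [hd] at a1 a2
        simp [Fin.forall_fin_succ, h3]
        exact ⟨by linear_combination h3 - a1, by linear_combination h3 - a2⟩
      · refine ⟨1, ?_⟩
        have a1 := hi 0 (by decide)
        have a2 := hi 2 (by decide)
        simp [hd] at a1 a2
        simp [Fin.forall_fin_succ, h3]
        exact ⟨by linear_combination h3 - a1, by linear_combination h3 - a2⟩
      · refine ⟨2, ?_⟩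
        have a1 := hi 0 (by decide)
        have a2 := hi 1 (by decide)
        simp [hd] at a1 a2
        simp [Fin.forall_fin_succ, h3]
        exact ⟨by linear_combination h3 - a1, by linear_combination h3 - a2⟩
    by_cases h4 : d i = 0
    · right
      have hall : ∀ j, d j = 0 := fun j => by
        by_cases hj : j = i
        · rw [hj, h4]
        · exact hi j hj
      have a0 := hall 0
      have a1 := hall 1
      have a2 := hall 2
      simp [hd] at a0 a1 a2
      simp [Fin.forall_fin_succ]
      exact ⟨by linear_combination -a0, by linear_combination -a1, by linear_combination -a2⟩
    -- Here three of the `gⱼ` equal `g₃ ≠ 0` and one differs. Together with `four_eqs`, two entries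
    -- of `N` determine all the others, which is too few for a three-dimensional family.
    exfalso
    fin_cases i
    · have a1 := hi 1 (by decide)
      have a2 := hi 2 (by decide)
      simp [hd] at a1 a2 h4
      have a1 : g 1 = g 3 := by linear_combination -a1
      have a2 : g 2 = g 3 := by linear_combination -a2
      refine fin' 0 2 0 5 fun x hx hy => ?_
      obtain ⟨t1, t2, t3⟩ := (h x).three_eqs hβ
      obtain ⟨e1, e2, e3, e4, e5⟩ := (h x).four_eqs hβ
      simp only [a1, a2, hx, hy, sub_self, zero_mul, mul_zero, zero_add, add_zero, mul_eq_zero, h4, h3,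
        false_or, sub_zero, zero_sub] at t1 t2 t3 e1 e2 e3 e4 e5
      simp [t1, t2, t3, h3] at e1 e2 e3 e4 e5
      exact (h x).orth.eq_zero e2 hx t1 e1 hy t2 e4 e3 t3
    · have a1 := hi 0 (by decide)
      have a2 := hi 2 (by decide)
      simp [hd] at a1 a2 h4
      have a1 : g 0 = g 3 := by linear_combination -a1
      have a2 : g 2 = g 3 := by linear_combination -a2
      refine fin' 1 2 1 5 fun x hx hy => ?_
      obtain ⟨t1, t2, t3⟩ := (h x).three_eqs hβ
      obtain ⟨e1, e2, e3, e4, e5⟩ := (h x).four_eqs hβ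
      simp [a1, a2, hx, hy, h4] at t1 t2 t3
      simp [a1, a2, hx, hy, t1, t2, t3, h3] at e1 e2 e3 e4 e5
      simp [e1, h3] at e5
      exact (h x).orth.eq_zero e2 t1 hx e1 t2 hy e4 t3 e5
    · have a1 := hi 0 (by decide)
      have a2 := hi 1 (by decide)
      simp [hd] at a1 a2 h4
      have a1 : g 0 = g 3 := by linear_combination -a1
      have a2 : g 1 = g 3 := by linear_combination -a2
      refine fin' 0 2 1 2 fun x hx hy => ?_
      obtain ⟨t1, t2, t3⟩ := (h x).three_eqs hβ
      obtain ⟨e1, e2, e3, e4, e5⟩ := (h x).four_eqs hβ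
      simp [a1, a2, hx, hy, h4] at t1 t2 t3
      simp [a1, a2, hx, hy, t1, t2, t3, h3, hc.u_ne] at e1 e2 e3 e4 e5
      simp [e1, e2, h3] at e3 e4 e5
      exact (h x).orth.eq_zero t1 hx hy t2 e1 e2 t3 e3 e5
  by_cases h2 : d 0 = d 1 ∧ d 1 = d 2
  · obtain ⟨a1, a2⟩ := h2
    simp [hd] at a1 a2
    have hd0 : g 3 - g 0 ≠ 0 := by
      intro h0
      refine h1 ⟨0, ?_⟩
      simp [Fin.forall_fin_succ, hd]
      exact ⟨by linear_combination h0 + a1, by linear_combination h0 + a1 + a2⟩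
    by_cases h0 : g 0 = 0
    · left
      refine ⟨3, ?_⟩
      simp [Fin.forall_fin_succ]
      exact ⟨h0, by rw [← a1, h0], by rw [← a2, ← a1, h0]⟩
    -- Now `g₀ = g₁ = g₂` is nonzero and differs from `g₃`; two entries again determine `N`, this
    -- time using `1 + u ≠ 0`.
    exfalso
    rw [← a1] at a2
    refine fin' 1 2 1 5 fun x hx hy => ?_
    obtain ⟨t1, t2, t3⟩ := (h x).three_eqs hβ
    obtain ⟨e1, e2, e3, e4, e5⟩ := (h x).four_eqs hβ
    have hu := hc.u1_ne
    simp only [← a1, ← a2, hx, hy] at t1 t2 t3 e1 e2 e3 e4 e5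
    have s1 : N x 0 2 = N x 0 1 := mul_left_cancel₀ hd0 (by linear_combination -t1)
    have s2 : N x 0 5 = N x 0 4 := mul_left_cancel₀ hd0 (by linear_combination -t2)
    have h01 : N x 0 1 = 0 := by
      have : (1 + c.u) * g 0 * N x 0 1 = 0 := by rw [s1] at e2; linear_combination e2
      simpa [hu, h0] using this
    have h04 : N x 0 4 = 0 := by
      have : (1 + c.u) * g 0 * N x 0 4 = 0 := by rw [s2] at e1; linear_combination -e1
      simpa [hu, h0] using this
    rw [h01] at s1
    rw [h04] at s2
    simp [s1, s2, h04, h0] at e3 e4 e5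
    exact (h x).orth.eq_zero h01 s1 hx h04 s2 hy e4 e3 e5
  exfalso
  obtain ⟨k, l, k', l', hkl⟩ := exists_two_entries d h1 h2
  have coordl : ∀ k l, ∃ φ : Module.Dual ℂ (Matrix (Fin 6) (Fin 6) ℂ), ∀ A, φ A = c.coord A k l := by
    intro k l
    refine ⟨{ toFun := fun A => c.coord A k l, map_add' := ?_, map_smul' := ?_ }, fun A => rfl⟩
    · intro A B
      fin_cases k <;> simp [coord] <;> ring
    · intro r A
      fin_cases k <;> simp [coord] <;> ring
  obtain ⟨φ, hφ⟩ := coordl k l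
  obtain ⟨ψ, hψ⟩ := coordl k' l'
  refine fin φ ψ fun x hx hy => ?_
  rw [hφ] at hx
  rw [hψ] at hy
  exact (h x).orth.eq_zero_of_coord hc
    (hkl _ (h x).orth.coord_diag (h x).orth.coord_sum ((h x).coord_eqs hβ) hx hy)

end Config

/-! ### ### The matrix `M` as a combination of the five points -/

theorem tripleCubic_eq (a : Triple → ℂ) (w : Fin 5 → Poly) : tripleCubic a w =
    MvPolynomial.C (a ⟨(0, 1, 2), by decide⟩) * w 0 * w 1 * w 2
    + MvPolynomial.C (a ⟨(0, 1, 3), by decide⟩) * w 0 * w 1 * w 3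
    + MvPolynomial.C (a ⟨(0, 1, 4), by decide⟩) * w 0 * w 1 * w 4
    + MvPolynomial.C (a ⟨(0, 2, 3), by decide⟩) * w 0 * w 2 * w 3
    + MvPolynomial.C (a ⟨(0, 2, 4), by decide⟩) * w 0 * w 2 * w 4
    + MvPolynomial.C (a ⟨(0, 3, 4), by decide⟩) * w 0 * w 3 * w 4
    + MvPolynomial.C (a ⟨(1, 2, 3), by decide⟩) * w 1 * w 2 * w 3
    + MvPolynomial.C (a ⟨(1, 2, 4), by decide⟩) * w 1 * w 2 * w 4
    + MvPolynomial.C (a ⟨(1, 3, 4), by decide⟩) * w 1 * w 3 * w 4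
    + MvPolynomial.C (a ⟨(2, 3, 4), by decide⟩) * w 2 * w 3 * w 4 := by
  have hu : (Finset.univ : Finset Triple) = {⟨(0, 1, 2), by decide⟩, ⟨(0, 1, 3), by decide⟩,
      ⟨(0, 1, 4), by decide⟩, ⟨(0, 2, 3), by decide⟩, ⟨(0, 2, 4), by decide⟩,
      ⟨(0, 3, 4), by decide⟩, ⟨(1, 2, 3), by decide⟩, ⟨(1, 2, 4), by decide⟩,
      ⟨(1, 3, 4), by decide⟩, ⟨(2, 3, 4), by decide⟩} := by decide
  rw [tripleCubic, hu]
  repeat rw [Finset.sum_insert (by decide)]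
  rw [Finset.sum_singleton]
  ring

/-- The configuration of five points attached to `(a, u)`. -/
def configOf (a : Triple → ℂ) (u : ℂ) : Config where
  u := u
  v := -(1 + a ⟨(0, 2, 4), by decide⟩ - a ⟨(0, 3, 4), by decide⟩) - u
  k := a ⟨(1, 2, 4), by decide⟩
  e₁ := a ⟨(0, 2, 4), by decide⟩ + a ⟨(1, 2, 4), by decide⟩ - a ⟨(2, 3, 4), by decide⟩
  e₂ := 1 + a ⟨(1, 2, 4), by decide⟩ - a ⟨(1, 3, 4), by decide⟩

namespace HomParam

/-- The configuration attached to a point of the parameter space. -/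
def config (q : HomParam) : Config := configOf q.a q.u

theorem a024_eq (q : HomParam) : q.a ⟨(0, 2, 4), by decide⟩ = q.config.u * q.config.v := by
  have := q.mem_A9'.2.2.2.2
  simp only [config, configOf] at this ⊢
  linear_combination this

theorem a_eq_one (q : HomParam) (t : Triple) (ht : t.1.2.2 ≤ 3) : q.a t = 1 := q.mem_A9'.2.1 t ht

theorem a014_eq (q : HomParam) : q.a ⟨(0, 1, 4), by decide⟩ = 1 := q.mem_A9'.1

theorem b_ne (q : HomParam) (i : Fin 5) : q.b i ≠ 0 := by
  obtain ⟨r, hr⟩ := Projectivization.exists_smul_eq_mk_rep ℂ q.b q.b_ne_zero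
  have := q.mem_A9'.2.2.1 i
  simp only at this
  rw [← hr] at this
  intro h
  exact this (by simp [h])

/-- The coefficients of `w₄` with respect to `w₀, …, w₃`. -/
def β (q : HomParam) (i : Fin 4) : ℂ := q.b 4 / q.b i.castSucc

theorem β_ne (q : HomParam) (i : Fin 4) : q.β i ≠ 0 := div_ne_zero (q.b_ne _) (q.b_ne _)

/-- The coordinates `w₀, …, w₃` on `ℂ⁴`. -/
def coordEquiv (q : HomParam) : (Fin 4 → ℂ) ≃ₗ[ℂ] (Fin 4 → ℂ) :=
  Matrix.toLinearEquiv' (q.P : Matrix (Fin 4) (Fin 4) ℂ)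
    ⟨(q.P⁻¹ : Matrix (Fin 4) (Fin 4) ℂ), by simp, by simp⟩

theorem coordEquiv_apply (q : HomParam) (z : Fin 4 → ℂ) :
    q.coordEquiv z = (q.P : Matrix (Fin 4) (Fin 4) ℂ).mulVec z := rfl

theorem eval_w_castSucc (q : HomParam) (z : Fin 4 → ℂ) (i : Fin 4) :
    MvPolynomial.eval z (q.w i.castSucc) = q.coordEquiv z i := by
  simp [w, fiveForms, coordEquiv_apply, Matrix.mulVec, dotProduct]

theorem eval_w_last (q : HomParam) (z : Fin 4 → ℂ) :
    MvPolynomial.eval z (q.w 4) = ∑ i, q.β i * q.coordEquiv z i := by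
  change MvPolynomial.eval z (q.w (Fin.last 4)) = _
  simp only [w, fiveForms, Fin.snoc_last]
  simp [coordEquiv_apply, Matrix.mulVec, dotProduct, β]

/-- Decomposability of `M₄` depends on the equation for `u` only through the entries `(1,4)` and
`(4,1)`, where `a₀₂₄` has to equal `u v`. -/
theorem matrixM4_eq (q : HomParam) : matrixM4 q.a q.u = q.config.pt 4 := by
  have h := q.a024_eq
  simp only [config, configOf] at h
  ext i j
  fin_cases i <;> fin_cases j <;>
    simp [matrixM4, Config.pt_apply, Config.fst, Config.snd, config, configOf] <;>
    first | done | ring1 | linear_combination h | linear_combination -h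

theorem valueAt_M (q : HomParam) (z : Fin 4 → ℂ) :
    valueAt q.M z = ∑ i, MvPolynomial.eval z (q.w i) • q.config.pt i := by
  have h : valueAt q.M z = valueAt (matrixM0123 q.w) z +
      MvPolynomial.eval z (q.w 4) • q.config.pt 4 := by
    rw [← matrixM4_eq]
    ext i j
    simp [valueAt, M]
  rw [h, Fin.sum_univ_castSucc]
  congr 1
  ext i j
  fin_cases i <;> fin_cases j <;>
    simp [valueAt, matrixM0123, Config.pt_apply, Config.fst, Config.snd, Fin.sum_univ_four,
      Matrix.sum_apply] <;> ring

theorem valueAt_M_eq_space (q : HomParam) (z : Fin 4 → ℂ) :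
    valueAt q.M z = ∑ i, q.coordEquiv z i • q.config.space q.β i := by
  rw [valueAt_M, Fin.sum_univ_castSucc]
  have : Fin.last 4 = (4 : Fin 5) := rfl
  simp only [eval_w_castSucc, this, eval_w_last, Config.space, smul_add, Finset.sum_add_distrib,
    Finset.sum_smul, smul_smul, mul_comm]

/-- After substituting `a₀₂₄ = u v` and `a₀₃₄ = (1 + u)(1 + v)`, both sides are polynomials in the
`wᵢ` and the free parameters of the configuration. -/
theorem pf6_M (q : HomParam) : pf6 q.M = -q.cubic := by
  have hM : q.M = matrixM0123 q.w + q.w 4 • (q.config.pt 4).map MvPolynomial.C := by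
    rw [← matrixM4_eq]; rfl
  have h034 : q.a ⟨(0, 3, 4), by decide⟩ =
      1 + q.config.u * q.config.v + q.config.u + q.config.v := by
    rw [← a024_eq]; simp only [config, configOf]; ring
  have h124 : q.a ⟨(1, 2, 4), by decide⟩ = q.config.k := rfl
  have h134 : q.a ⟨(1, 3, 4), by decide⟩ = 1 + q.config.k - q.config.e₂ := by
    simp only [config, configOf]; ring
  have h234 : q.a ⟨(2, 3, 4), by decide⟩ =
      q.config.u * q.config.v + q.config.k - q.config.e₁ := by
    rw [← a024_eq]; simp only [config, configOf]; ring
  rw [cubic, tripleCubic_eq, q.a014_eq, q.a024_eq, h034, h124, h134, h234,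
    q.a_eq_one ⟨(0, 1, 2), by decide⟩ (by decide), q.a_eq_one ⟨(0, 1, 3), by decide⟩ (by decide),
    q.a_eq_one ⟨(0, 2, 3), by decide⟩ (by decide), q.a_eq_one ⟨(1, 2, 3), by decide⟩ (by decide), hM]
  simp [pf6, pf4, matrixM0123, Config.pt_apply, Config.fst, Config.snd]
  ring

end HomParam

/-! ### ### Infinitesimal symmetries from a Segre family -/

/-- The isomorphism `ℂ³ ⊕ ℂ³ ≃ ℂ⁶` given by `s` and `t`. -/
def frameEquiv (s t : (Fin 3 → ℂ) →ₗ[ℂ] (Fin 6 → ℂ)) (h : Function.Bijective (s.coprod t)) :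
    (Fin 3 ⊕ Fin 3 → ℂ) ≃ₗ[ℂ] (Fin 6 → ℂ) :=
  (LinearEquiv.sumArrowLequivProdArrow (Fin 3) (Fin 3) ℂ ℂ).trans (LinearEquiv.ofBijective _ h)

/-- The matrix of the element of `𝔰𝔩₂` with coordinates `x`, acting on `ℂ² ⊗ ℂ³`. -/
def slMatrix : (Fin 3 → ℂ) →ₗ[ℂ] Matrix (Fin 3 ⊕ Fin 3) (Fin 3 ⊕ Fin 3) ℂ where
  toFun x := Matrix.fromBlocks (x 0 • 1) (x 1 • 1) (x 2 • 1) (-(x 0 • 1))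
  map_add' x y := by
    rw [Matrix.fromBlocks_add]
    simp [add_smul, add_comm]
  map_smul' r x := by
    rw [Matrix.fromBlocks_smul]
    simp [mul_smul]

theorem slMatrix_injective : Function.Injective slMatrix := by
  rw [injective_iff_map_eq_zero]
  intro x hx
  have h0 := congrFun (congrFun hx (Sum.inl 0)) (Sum.inl 0)
  have h1 := congrFun (congrFun hx (Sum.inl 0)) (Sum.inr 0)
  have h2 := congrFun (congrFun hx (Sum.inr 0)) (Sum.inl 0)
  simp [slMatrix] at h0 h1 h2
  ext i
  fin_cases i <;> assumption

theorem transpose_mul_toMatrix'_apply (A : Matrix (Fin 6) (Fin 6) ℂ)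
    (s t : (Fin 3 → ℂ) →ₗ[ℂ] (Fin 6 → ℂ)) (i j : Fin 3) :
    ((LinearMap.toMatrix' s).transpose * A * LinearMap.toMatrix' t) i j =
      s (Pi.single i 1) ⬝ᵥ A.mulVec (t (Pi.single j 1)) := by
  rw [Matrix.mul_assoc]
  simp [Matrix.mul_apply, dotProduct, Matrix.mulVec, LinearMap.toMatrix'_apply]

/-- In the frame `(s, t)` the forms `M(z)`, `z ∈ H`, become `[0 G; -G 0]`, the area form of `ℂ²`
tensored with `G`. This is annihilated by `𝔰𝔩₂ ⊗ 1`, which supplies the three-dimensional space of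
traceless symmetries. -/
theorem exists_act_of_isSegreFamily {M : PolyMatrix} {H : SubspaceC4}
    (hS : IsSegreFamily (isotropicFibre M H)) :
    ∃ X : (Fin 3 → ℂ) →ₗ[ℂ] Matrix (Fin 6) (Fin 6) ℂ, Function.Injective X ∧
      ∀ x, (X x).trace = 0 ∧ ∀ z ∈ H, Config.act (X x) (valueAt M z) = 0 := by
  obtain ⟨s, t, hst, hR⟩ := hS
  have hmem : ∀ c d : ℂ, (c ≠ 0 ∨ d ≠ 0) → LinearMap.range (c • s + d • t) ∈ isotropicFibre M H :=
    fun c d hcd => by rw [hR]; exact ⟨c, d, hcd, rfl⟩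
  have hiso : ∀ c d : ℂ, (c ≠ 0 ∨ d ≠ 0) → ∀ z ∈ H, ∀ x y,
      (c • s x + d • t x) ⬝ᵥ (valueAt M z).mulVec (c • s y + d • t y) = 0 := by
    intro c d hcd z hz x y
    exact (hmem c d hcd).2 z hz _ ⟨x, rfl⟩ _ ⟨y, rfl⟩
  set S := LinearMap.toMatrix' s
  set T := LinearMap.toMatrix' t
  set E : Matrix (Fin 6) (Fin 3 ⊕ Fin 3) ℂ := LinearMap.toMatrix' (frameEquiv s t hst : _ →ₗ[ℂ] _)
  set F : Matrix (Fin 3 ⊕ Fin 3) (Fin 6) ℂ :=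
    LinearMap.toMatrix' ((frameEquiv s t hst).symm : _ →ₗ[ℂ] _)
  have hEF : E * F = 1 := by
    rw [← LinearMap.toMatrix'_comp]; simp
  have hFE : F * E = 1 := by
    rw [← LinearMap.toMatrix'_comp]; simp
  have hE : E = Matrix.fromCols S T := by
    ext a i
    cases i with
    | inl i =>
      have e : (Equiv.sumArrowEquivProdArrow (Fin 3) (Fin 3) ℂ) (Pi.single (Sum.inl i) 1) =
          (Pi.single i 1, 0) := by
        ext j <;> simp [Equiv.sumArrowEquivProdArrow, Pi.single_apply]
      simp [E, S, frameEquiv, LinearMap.toMatrix'_apply, LinearEquiv.sumArrowLequivProdArrow, e]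
    | inr i =>
      have e : (Equiv.sumArrowEquivProdArrow (Fin 3) (Fin 3) ℂ) (Pi.single (Sum.inr i) 1) =
          (0, Pi.single i 1) := by
        ext j <;> simp [Equiv.sumArrowEquivProdArrow, Pi.single_apply]
      simp [E, T, frameEquiv, LinearMap.toMatrix'_apply, LinearEquiv.sumArrowLequivProdArrow, e]
  -- The members `(1:0)` and `(0:1)` of the family kill the diagonal blocks; the member `(1:1)`
  -- makes the off-diagonal blocks opposite.
  have hss : ∀ z ∈ H, S.transpose * valueAt M z * S = 0 := fun z hz => by
    ext i j
    have := hiso 1 0 (by simp) z hz (Pi.single i 1) (Pi.single j 1)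
    refine (transpose_mul_toMatrix'_apply _ s s i j).trans ?_
    simpa using this
  have htt : ∀ z ∈ H, T.transpose * valueAt M z * T = 0 := fun z hz => by
    ext i j
    have := hiso 0 1 (by simp) z hz (Pi.single i 1) (Pi.single j 1)
    refine (transpose_mul_toMatrix'_apply _ t t i j).trans ?_
    simpa using this
  have hst' : ∀ z ∈ H, T.transpose * valueAt M z * S = -(S.transpose * valueAt M z * T) :=
    fun z hz => by
    ext i j
    have := hiso 1 1 (by simp) z hz (Pi.single i 1) (Pi.single j 1)
    have h1 := hiso 1 0 (by simp) z hz (Pi.single i 1) (Pi.single j 1)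
    have h2 := hiso 0 1 (by simp) z hz (Pi.single i 1) (Pi.single j 1)
    simp [Matrix.mulVec_add] at this h1 h2
    have e1 := transpose_mul_toMatrix'_apply (valueAt M z) t s i j
    have e2 := transpose_mul_toMatrix'_apply (valueAt M z) s t i j
    refine e1.trans (Eq.trans ?_ (congrArg Neg.neg e2).symm)
    linear_combination this - h1 - h2
  refine ⟨{ toFun := fun x => E * slMatrix x * F, map_add' := fun x y => ?_,
            map_smul' := fun r x => ?_ }, ?_, ?_⟩
  · simp [Matrix.mul_add, Matrix.add_mul]
  · simp
  · intro x y hxy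
    apply slMatrix_injective
    have := congrArg (fun A => F * A * E) hxy
    simp only [LinearMap.coe_mk, AddHom.coe_mk] at this
    simpa [Matrix.mul_assoc, hFE, ← Matrix.mul_assoc F E] using this
  · intro x
    simp only [LinearMap.coe_mk, AddHom.coe_mk]
    refine ⟨?_, fun z hz => ?_⟩
    · rw [Matrix.trace_mul_comm, ← Matrix.mul_assoc, hFE, Matrix.one_mul]
      simp [slMatrix, Matrix.trace, Fintype.sum_sum_type]
    · have hG : E.transpose * valueAt M z * E =
          Matrix.fromBlocks 0 (S.transpose * valueAt M z * T) (-(S.transpose * valueAt M z * T)) 0 := by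
        rw [hE, Matrix.transpose_fromCols, Matrix.fromRows_mul, Matrix.fromRows_mul_fromCols,
          hss z hz, htt z hz, hst' z hz]
      set G := E.transpose * valueAt M z * E
      have hA : valueAt M z = F.transpose * G * F := by
        have : F.transpose * E.transpose = 1 := by
          rw [← Matrix.transpose_mul, hEF, Matrix.transpose_one]
        calc valueAt M z = (F.transpose * E.transpose) * valueAt M z * (E * F) := by
              rw [this, hEF]; simp
          _ = F.transpose * G * F := by simp only [G, Matrix.mul_assoc]
      have hc : Config.act (E * slMatrix x * F) (valueAt M z) =
          F.transpose * ((slMatrix x).transpose * G + G * slMatrix x) * F := by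
        have h1 : E.transpose * F.transpose = 1 := by
          rw [← Matrix.transpose_mul, hFE, Matrix.transpose_one]
        rw [hA, Config.act, Matrix.transpose_mul, Matrix.transpose_mul]
        have e1 : F.transpose * ((slMatrix x).transpose * E.transpose) * (F.transpose * G * F) =
            F.transpose * ((slMatrix x).transpose * ((E.transpose * F.transpose) * (G * F))) := by
          simp only [Matrix.mul_assoc]
        have e2 : F.transpose * G * F * (E * slMatrix x * F) =
            F.transpose * (G * ((F * E) * (slMatrix x * F))) := by
          simp only [Matrix.mul_assoc]
        rw [e1, e2, h1, hFE]
        simp only [Matrix.one_mul, Matrix.mul_add, Matrix.add_mul, Matrix.mul_assoc]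
      have h0 : (slMatrix x).transpose * G + G * slMatrix x = 0 := by
        rw [hG]
        simp only [slMatrix, LinearMap.coe_mk, AddHom.coe_mk, Matrix.fromBlocks_transpose,
          Matrix.fromBlocks_multiply, Matrix.fromBlocks_add]
        simp
      rw [hc, h0]
      simp

/-- If `H` is the kernel of `h` and `h z₀ = 1`, a symmetry `X` over `H` satisfies `X · M(z) = h(z)
N(X)` with `N(X) = X · M(z₀)`. This is a family of deformations indexed by `ℂ³`. -/
theorem HomParam.exists_plane_of_isSegreFamily (q : HomParam) (hc : q.config.General)
    (H : SubspaceC4) (hH : Module.finrank ℂ H = 3) (hS : IsSegreFamily (isotropicFibre q.M H)) :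
    ∃ i, ∀ z, z ∈ H ↔ MvPolynomial.eval z (q.w i) = 0 := by
  obtain ⟨X, hX, hXH⟩ := exists_act_of_isSegreFamily hS
  have hlt : H < ⊤ := by
    rw [lt_top_iff_ne_top]
    rintro rfl
    simp at hH
  obtain ⟨h, h0, hle⟩ := Submodule.exists_le_ker_of_lt_top H hlt
  have hker : H = LinearMap.ker h := by
    refine Submodule.eq_of_le_of_finrank_le hle ?_
    have := LinearMap.finrank_range_add_finrank_ker h
    rw [LinearMap.range_eq_top.mpr (LinearMap.surjective h0)] at this
    simp at this
    omega
  have hadd : ∀ x y, valueAt q.M (x + y) = valueAt q.M x + valueAt q.M y := fun x y => by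
    simp [valueAt_M_eq_space, add_smul, Finset.sum_add_distrib]
  have hsmul : ∀ (r : ℂ) x, valueAt q.M (r • x) = r • valueAt q.M x := fun r x => by
    simp [valueAt_M_eq_space, mul_smul, Finset.smul_sum]
  obtain ⟨z₀, hz₀⟩ := LinearMap.surjective h0 1
  let N : (Fin 3 → ℂ) →ₗ[ℂ] Matrix (Fin 6) (Fin 6) ℂ :=
    { toFun := fun x => Config.act (X x) (valueAt q.M z₀)
      map_add' := fun x y => by
        simp only [Config.act, map_add, Matrix.transpose_add, add_mul, mul_add]; abel
      map_smul' := fun r x => by simp [Config.act] }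
  have hact : ∀ x z, Config.act (X x) (valueAt q.M z) = h z • N x := by
    intro x z
    have hz : z + (-h z) • z₀ ∈ H := by rw [hker]; simp [hz₀]
    have := (hXH x).2 _ hz
    rw [hadd, hsmul, Config.act_add, Config.act_smul, neg_smul, add_neg_eq_zero] at this
    exact this
  set e : Fin 4 → Fin 4 → ℂ := fun i => q.coordEquiv.symm (Pi.single i 1) with he
  have hval : ∀ i, valueAt q.M (e i) = q.config.space q.β i := fun i => by
    simp [valueAt_M_eq_space, he, Pi.single_apply]
  have hz : ∀ z, h z = ∑ i, q.coordEquiv z i * h (e i) := fun z => by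
    have : z = ∑ i, q.coordEquiv z i • e i := by
      apply q.coordEquiv.injective
      ext j
      simp [he, Pi.single_apply]
    conv_lhs => rw [this]
    simp
  -- With this normalization `h = ∑ βᵢ gᵢ wᵢ`: a `g` supported at `i` gives the plane `wᵢ = 0`, and
  -- a constant `g` gives `w₄ = 0`.
  set g : Fin 4 → ℂ := fun i => h (e i) / q.β i with hg
  have hβ := q.β_ne
  have hge : ∀ i, h (e i) = q.β i * g i := fun i => by
    simp only [hg]; field_simp [hβ i]
  have hg0 : ∃ i, g i ≠ 0 := by
    by_contra hc
    push Not at hc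
    apply h0
    refine LinearMap.ext fun z => ?_
    rw [hz, LinearMap.zero_apply]
    exact Finset.sum_eq_zero fun i _ => by rw [hge, hc i]; simp
  have hdef : ∀ x, q.config.Deformation q.β g (X x) (N x) := fun x => by
    have ha : ∀ i, Config.act (X x) (q.config.space q.β i) = (q.β i * g i) • N x := fun i => by
      rw [← hval, hact, hge]
    exact ⟨q.config.orthogonal_of_act hβ hg0 (hXH x).1 ha, ha⟩
  rcases hc.plane_of_deformation hβ X N hX hdef with ⟨i, hi⟩ | hall
  · have hgi : g i ≠ 0 := by
      obtain ⟨j, hj⟩ := hg0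
      by_cases hji : j = i
      · rwa [← hji]
      · exact absurd (hi j hji) hj
    refine ⟨i.castSucc, fun z => ?_⟩
    rw [hker, LinearMap.mem_ker, hz, eval_w_castSucc, Finset.sum_eq_single i]
    · simp [hge, hβ, hgi]
    · intro j _ hj
      rw [hge, hi j hj]; simp
    · simp
  · have hg3 : g 3 ≠ 0 := by
      obtain ⟨j, hj⟩ := hg0
      rwa [hall] at hj
    refine ⟨4, fun z => ?_⟩
    rw [hker, LinearMap.mem_ker, hz, eval_w_last]
    have : ∑ i, q.coordEquiv z i * h (e i) = g 3 * ∑ i, q.β i * q.coordEquiv z i := by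
      rw [Finset.mul_sum]
      refine Finset.sum_congr rfl fun i _ => ?_
      rw [hge, hall i]; ring
    rw [this]
    simp [hg3]

/-! ### ### Isotropic 3-spaces of four rank-two forms -/

/-- The standard area form on `ℂ²`. -/
def det2 (a b : Fin 2 → ℂ) : ℂ := a 0 * b 1 - a 1 * b 0

theorem det2_smul_smul (a : Fin 2 → ℂ) (r s : ℂ) : det2 (r • a) (s • a) = 0 := by
  simp [det2]; ring

theorem exists_smul_of_det2_eq_zero {a b : Fin 2 → ℂ} (ha : a ≠ 0) (h : det2 a b = 0) :
    ∃ r : ℂ, b = r • a := by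
  simp only [det2] at h
  by_cases h0 : a 0 = 0
  · have h1 : a 1 ≠ 0 := fun h1 => ha (by ext i; fin_cases i <;> assumption)
    refine ⟨b 1 / a 1, ?_⟩
    have hb : b 0 = 0 := by simpa [h0, h1] using h
    ext i
    fin_cases i
    · simp [h0, hb]
    · simp [h1]
  · refine ⟨b 0 / a 0, ?_⟩
    ext i
    fin_cases i
    · simp [h0]
    · simp
      field_simp
      linear_combination h

theorem det2_map (G : (Fin 2 → ℂ) →ₗ[ℂ] (Fin 2 → ℂ)) {a b : Fin 2 → ℂ} (h : det2 a b = 0) :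
    det2 (G a) (G b) = 0 := by
  by_cases ha : a = 0
  · simp [ha, det2]
  · obtain ⟨r, rfl⟩ := exists_smul_of_det2_eq_zero ha h
    simpa using det2_smul_smul (G a) 1 r

theorem eq_zero_of_det2 {a p q : Fin 2 → ℂ} (hpq : det2 p q ≠ 0) (hp : det2 a p = 0)
    (hq : det2 a q = 0) : a = 0 := by
  simp only [det2] at *
  ext i
  fin_cases i
  · exact (mul_eq_zero.mp (show a 0 * (p 0 * q 1 - p 1 * q 0) = 0 by
      linear_combination p 0 * hq - q 0 * hp)).resolve_right hpq
  · exact (mul_eq_zero.mp (show a 1 * (p 0 * q 1 - p 1 * q 0) = 0 by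
      linear_combination p 1 * hq - q 1 * hp)).resolve_right hpq

/-- `det2` as a linear form in its first argument. -/
def det2Left (b : Fin 2 → ℂ) : Module.Dual ℂ (Fin 2 → ℂ) where
  toFun a := det2 a b
  map_add' x y := by simp [det2]; ring
  map_smul' r x := by simp [det2]; ring

theorem exists_mem_of_finrank_eq_three {B : Submodule ℂ (Fin 6 → ℂ)}
    (hB : Module.finrank ℂ B = 3) (φ ψ : Module.Dual ℂ (Fin 6 → ℂ)) :
    ∃ x ∈ B, x ≠ 0 ∧ φ x = 0 ∧ ψ x = 0 := by
  have hlt : Module.finrank ℂ (ℂ × ℂ) < Module.finrank ℂ B := by simp [hB]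
  have := LinearMap.ker_ne_bot_of_finrank_lt (f := (φ.prod ψ).domRestrict B) hlt
  obtain ⟨x, hx, hx0⟩ := Submodule.exists_mem_ne_zero_of_ne_bot this
  have hx' : (φ x, ψ x) = (0 : ℂ × ℂ) := hx
  exact ⟨x, x.2, by simpa using hx0, congrArg Prod.fst hx', congrArg Prod.snd hx'⟩

/-- Splitting of `ℂ⁶` by three projections, adapted to a fourth one. -/
theorem exists_adapted_equiv (π : Fin 4 → (Fin 6 → ℂ) →ₗ[ℂ] (Fin 2 → ℂ))
    (hπ : ∀ r x, (∀ s, s ≠ r → π s x = 0) → x = 0) :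
    ∃ (Φ : (Fin 6 → ℂ) ≃ₗ[ℂ] (Fin 3 → Fin 2 → ℂ))
      (G : Fin 3 → (Fin 2 → ℂ) ≃ₗ[ℂ] (Fin 2 → ℂ)),
      (∀ x r, Φ x r = G r (π r.castSucc x)) ∧ ∀ x, π 3 x = ∑ r, Φ x r := by
  have hinj : Function.Injective (LinearMap.pi fun r : Fin 3 => π r.castSucc) := by
    rw [injective_iff_map_eq_zero]
    intro x hx
    refine hπ 3 x fun s hs => ?_
    induction s using Fin.lastCases with
    | last => exact absurd rfl hs
    | cast s => exact congrFun hx s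
  let e := LinearEquiv.ofInjectiveOfFinrankEq _ hinj
    (by rw [Module.finrank_fin_fun, Module.finrank_pi_fintype]; simp)
  have he : ∀ x r, e x r = π r.castSucc x := fun x r => rfl
  -- `G r` is the fourth projection restricted to the `r`-th summand. Changing coordinates by it in
  -- each summand turns the fourth projection into the sum of the components.
  let G : Fin 3 → (Fin 2 → ℂ) →ₗ[ℂ] (Fin 2 → ℂ) := fun r =>
    π 3 ∘ₗ (e.symm : _ →ₗ[ℂ] _) ∘ₗ LinearMap.single ℂ (fun _ => Fin 2 → ℂ) r
  have hG : ∀ r, Function.Injective (G r) := by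
    intro r
    rw [injective_iff_map_eq_zero]
    intro a ha
    have h0 : e.symm (Pi.single r a) = 0 := by
      refine hπ r.castSucc _ fun s hs => ?_
      induction s using Fin.lastCases with
      | last => exact ha
      | cast s =>
        rw [← he, LinearEquiv.apply_symm_apply]
        exact Pi.single_eq_of_ne (fun h => hs (by rw [h])) _
    have := congrArg (fun y => e y r) h0
    simpa using this
  refine ⟨e.trans (LinearEquiv.piCongrRight fun r => LinearEquiv.ofInjectiveEndo (G r) (hG r)),
    fun r => LinearEquiv.ofInjectiveEndo (G r) (hG r), fun x r => rfl, fun x => ?_⟩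
  have hx : x = e.symm (∑ r, Pi.single r (e x r)) := by
    rw [Finset.univ_sum_single, LinearEquiv.symm_apply_apply]
  conv_lhs => rw [hx]
  simp [G]

/-- The `3`-dimensional subspaces isotropic for all combinations, with coefficients in a general
hyperplane, of the four forms `det2 (πᵣ x) (πᵣ y)` are the planes of a Segre variety. -/
theorem isSegreFamily_of_projections (π : Fin 4 → (Fin 6 → ℂ) →ₗ[ℂ] (Fin 2 → ℂ))
    (hπ : ∀ r x, (∀ s, s ≠ r → π s x = 0) → x = 0) {γ : Fin 4 → ℂ} (hγ : ∀ r, γ r ≠ 0) :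
    IsSegreFamily {B | Module.finrank ℂ B = 3 ∧ ∀ c : Fin 4 → ℂ, ∑ r, γ r * c r = 0 →
      ∀ x ∈ B, ∀ y ∈ B, ∑ r, c r * det2 (π r x) (π r y) = 0} := by
  obtain ⟨Φ, G, hΦ, h3⟩ := exists_adapted_equiv π hπ
  let s : (Fin 2 → ℂ) → (Fin 3 → ℂ) →ₗ[ℂ] (Fin 6 → ℂ) := fun a =>
    (Φ.symm : _ →ₗ[ℂ] _) ∘ₗ LinearMap.pi fun r => (LinearMap.proj r).smulRight a
  have hs : ∀ a x r, Φ (s a x) r = x r • a := fun a x r => by simp [s]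
  have hcd : ∀ c d : ℂ, c • s ![1, 0] + d • s ![0, 1] = s ![c, d] := by
    intro c d
    refine LinearMap.ext fun x => Φ.injective ?_
    ext r i
    simp only [LinearMap.add_apply, LinearMap.smul_apply, map_add, map_smul, Pi.add_apply,
      Pi.smul_apply, hs]
    fin_cases i <;> simp [mul_comm]
  have hsinj : ∀ a, a ≠ 0 → Function.Injective (s a) := by
    intro a ha
    rw [injective_iff_map_eq_zero]
    intro x hx
    ext r
    have := hs a x r
    rw [hx, map_zero, Pi.zero_apply] at this
    simpa [ha] using this.symm
  have hfin : ∀ a, a ≠ 0 → Module.finrank ℂ (LinearMap.range (s a)) = 3 := fun a ha => by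
    rw [LinearMap.finrank_range_of_inj (hsinj a ha)]; simp
  have hne : ∀ c d : ℂ, (c ≠ 0 ∨ d ≠ 0) → (![c, d] : Fin 2 → ℂ) ≠ 0 := by
    intro c d h h0
    have e0 := congrFun h0 0
    have e1 := congrFun h0 1
    simp at e0 e1
    tauto
  have hback : ∀ x (r : Fin 3), π r.castSucc x = (G r).symm (Φ x r) := fun x r => by
    rw [hΦ, LinearEquiv.symm_apply_apply]
  refine ⟨s ![1, 0], s ![0, 1], ?_, ?_⟩
  · have hi : Function.Injective ((s ![1, 0]).coprod (s ![0, 1])) := by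
      rw [injective_iff_map_eq_zero]
      rintro ⟨x, y⟩ hxy
      rw [LinearMap.coprod_apply] at hxy
      have : ∀ r, x r • (![1, 0] : Fin 2 → ℂ) + y r • ![0, 1] = 0 := fun r => by
        rw [← hs, ← hs, ← Pi.add_apply, ← map_add, hxy, map_zero, Pi.zero_apply]
      have hx : x = 0 := by
        ext r
        simpa using congrFun (this r) 0
      have hy : y = 0 := by
        ext r
        simpa using congrFun (this r) 1
      rw [hx, hy]; rfl
    exact ⟨hi, (LinearMap.injective_iff_surjective_of_finrank_eq_finrank (by simp)).mp hi⟩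
  ext B
  simp only [Set.mem_ofPred_eq, hcd]
  constructor
  swap
  · rintro ⟨c, d, h, rfl⟩
    refine ⟨hfin _ (hne c d h), ?_⟩
    rintro f - _ ⟨x, rfl⟩ _ ⟨y, rfl⟩
    refine Finset.sum_eq_zero fun r _ => ?_
    suffices det2 (π r (s ![c, d] x)) (π r (s ![c, d] y)) = 0 by rw [this, mul_zero]
    induction r using Fin.lastCases with
    | last =>
      change det2 (π 3 _) (π 3 _) = 0
      rw [h3, h3]
      simp only [hs, ← Finset.sum_smul]
      exact det2_smul_smul _ _ _
    | cast r =>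
      rw [hback, hback, hs, hs]
      exact det2_map (G r).symm.toLinearMap (det2_smul_smul _ _ _)
  rintro ⟨hB, hiso⟩
  have hprop : ∀ x ∈ B, ∀ y ∈ B, ∀ r t, γ t * det2 (π r x) (π r y) = γ r * det2 (π t x) (π t y) := by
    intro x hx y hy r t
    -- These coefficients lie in the hyperplane and compare two forms at a time: on `B` the four
    -- forms are proportional to `γ`.
    have := hiso (Pi.single r (γ t) - Pi.single t (γ r))
      (by simp [mul_sub, Finset.sum_sub_distrib, Pi.single_apply, mul_comm]) x hx y hy
    simp [sub_mul, Finset.sum_sub_distrib, Pi.single_apply] at this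
    linear_combination this
  have hzero0 : ∀ x ∈ B, ∀ y ∈ B, det2 (π 0 x) (π 0 y) = 0 := by
    intro x hx y hy
    by_contra hne
    -- If one form is nonzero on `(x, y)`, so are all four, and then each `πᵣ x, πᵣ y` is a basis of
    -- `ℂ²`. Two conditions on the 3-space `B` leave a nonzero `z` with `π₀ z` parallel to both `π₀
    -- x` and `π₀ y`; by proportionality every `πᵣ z` vanishes.
    obtain ⟨z, hz, hz0, h1, h2⟩ := exists_mem_of_finrank_eq_three hB
      (det2Left (π 0 x) ∘ₗ π 0) (det2Left (π 0 y) ∘ₗ π 0)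
    change det2 (π 0 z) (π 0 x) = 0 at h1
    change det2 (π 0 z) (π 0 y) = 0 at h2
    have hv : ∀ r, π r z = 0 := fun r => by
      refine eq_zero_of_det2 (p := π r x) (q := π r y) ?_ ?_ ?_
      · intro h0
        have := hprop x hx y hy r 0
        rw [h0, mul_zero] at this
        exact (mul_ne_zero (hγ r) hne) this.symm
      · have := hprop z hz x hx r 0
        rw [h1, mul_zero] at this
        exact (mul_eq_zero.mp this).resolve_left (hγ 0)
      · have := hprop z hz y hy r 0
        rw [h2, mul_zero] at this
        exact (mul_eq_zero.mp this).resolve_left (hγ 0)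
    exact hz0 (hπ 0 z fun r _ => hv r)
  have hzero : ∀ r, ∀ x ∈ B, ∀ y ∈ B, det2 (π r x) (π r y) = 0 := by
    intro r x hx y hy
    have := hprop x hx y hy r 0
    rw [hzero0 x hx y hy, mul_zero] at this
    exact (mul_eq_zero.mp this).resolve_left (hγ 0)
  have hΦ0 : ∀ r, ∀ x ∈ B, ∀ y ∈ B, det2 (Φ x r) (Φ y r) = 0 := by
    intro r x hx y hy
    rw [hΦ, hΦ]
    exact det2_map (G r).toLinearMap (hzero _ x hx y hy)
  have hξ : ∀ r, ∃ ξ : Module.Dual ℂ (Fin 2 → ℂ), ∀ x ∈ B, ξ (Φ x r) = 0 → Φ x r = 0 := by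
    intro r
    by_cases hall : ∀ x ∈ B, Φ x r = 0
    · exact ⟨0, fun x hx _ => hall x hx⟩
    push Not at hall
    obtain ⟨y, hy, hy0⟩ := hall
    obtain ⟨i, hi⟩ := Function.ne_iff.mp hy0
    refine ⟨LinearMap.proj i, fun x hx h => ?_⟩
    obtain ⟨m, hm⟩ := exists_smul_of_det2_eq_zero hy0 (hΦ0 r y hy x hx)
    rw [hm] at h ⊢
    have : m = 0 := (mul_eq_zero.mp h).resolve_right hi
    rw [this, zero_smul]
  choose ξ hξ using hξ
  -- Each component of `B` is at most a line, so one linear condition makes it vanish. Two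
  -- conditions on the 3-space `B` leave a nonzero vector in a single summand.
  have hv : ∀ r : Fin 3, ∃ v ∈ B, Φ v r ≠ 0 ∧ ∀ t, t ≠ r → Φ v t = 0 := by
    intro r
    obtain ⟨v, hv, hv0, h1, h2⟩ := exists_mem_of_finrank_eq_three hB
      (ξ (r + 1) ∘ₗ LinearMap.proj (r + 1) ∘ₗ Φ.toLinearMap)
      (ξ (r + 2) ∘ₗ LinearMap.proj (r + 2) ∘ₗ Φ.toLinearMap)
    have h1 := hξ (r + 1) v hv h1
    have h2 := hξ (r + 2) v hv h2
    have ht : ∀ t, t ≠ r → Φ v t = 0 := by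
      intro t ht
      have : t = r + 1 ∨ t = r + 2 :=
        (by decide : ∀ r t : Fin 3, t ≠ r → t = r + 1 ∨ t = r + 2) r t ht
      rcases this with rfl | rfl <;> assumption
    refine ⟨v, hv, fun h0 => hv0 (Φ.injective ?_), ht⟩
    rw [map_zero]
    funext t
    by_cases htr : t = r
    · rw [htr]; exact h0
    · exact ht t htr
  choose v hvB hv0 hv using hv
  have h3v : ∀ r, π 3 (v r) = Φ (v r) r := fun r => by
    rw [h3, Finset.sum_eq_single r (fun t _ ht => hv r t ht) (by simp)]
  set a := Φ (v 0) 0 with ha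
  -- The fourth projection sends `vᵣ` to its only component and has image of dimension at most one
  -- on `B`. Hence the three component lines coincide, and `B` lies in `a ⊗ ℂ³`.
  have hmain : ∀ x ∈ B, ∀ r, ∃ m : ℂ, Φ x r = m • a := by
    intro x hx r
    have hr := hzero 3 (v 0) (hvB 0) (v r) (hvB r)
    rw [h3v, h3v] at hr
    obtain ⟨m, hm⟩ := exists_smul_of_det2_eq_zero (hv0 0) hr
    obtain ⟨m', hm'⟩ := exists_smul_of_det2_eq_zero (hv0 r) (hΦ0 r (v r) (hvB r) x hx)
    exact ⟨m' * m, by rw [hm', hm, smul_smul]⟩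
  have hav : (![a 0, a 1] : Fin 2 → ℂ) = a := by ext i; fin_cases i <;> rfl
  refine ⟨a 0, a 1, ?_, ?_⟩
  · by_contra hc
    push Not at hc
    exact hv0 0 (by ext i; fin_cases i; exacts [hc.1, hc.2])
  · rw [hav]
    refine Submodule.eq_of_le_of_finrank_eq ?_ (by rw [hB, hfin a (hv0 0)])
    intro x hx
    choose m hm using hmain x hx
    exact ⟨m, Φ.injective (by ext1 r; rw [hs, hm])⟩

/-! ### ### The five lines and the isotropic fibres over the pentahedron -/

namespace Config

/-- The pair of linear forms defining the `i`-th line, as a map to `ℂ²`. -/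
def proj (c : Config) (i : Fin 5) : (Fin 6 → ℂ) →ₗ[ℂ] (Fin 2 → ℂ) :=
  Matrix.toLin' (Matrix.of ![c.fst i, c.snd i])

theorem proj_apply (c : Config) (i : Fin 5) (x : Fin 6 → ℂ) :
    c.proj i x = ![c.fst i ⬝ᵥ x, c.snd i ⬝ᵥ x] := by
  ext r
  fin_cases r <;> simp [proj, Matrix.mulVec]

theorem dotProduct_pt_mulVec (c : Config) (i : Fin 5) (x y : Fin 6 → ℂ) :
    x ⬝ᵥ (c.pt i).mulVec y = det2 (c.proj i x) (c.proj i y) := by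
  simp only [pt, linePoint, Matrix.sub_mulVec, dotProduct_sub, Matrix.vecMulVec_mulVec, proj_apply,
    det2, Matrix.cons_val]
  simp [dotProduct_comm x]
  ring

/-- Up to sign, the determinant of the six linear forms attached to `i, j, k` is `a_{ijk}`, and all
of these are nonzero for a general configuration. -/
theorem General.eq_zero_of_proj_lt {c : Config} (hc : c.General) {i j k : Fin 5} (hij : i < j)
    (hjk : j < k) {x : Fin 6 → ℂ} (hi : c.proj i x = 0) (hj : c.proj j x = 0)
    (hk : c.proj k x = 0) : x = 0 := by
  have hu := hc.u_ne
  have hv := hc.v_ne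
  have hu1 := hc.u1_ne
  have hv1 := hc.v1_ne
  have hk_ne := hc.k_ne
  have h134 := hc.a134_ne
  have h234 := hc.a234_ne
  have main : x 0 = 0 ∧ x 1 = 0 ∧ x 2 = 0 ∧ x 3 = 0 ∧ x 4 = 0 ∧ x 5 = 0 := by
    have hi0 := congrFun hi 0
    have hi1 := congrFun hi 1
    have hj0 := congrFun hj 0
    have hj1 := congrFun hj 1
    have hk0 := congrFun hk 0
    have hk1 := congrFun hk 1
    clear hi hj hk
    fin_cases i <;> fin_cases j <;> (try exact absurd hij (by decide)) <;> fin_cases k <;>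
    (try exact absurd hjk (by decide)) <;>
    simp [proj_apply, fst, snd, dotProduct, Fin.sum_univ_six] at hi0 hi1 hj0 hj1 hk0 hk1
    all_goals clear hij hjk
    all_goals grind
  ext a
  fin_cases a <;> simp [main]

theorem General.eq_zero_of_proj {c : Config} (hc : c.General) {i j : Fin 5} (hij : i < j)
    {x : Fin 6 → ℂ} (h : ∀ s, s ≠ i → s ≠ j → c.proj s x = 0) : x = 0 := by
  obtain ⟨a, b, d, hab, hbd, ha, hb, hd⟩ : ∃ a b d : Fin 5, a < b ∧ b < d ∧
      (a ≠ i ∧ a ≠ j) ∧ (b ≠ i ∧ b ≠ j) ∧ (d ≠ i ∧ d ≠ j) := by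
    clear h
    revert i j
    decide
  exact hc.eq_zero_of_proj_lt hab hbd (h a ha.1 ha.2) (h b hb.1 hb.2) (h d hd.1 hd.2)

end Config

namespace HomParam

/-- The coefficients of the linear relation between `w₀, …, w₄`. -/
def rel (q : HomParam) : Fin 5 → ℂ := Fin.snoc (α := fun _ => ℂ) q.β (-1)

theorem rel_castSucc (q : HomParam) (i : Fin 4) : q.rel i.castSucc = q.β i := by simp [rel]

theorem rel_last (q : HomParam) : q.rel (Fin.last 4) = -1 := by simp only [rel, Fin.snoc_last]

theorem rel_ne (q : HomParam) (i : Fin 5) : q.rel i ≠ 0 := by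
  induction i using Fin.lastCases with
  | last => rw [rel_last]; simp
  | cast i => rw [rel_castSucc]; exact q.β_ne i

theorem sum_rel_mul_eval_w (q : HomParam) (z : Fin 4 → ℂ) :
    ∑ i, q.rel i * MvPolynomial.eval z (q.w i) = 0 := by
  rw [Fin.sum_univ_castSucc, rel_last]
  simp only [rel_castSucc, eval_w_castSucc]
  have := q.eval_w_last z
  change MvPolynomial.eval z (q.w (Fin.last 4)) = _ at this
  rw [this]
  ring

theorem exists_eval_w (q : HomParam) (c : Fin 5 → ℂ) (hc : ∑ i, q.rel i * c i = 0) :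
    ∃ z, ∀ i, MvPolynomial.eval z (q.w i) = c i := by
  obtain ⟨z, hz⟩ := q.coordEquiv.surjective fun i => c i.castSucc
  have hz' : ∀ i : Fin 4, MvPolynomial.eval z (q.w i.castSucc) = c i.castSucc := fun i => by
    rw [eval_w_castSucc, hz]
  refine ⟨z, fun i => ?_⟩
  induction i using Fin.lastCases with
  | last =>
    have := q.sum_rel_mul_eval_w z
    rw [Fin.sum_univ_castSucc, rel_last] at this hc
    simp only [hz'] at this
    linear_combination hc - this
  | cast i => exact hz' i

/-- The vertex of the pentahedron on the three planes other than `i` and `j`; the relation between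
the forms fixes the ratio of the two remaining values. -/
theorem exists_eval_w_pair (q : HomParam) {i j : Fin 5} (hij : i ≠ j) :
    ∃ z, MvPolynomial.eval z (q.w i) = q.rel j ∧ MvPolynomial.eval z (q.w j) = -q.rel i ∧
      ∀ k, k ≠ i → k ≠ j → MvPolynomial.eval z (q.w k) = 0 := by
  obtain ⟨z, hz⟩ := q.exists_eval_w (Pi.single i (q.rel j) - Pi.single j (q.rel i)) (by
    simp [mul_sub, Finset.sum_sub_distrib, Pi.single_apply]
    ring)
  refine ⟨z, ?_, ?_, fun k hi hj => ?_⟩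
  · rw [hz]; simp [hij]
  · rw [hz]; simp [hij.symm]
  · rw [hz]; simp [hi, hj]

/-- On `wₘ = 0` the values of `M` are the combinations of the other four points whose coefficients
satisfy one linear relation, with all its coefficients nonzero. This is the setting of
`isSegreFamily_of_projections`. -/
theorem isSegreFamily_of_plane (q : HomParam) (hc : q.config.General) {H : SubspaceC4} {m : Fin 5}
    (hH : ∀ z, z ∈ H ↔ MvPolynomial.eval z (q.w m) = 0) :
    IsSegreFamily (isotropicFibre q.M H) := by
  have key := isSegreFamily_of_projections (fun r => q.config.proj (m.succAbove r))
    (γ := fun r => q.rel (m.succAbove r)) (fun r x hx => by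
      have hs : ∀ s, s ≠ m → s ≠ m.succAbove r → q.config.proj s x = 0 := by
        intro s hsm hsr
        obtain ⟨t, rfl⟩ := Fin.exists_succAbove_eq hsm
        exact hx t fun h => hsr (by rw [h])
      rcases lt_or_gt_of_ne (Fin.succAbove_ne m r) with hlt | hlt
      · exact hc.eq_zero_of_proj hlt fun s h1 h2 => hs s h2 h1
      · exact hc.eq_zero_of_proj hlt fun s h1 h2 => hs s h1 h2)
    (fun r => q.rel_ne _)
  have hval : ∀ z ∈ H, ∀ x y, x ⬝ᵥ (valueAt q.M z).mulVec y = ∑ r : Fin 4,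
      MvPolynomial.eval z (q.w (m.succAbove r)) *
        det2 (q.config.proj (m.succAbove r) x) (q.config.proj (m.succAbove r) y) := by
    intro z hz x y
    rw [valueAt_M, Matrix.sum_mulVec, dotProduct_sum, Fin.sum_univ_succAbove _ m, (hH z).mp hz]
    simp [Matrix.smul_mulVec, Config.dotProduct_pt_mulVec]
  convert key using 1
  ext B
  refine and_congr_right fun _ => ⟨fun h c hcsum x hx y hy => ?_, fun h z hz x hx y hy => ?_⟩
  · obtain ⟨z, hz⟩ := q.exists_eval_w (m.insertNth (α := fun _ => ℂ) 0 c) (by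
      rw [Fin.sum_univ_succAbove _ m]
      simpa using hcsum)
    have hzH : z ∈ H := by rw [hH, hz]; simp
    have := h z hzH x hx y hy
    rw [hval z hzH] at this
    simpa [hz] using this
  · rw [hval z hz]
    refine h _ ?_ x hx y hy
    have := q.sum_rel_mul_eval_w z
    rw [Fin.sum_univ_succAbove _ m, (hH z).mp hz] at this
    simpa using this

/-- The form `wᵢ` as a linear form on `ℂ⁴`. -/
def wDual (q : HomParam) (i : Fin 5) : Module.Dual ℂ (Fin 4 → ℂ) where
  toFun z := MvPolynomial.eval z (q.w i)
  map_add' x y := by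
    induction i using Fin.lastCases with
    | last =>
      change MvPolynomial.eval (x + y) (q.w 4) =
        MvPolynomial.eval x (q.w 4) + MvPolynomial.eval y (q.w 4)
      simp only [eval_w_last, map_add, Pi.add_apply, mul_add, Finset.sum_add_distrib]
    | cast i => simp only [eval_w_castSucc, map_add, Pi.add_apply]
  map_smul' r x := by
    induction i using Fin.lastCases with
    | last =>
      change MvPolynomial.eval (r • x) (q.w 4) = r • MvPolynomial.eval x (q.w 4)
      simp only [eval_w_last, map_smul, Pi.smul_apply, smul_eq_mul, Finset.mul_sum]
      exact Finset.sum_congr rfl fun i _ => by ring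
    | cast i => simp only [eval_w_castSucc, map_smul, Pi.smul_apply, RingHom.id_apply]

theorem wDual_apply (q : HomParam) (i : Fin 5) (z : Fin 4 → ℂ) :
    q.wDual i z = MvPolynomial.eval z (q.w i) := rfl

theorem wDual_ne_zero (q : HomParam) (i : Fin 5) : q.wDual i ≠ 0 := by
  obtain ⟨j, hj⟩ := exists_ne i
  obtain ⟨z, hz, -⟩ := q.exists_eval_w_pair hj.symm
  intro h
  rw [← wDual_apply, h] at hz
  exact q.rel_ne j hz.symm

theorem pentahedron_eq_range (q : HomParam) :
    q.pentahedron = Set.range fun i => LinearMap.ker (q.wDual i) := by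
  ext H
  constructor
  · rintro ⟨i, hi⟩
    exact ⟨i, by ext z; rw [LinearMap.mem_ker, wDual_apply, hi]⟩
  · rintro ⟨i, rfl⟩
    exact ⟨i, fun z => Iff.rfl⟩

theorem ker_wDual_injective (q : HomParam) :
    Function.Injective fun i => LinearMap.ker (q.wDual i) := by
  intro i j hij
  by_contra hne
  obtain ⟨k, hki, hkj⟩ : ∃ k : Fin 5, k ≠ i ∧ k ≠ j := by
    clear hij hne
    revert i j
    decide
  obtain ⟨z, -, hz, h0⟩ := q.exists_eval_w_pair hkj
  have hz' : z ∈ LinearMap.ker (q.wDual i) := h0 i hki.symm hne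
  have hz'' : z ∈ LinearMap.ker (q.wDual j) := by
    change LinearMap.ker (q.wDual i) = LinearMap.ker (q.wDual j) at hij
    rwa [← hij]
  rw [LinearMap.mem_ker, wDual_apply, hz, neg_eq_zero] at hz''
  exact q.rel_ne k hz''

theorem ncard_pentahedron (q : HomParam) : q.pentahedron.ncard = 5 := by
  rw [pentahedron_eq_range, ← Set.image_univ, Set.ncard_image_of_injective _ q.ker_wDual_injective]
  simp

theorem linearIndependent_wDual (q : HomParam) (i : Fin 5) :
    LinearIndependent ℂ fun j : {j : Fin 5 // j ≠ i} => q.wDual j := by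
  rw [Fintype.linearIndependent_iff]
  intro l hl j
  obtain ⟨z, hz, -, h0⟩ := q.exists_eval_w_pair j.2
  have := LinearMap.congr_fun hl z
  rw [LinearMap.sum_apply, Finset.sum_eq_single j] at this
  · simp only [LinearMap.smul_apply, wDual_apply, hz, smul_eq_mul, LinearMap.zero_apply] at this
    exact (mul_eq_zero.mp this).resolve_right (q.rel_ne i)
  · intro k _ hk
    rw [LinearMap.smul_apply, wDual_apply, h0 k (fun h => hk (Subtype.ext h)) k.2, smul_zero]
  · simp

theorem isCompletePentahedron (q : HomParam) : IsCompletePentahedron q.pentahedron :=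
  ⟨q.wDual, q.linearIndependent_wDual, q.pentahedron_eq_range⟩

theorem finrank_plane (q : HomParam) {H : SubspaceC4} {m : Fin 5}
    (hH : ∀ z, z ∈ H ↔ MvPolynomial.eval z (q.w m) = 0) : Module.finrank ℂ H = 3 := by
  have hker : H = LinearMap.ker (q.wDual m) := by
    ext z; rw [LinearMap.mem_ker, wDual_apply, hH]
  have := LinearMap.finrank_range_add_finrank_ker (q.wDual m)
  rw [LinearMap.range_eq_top.mpr (LinearMap.surjective (q.wDual_ne_zero m)), ← hker] at this
  simp at this
  omega

theorem pentahedron_eq (q : HomParam) (hc : q.config.General) : q.pentahedron =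
    {H : SubspaceC4 | Module.finrank ℂ H = 3 ∧ IsSegreFamily (isotropicFibre q.M H)} := by
  ext H
  constructor
  · rintro ⟨m, hm⟩
    exact ⟨q.finrank_plane hm, q.isSegreFamily_of_plane hc hm⟩
  · rintro ⟨h3, hS⟩
    exact q.exists_plane_of_isSegreFamily hc H h3 hS

end HomParam

/-! ### ### Smoothness and the inscribed pentahedron -/

open MvPolynomial in
theorem eval_pderiv_bind₁ (l : Fin 4 → Poly) (f : Poly) (z : Fin 4 → ℂ) (j : Fin 4) :
    eval z (pderiv j (bind₁ l f)) =
      ∑ i, eval z (bind₁ l (pderiv i f)) * eval z (pderiv j (l i)) := by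
  induction f using MvPolynomial.induction_on with
  | C a => simp
  | add p q hp hq => simp [hp, hq, add_mul, Finset.sum_add_distrib]
  | mul_X p i hp =>
    simp only [map_mul, bind₁_X_right, Derivation.leibniz, smul_eq_mul, map_add, hp, pderiv_X,
      add_mul, Finset.sum_add_distrib, Finset.mul_sum]
    congr 1
    · rw [Finset.sum_eq_single i]
      · simp
      · intro k _ hk
        simp [Pi.single_eq_of_ne hk.symm]
      · simp
    · exact Finset.sum_congr rfl fun k _ => by ring

open MvPolynomial in
-- By the chain rule the gradient is multiplied by the matrix `P`, which is invertible.
theorem IsSmoothForm.bind₁ {f : Poly} (hf : IsSmoothForm f) (P : GL (Fin 4) ℂ) :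
    IsSmoothForm (bind₁ (fun i => ∑ j, C ((P : Matrix (Fin 4) (Fin 4) ℂ) i j) * X j) f) := by
  intro z hz h0
  set l : Fin 4 → Poly := fun i => ∑ j, C ((P : Matrix (Fin 4) (Fin 4) ℂ) i j) * X j with hl
  have hev : ∀ g : Poly, eval z (MvPolynomial.bind₁ l g) =
      eval ((P : Matrix (Fin 4) (Fin 4) ℂ).mulVec z) g := fun g => by
    have : (fun i => eval z (l i)) = (P : Matrix (Fin 4) (Fin 4) ℂ).mulVec z := by
      ext i; simp [hl, Matrix.mulVec, dotProduct]
    rw [← this, eval, eval₂Hom_bind₁]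
    rfl
  have hPz : (P : Matrix (Fin 4) (Fin 4) ℂ).mulVec z ≠ 0 := fun h => hz (by
    have := congrArg (P⁻¹ : Matrix (Fin 4) (Fin 4) ℂ).mulVec h
    simpa using this)
  rw [hev] at h0
  obtain ⟨i, hi⟩ := hf _ hPz h0
  by_contra hc
  push Not at hc
  have hvec : Matrix.vecMul (fun i => eval ((P : Matrix (Fin 4) (Fin 4) ℂ).mulVec z) (pderiv i f))
      (P : Matrix (Fin 4) (Fin 4) ℂ) = 0 := by
    ext j
    have := hc j
    rw [eval_pderiv_bind₁] at this
    simp only [hev] at this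
    rw [Pi.zero_apply, ← this]
    simp only [Matrix.vecMul, dotProduct]
    refine Finset.sum_congr rfl fun i _ => ?_
    simp [hl, pderiv_X, Pi.single_apply]
  have := congrArg (fun y => Matrix.vecMul y (P⁻¹ : Matrix (Fin 4) (Fin 4) ℂ)) hvec
  simp only [Matrix.vecMul_vecMul] at this
  apply hi
  have := congrFun this i
  simpa using this

theorem IsSmoothForm.smul {f : Poly} (hf : IsSmoothForm f) {r : ℂ} (hr : r ≠ 0) :
    IsSmoothForm (r • f) := by
  intro z hz h0
  rw [MvPolynomial.smul_eval, mul_eq_zero] at h0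
  obtain ⟨i, hi⟩ := hf z hz (h0.resolve_left hr)
  exact ⟨i, by rw [Derivation.map_smul, MvPolynomial.smul_eval]; exact mul_ne_zero hr hi⟩

theorem IsSmoothForm.ne_zero {f : Poly} (hf : IsSmoothForm f) : f ≠ 0 := by
  rintro rfl
  obtain ⟨i, hi⟩ := hf (fun _ => 1) (fun h => one_ne_zero (congrFun h 0)) (by simp)
  simp at hi

theorem fiveForms_smul (r : ℂ) (hr : r ≠ 0) (b : Fin 5 → ℂ) (l : Fin 4 → Poly) :
    fiveForms (r • b) l = fiveForms b l := by
  simp only [fiveForms, Pi.smul_apply, smul_eq_mul, mul_div_mul_left _ _ hr]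

theorem bind₁_tripleCubic (a : Triple → ℂ) (b : Fin 5 → ℂ) (l : Fin 4 → Poly) :
    MvPolynomial.bind₁ l (tripleCubic a (fiveForms b MvPolynomial.X)) =
      tripleCubic a (fiveForms b l) := by
  have h : ∀ i, MvPolynomial.bind₁ l (fiveForms b MvPolynomial.X i) = fiveForms b l i := fun i => by
    induction i using Fin.lastCases with
    | last => simp only [fiveForms, Fin.snoc_last, map_sum, map_mul, MvPolynomial.bind₁_C_right,
        MvPolynomial.bind₁_X_right]
    | cast i => simp [fiveForms]
  simp [tripleCubic, h]

namespace HomParam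

theorem isSmoothForm_cubic (q : HomParam) : IsSmoothForm q.cubic := by
  obtain ⟨r, hr⟩ := Projectivization.exists_smul_eq_mk_rep ℂ q.b q.b_ne_zero
  have h := q.mem_A9'.2.2.2.1
  simp only at h
  rw [← hr, Units.smul_def, fiveForms_smul _ r.ne_zero] at h
  have := h.bind₁ q.P
  rwa [bind₁_tripleCubic] at this

theorem isHomogeneous_w (q : HomParam) (i : Fin 5) : (q.w i).IsHomogeneous 1 := by
  have hl : ∀ i, (∑ j, MvPolynomial.C ((q.P : Matrix (Fin 4) (Fin 4) ℂ) i j) *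
      MvPolynomial.X j : Poly).IsHomogeneous 1 := fun i =>
    MvPolynomial.IsHomogeneous.sum _ _ _ fun j _ => MvPolynomial.isHomogeneous_C_mul_X _ _
  induction i using Fin.lastCases with
  | last =>
    simp only [w, fiveForms, Fin.snoc_last]
    exact MvPolynomial.IsHomogeneous.sum _ _ _ fun j _ => (hl j).C_mul _
  | cast i => simpa [w, fiveForms] using hl i

theorem isHomogeneous_cubic (q : HomParam) : q.cubic.IsHomogeneous 3 :=
  MvPolynomial.IsHomogeneous.sum _ _ _ fun _ _ =>
    ((((q.isHomogeneous_w _).C_mul _).mul (q.isHomogeneous_w _)).mul (q.isHomogeneous_w _))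

theorem M_apply (q : HomParam) (a b : Fin 6) :
    q.M a b = ∑ i, MvPolynomial.C (q.config.pt i a b) * q.w i := by
  refine MvPolynomial.funext fun z => ?_
  have := congrFun (congrFun (q.valueAt_M z) a) b
  simp only [valueAt, Matrix.map_apply, Matrix.sum_apply, Matrix.smul_apply, smul_eq_mul] at this
  rw [this]
  simp [mul_comm]

theorem isSkewLinear_M (q : HomParam) : IsSkewLinear q.M := by
  refine ⟨?_, fun a b => ?_⟩
  · ext1 a b
    rw [Matrix.transpose_apply, Matrix.neg_apply, M_apply, M_apply, ← Finset.sum_neg_distrib]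
    refine Finset.sum_congr rfl fun i _ => ?_
    rw [Config.pt_skew, map_neg, neg_mul]
  · rw [M_apply]
    exact MvPolynomial.IsHomogeneous.sum _ _ _ fun i _ => (q.isHomogeneous_w i).C_mul _

theorem M_mem_smLocus (q : HomParam) : q.M ∈ smLocus := by
  refine ⟨q.isSkewLinear_M, ?_⟩
  rw [pf6_M, ← neg_one_smul ℂ]
  exact q.isSmoothForm_cubic.smul (by norm_num)

theorem cubic_subtype_ne_zero (q : HomParam) :
    (⟨q.cubic, q.isHomogeneous_cubic⟩ : MvPolynomial.homogeneousSubmodule (Fin 4) ℂ 3) ≠ 0 :=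
  fun h => q.isSmoothForm_cubic.ne_zero (congrArg Subtype.val h)

/-- The cubic surface of a point of the parameter space. -/
def surface (q : HomParam) : CubicSurface :=
  Projectivization.mk ℂ ⟨q.cubic, q.isHomogeneous_cubic⟩ q.cubic_subtype_ne_zero

theorem isEquation_cubic (q : HomParam) : IsEquation q.cubic q.surface :=
  ⟨q.isHomogeneous_cubic, q.cubic_subtype_ne_zero, rfl⟩

theorem isEquation_pf6 (q : HomParam) : IsEquation (pf6 q.M) q.surface := by
  rw [pf6_M]
  have hm : -q.cubic ∈ MvPolynomial.homogeneousSubmodule (Fin 4) ℂ 3 :=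
    neg_mem q.isHomogeneous_cubic
  refine ⟨hm, fun h => ?_, ?_⟩
  · exact q.isSmoothForm_cubic.ne_zero (neg_eq_zero.mp (congrArg Subtype.val h))
  · rw [surface, Projectivization.mk_eq_mk_iff']
    exact ⟨-1, Subtype.ext (by simp)⟩

theorem surface_rep (q : HomParam) : ∃ r : ℂ, r ≠ 0 ∧ (q.surface.rep : Poly) = r • q.cubic := by
  obtain ⟨r, hr⟩ := Projectivization.exists_smul_eq_mk_rep ℂ _ q.cubic_subtype_ne_zero
  exact ⟨r, r.ne_zero, by rw [surface, ← hr]; rfl⟩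

/-- Two triples of indices out of five always meet, so every monomial contains a factor vanishing at
`z`. -/
theorem eval_cubic_eq_zero (q : HomParam) {i j k : Fin 5} (hij : i ≠ j) (hik : i ≠ k) (hjk : j ≠ k)
    {z : Fin 4 → ℂ} (hi : MvPolynomial.eval z (q.w i) = 0) (hj : MvPolynomial.eval z (q.w j) = 0)
    (hk : MvPolynomial.eval z (q.w k) = 0) : MvPolynomial.eval z q.cubic = 0 := by
  rw [cubic, tripleCubic, map_sum]
  refine Finset.sum_eq_zero fun t _ => ?_
  have : t.1.1 = i ∨ t.1.1 = j ∨ t.1.1 = k ∨ t.1.2.1 = i ∨ t.1.2.1 = j ∨ t.1.2.1 = k ∨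
      t.1.2.2 = i ∨ t.1.2.2 = j ∨ t.1.2.2 = k := by
    have ht := t.2
    omega
  simp only [map_mul]
  rcases this with h | h | h | h | h | h | h | h | h <;> simp [h, hi, hj, hk]

theorem mem_inscribedPairs (q : HomParam) : (q.surface, q.pentahedron) ∈ inscribedPairs := by
  obtain ⟨r, hr, hrep⟩ := q.surface_rep
  refine ⟨?_, q.isCompletePentahedron, ?_⟩
  · simp only [hrep]
    exact q.isSmoothForm_cubic.smul hr
  · rintro H₁ ⟨i, hi⟩ H₂ ⟨j, hj⟩ H₃ ⟨k, hk⟩ h12 h13 h23 z ⟨⟨hz1, hz2⟩, hz3⟩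
    have key : ∀ {m n : Fin 5} {H H' : SubspaceC4}, H ≠ H' →
        (∀ z, z ∈ H ↔ MvPolynomial.eval z (q.w m) = 0) →
        (∀ z, z ∈ H' ↔ MvPolynomial.eval z (q.w n) = 0) → m ≠ n := by
      rintro m n H H' hne hm hn rfl
      exact hne (by ext z; rw [hm, hn])
    simp only [hrep, MvPolynomial.smul_eval]
    rw [q.eval_cubic_eq_zero (key h12 hi hj) (key h13 hi hk) (key h23 hj hk)
      ((hi z).mp hz1) ((hj z).mp hz2) ((hk z).mp hz3), mul_zero]

theorem phi1Eq (q : HomParam) (hc : q.config.General) :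
    Phi1Eq q.M q.surface q.pentahedron where
  mem_sm := q.M_mem_smLocus
  surface := q.isEquation_pf6
  planes := q.pentahedron_eq hc
  five := q.ncard_pentahedron

end HomParam

/-! ### ### Linear characterization of the span of the five points -/

namespace Config

variable {c : Config}

theorem Orthogonal.pfPolar_eq_zero {N : Matrix (Fin 6) (Fin 6) ℂ} (h : c.Orthogonal N)
    (i j : Fin 5) : pfPolar (c.pt i) (c.pt j) N = 0 := by
  obtain ⟨-, h03, h14, h25, h24, h23, h13, hd, hs⟩ := h
  have hd0 := hd 0
  have hd1 := hd 1
  have hd2 := hd 2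
  clear hd
  simp [coord, sigma] at hd0 hd1 hd2 hs
  have key : ∀ i j : Fin 5, i < j → pfPolar (c.pt i) (c.pt j) N = 0 := by
    intro i j hij
    fin_cases i <;> fin_cases j <;> (try exact absurd hij (by decide)) <;>
    simp [pfPolar, wedge4, pt_apply, fst, snd, h03, h14, h25, h24, h23, h13]
    · linear_combination hd0
    · linear_combination hd1
    · linear_combination hd2
    · linear_combination hs + hd0 + hd1 + hd2
  rcases lt_trichotomy i j with hij | rfl | hij
  · exact key i j hij
  · exact pfPolar_linePoint_self _ _ _
  · rw [pfPolar_comm]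
    exact key j i hij

/-- The skew matrix with vanishing diagonal blocks and with symmetric off-diagonal blocks
`(xₖ, yₖ, zₖ)`. -/
def ofBlocks (x y z : Fin 3 → ℂ) : Matrix (Fin 6) (Fin 6) ℂ :=
  !![0, x 2, -x 1, 0, y 2, -y 1;
     -x 2, 0, x 0, -y 2, 0, y 0;
     x 1, -x 0, 0, y 1, -y 0, 0;
     0, y 2, -y 1, 0, z 2, -z 1;
     -y 2, 0, y 0, -z 2, 0, z 0;
     y 1, -y 0, 0, z 1, -z 0, 0]

theorem coord_ofBlocks (c : Config) (x y z : Fin 3 → ℂ) (k l : Fin 3) :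
    c.coord (ofBlocks x y z) k l = z k * c.sigma l 0 - y k * c.sigma l 1 + x k * c.sigma l 2 := by
  fin_cases k <;> simp [coord, ofBlocks]

/-- Invertibility of `σ` makes `coord` a bijection from the off-diagonal blocks to `3 × 3` matrices.
Orthogonal `N` thus correspond to matrices with zero diagonal and zero sum of entries, which
provides test elements at will. -/
theorem General.exists_orthogonal (hc : c.General) (n : Fin 3 → Fin 3 → ℂ) (hd : ∀ k, n k k = 0)
    (hs : n 0 1 + n 0 2 + n 1 0 + n 1 2 + n 2 0 + n 2 1 = 0) :
    ∃ N, c.Orthogonal N ∧ ∀ k l, c.coord N k l = n k l := by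
  have hsol : ∀ k, ∃ x y z : ℂ, ∀ l,
      z * c.sigma l 0 - y * c.sigma l 1 + x * c.sigma l 2 = n k l := by
    intro k
    have hu : IsUnit c.sigma.det := isUnit_iff_ne_zero.mpr hc.det_ne
    have e : c.sigma.mulVec (c.sigma⁻¹.mulVec (n k)) = n k := by
      rw [Matrix.mulVec_mulVec, Matrix.mul_nonsing_inv _ hu, Matrix.one_mulVec]
    set r := c.sigma⁻¹.mulVec (n k)
    refine ⟨r 2, -r 1, r 0, fun l => ?_⟩
    rw [← e]
    simp only [Matrix.mulVec, dotProduct, Fin.sum_univ_three]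
    ring
  choose x y z hxyz using hsol
  have hcoord : ∀ k l, c.coord (ofBlocks x y z) k l = n k l := fun k l => by
    rw [coord_ofBlocks, hxyz]
  refine ⟨ofBlocks x y z, ⟨fun a b => ?_, rfl, rfl, rfl, rfl, ?_, rfl, fun k => ?_, ?_⟩, hcoord⟩
  · fin_cases a <;> fin_cases b <;> simp [ofBlocks]
  · simp [ofBlocks]
  · rw [hcoord, hd]
  · simp only [hcoord, hs]

/-- The symmetric part of the `k`-th off-diagonal block of `A`, as a binary quadratic form. -/
def symBlock (A : Matrix (Fin 6) (Fin 6) ℂ) : Matrix (Fin 3) (Fin 3) ℂ :=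
  !![A 1 2, A 1 5 - A 2 4, A 4 5;
     -A 0 2, -(A 0 5 - A 2 3), -A 3 5;
     A 0 1, A 0 4 - A 1 3, A 3 4]

/-- Against an orthogonal `N` and `u₀, …, u₃`, only the component of `A` in `S²ℂ² ⊗ ⋀²ℂ³` matters.
It is written here in the basis `σₗ`, with coefficients `o`. -/
theorem Orthogonal.pfPolar_pt {N A : Matrix (Fin 6) (Fin 6) ℂ} (h : c.Orthogonal N)
    {o : Matrix (Fin 3) (Fin 3) ℂ}
    (ho : ∀ k m, symBlock A k m = o k 0 * c.sigma 0 m + o k 1 * c.sigma 1 m + o k 2 * c.sigma 2 m) :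
    (pfPolar A (c.pt 0) N = o 0 0 * c.coord N 0 0 + o 0 1 * c.coord N 0 1 + o 0 2 * c.coord N 0 2) ∧
    (pfPolar A (c.pt 1) N = o 1 0 * c.coord N 1 0 + o 1 1 * c.coord N 1 1 + o 1 2 * c.coord N 1 2) ∧
    (pfPolar A (c.pt 2) N = o 2 0 * c.coord N 2 0 + o 2 1 * c.coord N 2 1 + o 2 2 * c.coord N 2 2) ∧
    (pfPolar A (c.pt 3) N =
      ((o 0 0 + o 1 0 + o 2 0) * (c.coord N 0 0 + c.coord N 1 0 + c.coord N 2 0)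
      + (o 0 1 + o 1 1 + o 2 1) * (c.coord N 0 1 + c.coord N 1 1 + c.coord N 2 1)
      + (o 0 2 + o 1 2 + o 2 2) * (c.coord N 0 2 + c.coord N 1 2 + c.coord N 2 2))) := by
  obtain ⟨-, h03, h14, h25, h24, h23, h13, hd, hs⟩ := h
  clear hd hs
  have a00 := ho 0 0
  have a01 := ho 0 1
  have a02 := ho 0 2
  have a10 := ho 1 0
  have a11 := ho 1 1
  have a12 := ho 1 2
  have a20 := ho 2 0
  have a21 := ho 2 1
  have a22 := ho 2 2
  clear ho
  simp only [symBlock, Matrix.of_apply, Matrix.cons_val] at a00 a01 a02 a10 a11 a12 a20 a21 a22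
  refine ⟨?_, ?_, ?_, ?_⟩
  all_goals
    simp [pfPolar, wedge4, pt_apply, fst, snd, h03, h14, h25, h24, h23, h13, coord, -neg_sub]
  · linear_combination N 4 5 * a00 - N 1 5 * a01 + N 1 2 * a02
  · linear_combination -N 3 5 * a10 + N 0 5 * a11 - N 0 2 * a12
  · linear_combination N 3 4 * a20 - N 0 4 * a21 + N 0 1 * a22
  · linear_combination (N 4 5 - N 3 5 + N 3 4) * (a00 + a10 + a20)
      - (N 1 5 - N 0 5 + N 0 4) * (a01 + a11 + a21) + (N 1 2 - N 0 2 + N 0 1) * (a02 + a12 + a22)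

/-- The entries of `A` in the diagonal blocks drop out because they multiply the vanishing `coord N
k k`. -/
theorem Orthogonal.pfPolar_pt_four {N A : Matrix (Fin 6) (Fin 6) ℂ} (h : c.Orthogonal N)
    (hA : symBlock A = 0) :
    pfPolar A (c.pt 4) N = A 1 5 * (c.coord N 1 2 + c.coord N 2 1)
      + A 0 5 * (c.coord N 0 2 + c.coord N 2 0) + A 0 4 * (c.coord N 0 1 + c.coord N 1 0) := by
  obtain ⟨-, h03, h14, h25, h24, h23, h13, hd, -⟩ := h
  have d0 := hd 0
  have d1 := hd 1
  have d2 := hd 2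
  clear hd
  have ho : ∀ k m, symBlock A k m = 0 := fun k m => by rw [hA]; rfl
  have a00 := ho 0 0
  have a01 := ho 0 1
  have a02 := ho 0 2
  have a10 := ho 1 0
  have a11 := ho 1 1
  have a12 := ho 1 2
  have a20 := ho 2 0
  have a21 := ho 2 1
  have a22 := ho 2 2
  clear ho hA
  simp only [symBlock, Matrix.of_apply, Matrix.cons_val, neg_eq_zero] at a00 a01 a02 a10 a11 a12 a20 a21 a22
  have b24 : A 2 4 = A 1 5 := by linear_combination -a01
  have b23 : A 2 3 = A 0 5 := by linear_combination -a11
  have b13 : A 1 3 = A 0 4 := by linear_combination -a21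
  simp [coord, sigma] at d0 d1 d2 ⊢
  simp [pfPolar, wedge4, pt_apply, fst, snd, h03, h14, h25, h24, h23, h13, a00, a02, a10, a12, a20, a22,
    b24, b23, b13]
  linear_combination A 0 3 * d0 + A 1 4 * d1 + A 2 5 * d2

/-- The linear characterization of the span of the five points. -/
theorem General.exists_eq_sum_of_pfPolar (hc : c.General) {β : Fin 4 → ℂ} (hβ : ∀ i, β i ≠ 0)
    {A : Matrix (Fin 6) (Fin 6) ℂ} (hA : ∀ a b, A a b = -A b a)
    (h : ∀ N, c.Orthogonal N → ∀ i, pfPolar A (c.space β i) N = 0) :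
    ∃ t : Fin 5 → ℂ, A = ∑ i, t i • c.pt i := by
  have hu : IsUnit c.sigma.det := isUnit_iff_ne_zero.mpr hc.det_ne
  set o := symBlock A * c.sigma⁻¹ with ho
  have hom : symBlock A = o * c.sigma := by
    rw [ho, Matrix.mul_assoc, Matrix.nonsing_inv_mul _ hu, Matrix.mul_one]
  have ho' : ∀ k m, symBlock A k m =
      o k 0 * c.sigma 0 m + o k 1 * c.sigma 1 m + o k 2 * c.sigma 2 m := fun k m => by
    rw [hom, Matrix.mul_apply, Fin.sum_univ_three]
  have hrel : ∀ n : Fin 3 → Fin 3 → ℂ, (∀ k, n k k = 0) →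
      n 0 1 + n 0 2 + n 1 0 + n 1 2 + n 2 0 + n 2 1 = 0 → ∃ φ : ℂ,
      o 0 1 * n 0 1 + o 0 2 * n 0 2 + β 0 * φ = 0 ∧ o 1 0 * n 1 0 + o 1 2 * n 1 2 + β 1 * φ = 0 ∧
      o 2 0 * n 2 0 + o 2 1 * n 2 1 + β 2 * φ = 0 ∧
      (o 0 0 + o 1 0 + o 2 0) * (n 1 0 + n 2 0) + (o 0 1 + o 1 1 + o 2 1) * (n 0 1 + n 2 1)
      + (o 0 2 + o 1 2 + o 2 2) * (n 0 2 + n 1 2) + β 3 * φ = 0 := by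
    intro n hd hs
    obtain ⟨N, hN, hNc⟩ := hc.exists_orthogonal n hd hs
    obtain ⟨p0, p1, p2, p3⟩ := hN.pfPolar_pt ho'
    simp only [hNc, hd] at p0 p1 p2 p3
    have q0 := h N hN 0
    have q1 := h N hN 1
    have q2 := h N hN 2
    have q3 := h N hN 3
    simp only [space, pfPolar_add_mid, pfPolar_smul_mid] at q0 q1 q2 q3
    refine ⟨pfPolar A (c.pt 4) N, ?_, ?_, ?_, ?_⟩
    · change pfPolar A (c.pt 0) N + _ = 0 at q0
      linear_combination q0 - p0
    · change pfPolar A (c.pt 1) N + _ = 0 at q1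
      linear_combination q1 - p1
    · change pfPolar A (c.pt 2) N + _ = 0 at q2
      linear_combination q2 - p2
    · change pfPolar A (c.pt 3) N + _ = 0 at q3
      linear_combination q3 - p3
  have hdiag : ∀ M : Matrix (Fin 3) (Fin 3) ℂ, M 0 0 = 0 → M 1 1 = 0 → M 2 2 = 0 →
      ∀ k, M k k = 0 := by
    intro M h0 h1 h2 k
    fin_cases k <;> assumption
  -- These five matrices are a basis of the matrices with zero diagonal and zero sum. Each has a
  -- zero row, which forces the corresponding `φ` to vanish as `β` has no zero entry; the remaining
  -- equations make `o` scalar.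
  obtain ⟨φ1, a0, a1, a2, a3⟩ := hrel !![0, 1, -1; 0, 0, 0; 0, 0, 0]
    (hdiag _ rfl rfl rfl) (by simp)
  obtain ⟨φ2, b0, b1, b2, b3⟩ := hrel !![0, 0, 0; 1, 0, -1; 0, 0, 0]
    (hdiag _ rfl rfl rfl) (by simp)
  obtain ⟨φ3, c0, c1, c2, c3⟩ := hrel !![0, 0, 0; 0, 0, 0; 1, -1, 0]
    (hdiag _ rfl rfl rfl) (by simp)
  obtain ⟨φ4, d0, d1, d2, d3⟩ := hrel !![0, 1, 0; -1, 0, 0; 0, 0, 0]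
    (hdiag _ rfl rfl rfl) (by simp)
  obtain ⟨φ5, e0, e1, e2, e3⟩ := hrel !![0, 1, 0; 0, 0, 0; -1, 0, 0]
    (hdiag _ rfl rfl rfl) (by simp)
  simp [hβ] at a0 a1 a2 a3 b0 b1 b2 b3 c0 c1 c2 c3 d0 d1 d2 d3 e0 e1 e2 e3
  simp [a1, b0, c0, d2, e1] at a0 a3 b1 b3 c2 c3 d0 d1 e0 e2
  have o02 : o 0 2 = 0 := by linear_combination d0 - a0
  have o12 : o 1 2 = 0 := by linear_combination d1 - b1
  have o21 : o 2 1 = 0 := by linear_combination e2 - c2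
  have o11 : o 1 1 = o 2 2 := by linear_combination a3 - d0 - o21 + o12 + o02
  have o00 : o 0 0 = o 2 2 := by linear_combination b3 - d1 - e2 + o12 + o02
  have hT4 : ∀ N, c.Orthogonal N → pfPolar A (c.pt 4) N = 0 := by
    intro N hN
    have p0 := (hN.pfPolar_pt ho').1
    have q0 := h N hN 0
    simp only [space, pfPolar_add_mid, pfPolar_smul_mid] at q0
    change pfPolar A (c.pt 0) N + _ = 0 at q0
    rw [p0, hN.coord_diag, d0, o02] at q0
    simpa [hβ] using q0
  -- Since `σ` is the component of `u₄` in `S²ℂ² ⊗ ⋀²ℂ³`, subtracting this multiple leaves a form in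
  -- `⋀²ℂ² ⊗ S²ℂ³`, that is, a symmetric `3 × 3` matrix. Orthogonality with `u₄` will make its
  -- off-diagonal entries equal, which places it in the span of `u₀, …, u₃`.
  set B := A - o 2 2 • c.pt 4 with hB
  have hBs : ∀ a b, B a b = -B b a := fun a b => by
    simp only [hB, Matrix.sub_apply, Matrix.smul_apply, smul_eq_mul]
    rw [hA, pt_skew]
    ring
  have hsym : symBlock B = 0 := by
    have h1 : symBlock B = symBlock A - o 2 2 • c.sigma := by
      ext k m
      fin_cases k <;> fin_cases m <;>
        simp [symBlock, hB, sigma, pt_apply, fst, snd] <;> ring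
    rw [h1]
    ext k m
    rw [Matrix.sub_apply, ho', Matrix.smul_apply]
    fin_cases k <;> simp [d0, o02, d1, o12, e2, o21, o11, o00]
  have hB4 : ∀ N, c.Orthogonal N → B 1 5 * (c.coord N 1 2 + c.coord N 2 1)
      + B 0 5 * (c.coord N 0 2 + c.coord N 2 0) + B 0 4 * (c.coord N 0 1 + c.coord N 1 0) = 0 := by
    intro N hN
    rw [← hN.pfPolar_pt_four hsym, hB, sub_eq_add_neg, ← neg_smul, pfPolar_add_left,
      pfPolar_smul_left, hT4 N hN, hN.pfPolar_eq_zero]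
    ring
  have h45 : B 0 4 = B 0 5 := by
    obtain ⟨N, hN, hNc⟩ := hc.exists_orthogonal !![0, 1, -1; 0, 0, 0; 0, 0, 0]
      (hdiag _ rfl rfl rfl) (by simp)
    have := hB4 N hN
    simp [hNc] at this
    linear_combination this
  have h415 : B 0 4 = B 1 5 := by
    obtain ⟨N, hN, hNc⟩ := hc.exists_orthogonal !![0, 0, 0; 1, 0, -1; 0, 0, 0]
      (hdiag _ rfl rfl rfl) (by simp)
    have := hB4 N hN
    simp [hNc] at this
    linear_combination this
  have s : ∀ k m, symBlock B k m = 0 := fun k m => by rw [hsym]; rfl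
  have s00 := s 0 0
  have s01 := s 0 1
  have s02 := s 0 2
  have s10 := s 1 0
  have s11 := s 1 1
  have s12 := s 1 2
  have s20 := s 2 0
  have s21 := s 2 1
  have s22 := s 2 2
  simp only [symBlock, Matrix.of_apply, Matrix.cons_val, neg_eq_zero] at s00 s01 s02 s10 s11 s12 s20 s21 s22
  have b05 : B 0 5 = B 0 4 := h45.symm
  have b15 : B 1 5 = B 0 4 := h415.symm
  have b24 : B 2 4 = B 0 4 := by linear_combination b15 - s01
  have b23 : B 2 3 = B 0 4 := by linear_combination b05 - s11
  have b13 : B 1 3 = B 0 4 := by linear_combination -s21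
  refine ⟨![B 0 3 - B 0 4, B 1 4 - B 0 4, B 2 5 - B 0 4, B 0 4, o 2 2], ?_⟩
  have hBeq : B = (B 0 3 - B 0 4) • c.pt 0 + (B 1 4 - B 0 4) • c.pt 1 + (B 2 5 - B 0 4) • c.pt 2
      + B 0 4 • c.pt 3 := by
    have hlt : ∀ a b, a < b → B a b = ((B 0 3 - B 0 4) • c.pt 0 + (B 1 4 - B 0 4) • c.pt 1
        + (B 2 5 - B 0 4) • c.pt 2 + B 0 4 • c.pt 3) a b := by
      intro a b hab
      fin_cases a <;> fin_cases b <;> (try exact absurd hab (by decide)) <;>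
        simp [pt_apply, fst, snd, s00, s02, s10, s12, s20, s22, b05, b15, b24, b23, b13]
    ext a b
    rcases lt_trichotomy a b with hab | rfl | hab
    · exact hlt a b hab
    · have h1 := hBs a a
      have h2 := c.pt_skew 0 a a
      have h3 := c.pt_skew 1 a a
      have h4 := c.pt_skew 2 a a
      have h5 := c.pt_skew 3 a a
      simp only [Matrix.add_apply, Matrix.smul_apply, smul_eq_mul]
      linear_combination h1 / 2 - (B 0 3 - B 0 4) * h2 / 2 - (B 1 4 - B 0 4) * h3 / 2
        - (B 2 5 - B 0 4) * h4 / 2 - B 0 4 * h5 / 2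
    · rw [hBs, hlt b a hab]
      simp only [Matrix.add_apply, Matrix.smul_apply, smul_eq_mul, c.pt_skew _ a b]
      ring
  have : A = B + o 2 2 • c.pt 4 := by rw [hB, sub_add_cancel]
  rw [this, Fin.sum_univ_five]
  conv_lhs => rw [hBeq]
  simp

end Config

/-! ### ### Decomposable forms in the span -/

theorem wedge4_eq_zero_of_isDecomposable {A : Matrix (Fin 6) (Fin 6) ℂ} (h : IsDecomposable A)
    (a b c d : Fin 6) : wedge4 A A a b c d = 0 := by
  obtain ⟨-, x, y, rfl⟩ := h
  exact wedge4_linePoint_self x y a b c d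

namespace Config

variable {c : Config}

theorem sum_pt_apply (t : Fin 5 → ℂ) (a b : Fin 6) :
    (∑ i, t i • c.pt i) a b = ∑ i, t i * (c.fst i a * c.snd i b - c.snd i a * c.fst i b) := by
  rw [Matrix.sum_apply]
  exact Finset.sum_congr rfl fun i _ => by rw [Matrix.smul_apply, pt_apply, smul_eq_mul]

theorem linearIndependent_pt (c : Config) : LinearIndependent ℂ c.pt := by
  rw [Fintype.linearIndependent_iff]
  intro t ht
  have h : ∀ a b, ∑ i, t i * (c.fst i a * c.snd i b - c.snd i a * c.fst i b) = 0 := fun a b => by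
    rw [← sum_pt_apply, ht]; rfl
  have h4 := h 0 2
  have h3 := h 0 4
  have h0 := h 0 3
  have h1 := h 1 4
  have h2 := h 2 5
  simp [Fin.sum_univ_five, fst, snd] at h4 h3 h0 h1 h2
  simp [h4] at h3 h0 h1 h2
  simp [h3] at h0 h1 h2
  intro i
  fin_cases i <;> assumption

/-- For `A = ∑ tᵢ uᵢ` decomposability gives `A ∧ A = 2 ∑_{i<j} tᵢ tⱼ uᵢ ∧ uⱼ = 0`. The coefficients
of this 4-form can be solved successively for all ten products `tᵢ tⱼ`, so at most one `tᵢ`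
survives. -/
theorem General.eq_smul_pt (hc : c.General) {t : Fin 5 → ℂ}
    (h : IsDecomposable (∑ i, t i • c.pt i)) : ∃ i, ∀ j, j ≠ i → t j = 0 := by
  have hw := wedge4_eq_zero_of_isDecomposable h
  simp only [wedge4, sum_pt_apply] at hw
  have a0 := hw 0 3 1 2
  have a1 := hw 0 3 1 5
  have a1' := hw 0 3 4 2
  have a2 := hw 0 3 4 5
  have b0 := hw 1 4 0 2
  have b1 := hw 1 4 0 5
  have c0 := hw 2 5 0 1
  have c1 := hw 2 5 0 4
  have d1 := hw 0 3 1 4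
  have d2 := hw 0 3 2 5
  have d3 := hw 1 4 2 5
  clear hw h
  simp [fst, snd, Fin.sum_univ_five] at a0 a1 a1' a2 b0 b1 c0 c1 d1 d2 d3
  have h43 : t 4 * t 3 = 0 :=
    (mul_eq_zero.mp (by linear_combination a0 / 2 : t 4 * t 3 * (1 + c.u) = 0)).resolve_right
      hc.u1_ne
  have h40 : t 4 * t 0 = 0 := by
    by_contra h0
    have e1 : c.v - c.u = 0 := (mul_eq_zero.mp (by
      linear_combination (a1 + a1') / 2 - (c.v + c.e₁ - c.u - c.e₂) * h43 :
        t 4 * t 0 * (c.v - c.u) = 0)).resolve_left h0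
    have e2 : c.e₁ + c.v * c.e₂ = 0 := (mul_eq_zero.mp (by
      linear_combination -a2 / 2 + (c.k + c.k * c.v - c.e₂ * c.v - c.e₁) * h43 :
        t 4 * t 0 * (c.e₁ + c.v * c.e₂) = 0)).resolve_left h0
    -- The two relations `e1`, `e2` say that the first row of `σ` is zero.
    refine hc.det_ne ?_
    rw [Matrix.det_fin_three]
    simp only [sigma, Matrix.of_apply, Matrix.cons_val]
    linear_combination (c.u * c.k - c.k * c.v) * e1 - (c.e₁ + c.u * c.e₂) * e2
  have h41 : t 4 * t 1 = 0 := by linear_combination -b0 / 2 - (1 + c.u) * h43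
  have h42 : t 4 * t 2 = 0 :=
    (mul_eq_zero.mp (by linear_combination c0 / 2 - (1 + c.u) * h43 :
      t 4 * t 2 * c.u = 0)).resolve_right hc.u_ne
  have h30 : t 3 * t 0 = 0 := by
    linear_combination a1 / 2 - (c.k - c.e₂ - c.u) * h43 + c.u * h40
  have h31 : t 3 * t 1 = 0 := by
    linear_combination b1 / 2 - (c.u + c.u * c.v + c.e₂ - c.e₁) * h43 - c.e₂ * h41
  have h32 : t 3 * t 2 = 0 := by
    linear_combination c1 / 2 - (1 - c.e₂ + c.v + c.e₁) * h43 - c.e₁ * h42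
  have h01 : t 0 * t 1 = 0 := by
    linear_combination d1 / 2 - (c.u * c.v + c.k - c.e₁) * h43 - c.u * c.v * h40 - c.k * h41
      - h30 - h31
  have h02 : t 0 * t 2 = 0 := by
    linear_combination d2 / 2 - (1 + c.k - c.e₂) * h43 - h40 - c.k * h42 - h30 - h32
  have h12 : t 1 * t 2 = 0 := by
    linear_combination d3 / 2 - (c.u + c.u * c.v + 1 + c.v) * h43 - c.u * c.v * h42 - h41
      - h31 - h32
  by_cases h4 : t 4 = 0
  · by_cases h3 : t 3 = 0
    · by_cases h0 : t 0 = 0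
      · by_cases h1 : t 1 = 0
        · exact ⟨2, by simp [Fin.forall_fin_succ, *]⟩
        · refine ⟨1, ?_⟩
          have := (mul_eq_zero.mp h12).resolve_left h1
          simp [Fin.forall_fin_succ, h0, h3, h4, this]
      · refine ⟨0, ?_⟩
        have e1 := (mul_eq_zero.mp h01).resolve_left h0
        have e2 := (mul_eq_zero.mp h02).resolve_left h0
        simp [Fin.forall_fin_succ, h3, h4, e1, e2]
    · refine ⟨3, ?_⟩
      have e0 := (mul_eq_zero.mp h30).resolve_left h3
      have e1 := (mul_eq_zero.mp h31).resolve_left h3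
      have e2 := (mul_eq_zero.mp h32).resolve_left h3
      simp [Fin.forall_fin_succ, h4, e0, e1, e2]
  · refine ⟨4, ?_⟩
    have e0 := (mul_eq_zero.mp h40).resolve_left h4
    have e1 := (mul_eq_zero.mp h41).resolve_left h4
    have e2 := (mul_eq_zero.mp h42).resolve_left h4
    have e3 := (mul_eq_zero.mp h43).resolve_left h4
    simp [Fin.forall_fin_succ, e0, e1, e2, e3]

theorem General.isFivePoints (hc : c.General) :
    IsFivePoints (Submodule.span ℂ (Set.range c.pt)) c.pt where
  decomposable i := ⟨c.linearIndependent_pt.ne_zero i, _, _, rfl⟩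
  linearIndependent := c.linearIndependent_pt
  span_eq := rfl
  only ω hω hd := by
    obtain ⟨t, rfl⟩ := (Submodule.mem_span_range_iff_exists_fun ℂ).mp hω
    obtain ⟨i, hi⟩ := hc.eq_smul_pt hd
    exact ⟨i, t i, Finset.sum_eq_single i (fun j _ hj => by rw [hi j hj, zero_smul]) (by simp)⟩

end Config

/-! ### ### Uniqueness of the five-point space -/

theorem IsDecomposable.pfPolar_self {A : Matrix (Fin 6) (Fin 6) ℂ} (h : IsDecomposable A)
    (N : Matrix (Fin 6) (Fin 6) ℂ) : pfPolar A A N = 0 := by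
  obtain ⟨-, x, y, rfl⟩ := h
  exact pfPolar_linePoint_self x y N

theorem IsDecomposable.skew {A : Matrix (Fin 6) (Fin 6) ℂ} (h : IsDecomposable A)
    (a b : Fin 6) : A a b = -A b a := by
  obtain ⟨-, x, y, rfl⟩ := h
  change linePoint x y a b = -linePoint x y b a
  simp only [linePoint_apply]; ring

theorem pfPolar_eq_zero_of_mem_span {s : Set (Matrix (Fin 6) (Fin 6) ℂ)}
    {A N : Matrix (Fin 6) (Fin 6) ℂ} (h : ∀ B ∈ s, pfPolar A B N = 0)
    {B : Matrix (Fin 6) (Fin 6) ℂ} (hB : B ∈ Submodule.span ℂ s) : pfPolar A B N = 0 := by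
  induction hB using Submodule.span_induction with
  | mem x hx => exact h x hx
  | zero => rw [← zero_smul ℂ (0 : Matrix (Fin 6) (Fin 6) ℂ), pfPolar_smul_mid, zero_mul]
  | add x y _ _ hx hy => rw [pfPolar_add_mid, hx, hy, add_zero]
  | smul r x _ hx => rw [pfPolar_smul_mid, hx, mul_zero]

namespace Config

variable {c : Config}

theorem Orthogonal.pfPolar_eq_zero_of_mem {N : Matrix (Fin 6) (Fin 6) ℂ} (h : c.Orthogonal N)
    {A B : Matrix (Fin 6) (Fin 6) ℂ} (hA : A ∈ Submodule.span ℂ (Set.range c.pt))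
    (hB : B ∈ Submodule.span ℂ (Set.range c.pt)) : pfPolar A B N = 0 := by
  refine pfPolar_eq_zero_of_mem_span ?_ hB
  rintro _ ⟨j, rfl⟩
  rw [pfPolar_comm]
  refine pfPolar_eq_zero_of_mem_span ?_ hA
  rintro _ ⟨i, rfl⟩
  exact h.pfPolar_eq_zero j i

/-- No `uⱼ` of `W` lies in `V`, so `W = V ⊕ ℂu₀` and `uⱼ = m + r u₀` with `m ∈ V` and `r ≠ 0`.
Pairing `uⱼ ∧ uⱼ = 0` with an orthogonal `N` kills `u₀ ∧ u₀` and `m ∧ m`, leaving `u₀ ∧ m ∧ N = 0`.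
Hence `u₀ ∧ uⱼ ∧ N = 0` for all `j`, in particular `u₀ ∧ V ∧ N = 0`, and the linear characterization
puts `u₀` in the span of the configuration. -/
theorem General.eq_span_of_isFivePoints (hc : c.General) {β : Fin 4 → ℂ} (hβ : ∀ i, β i ≠ 0)
    {V : Submodule ℂ (Matrix (Fin 6) (Fin 6) ℂ)} (hV : Module.finrank ℂ V = 4)
    (hVpt : V ≤ Submodule.span ℂ (Set.range c.pt)) (hspace : ∀ i, c.space β i ∈ V)
    (hpt : ∀ i, c.pt i ∉ V) {W : Submodule ℂ (Matrix (Fin 6) (Fin 6) ℂ)}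
    {u : Fin 5 → Matrix (Fin 6) (Fin 6) ℂ} (hW : IsFivePoints W u) (hVW : V ≤ W) :
    W = Submodule.span ℂ (Set.range c.pt) := by
  have hu : ∀ i, u i ∉ V := fun i hi => by
    obtain ⟨j, r, hr⟩ := hc.isFivePoints.only _ (hVpt hi) (hW.decomposable i)
    have hr0 : r ≠ 0 := by
      rintro rfl
      exact (hW.decomposable i).1 (by rw [hr, zero_smul])
    exact hpt j ((V.smul_mem_iff hr0).mp (hr ▸ hi))
  have huW : ∀ i, u i ∈ W := fun i => hW.span_eq ▸ Submodule.subset_span ⟨i, rfl⟩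
  have hW5 : Module.finrank ℂ W = 5 := by
    rw [hW.span_eq, finrank_span_eq_card hW.linearIndependent, Fintype.card_fin]
  have hsup : V ⊔ Submodule.span ℂ {u 0} = W := by
    have hle : V ⊔ Submodule.span ℂ {u 0} ≤ W := sup_le hVW (by simpa using huW 0)
    refine Submodule.eq_of_le_of_finrank_le hle ?_
    have hlt : V < V ⊔ Submodule.span ℂ {u 0} := by
      refine lt_of_le_of_ne le_sup_left fun h => hu 0 ?_
      rw [h]
      exact Submodule.mem_sup_right (Submodule.mem_span_singleton_self _)
    have := Submodule.finrank_lt_finrank_of_lt hlt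
    omega
  have horth : ∀ N, c.Orthogonal N → ∀ i, pfPolar (u 0) (c.space β i) N = 0 := by
    intro N hN i
    have hx := hVW (hspace i)
    rw [hW.span_eq] at hx
    refine pfPolar_eq_zero_of_mem_span ?_ hx
    rintro _ ⟨j, rfl⟩
    have hj := huW j
    rw [← hsup, Submodule.mem_sup] at hj
    obtain ⟨m, hm, y, hy, hmy⟩ := hj
    obtain ⟨r, rfl⟩ := Submodule.mem_span_singleton.mp hy
    have hr : r ≠ 0 := by
      rintro rfl
      exact hu j (by rw [← hmy, zero_smul, add_zero]; exact hm)
    have e := (hW.decomposable j).pfPolar_self N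
    have e0 := (hW.decomposable 0).pfPolar_self N
    have em := hN.pfPolar_eq_zero_of_mem (hVpt hm) (hVpt hm)
    rw [← hmy] at e ⊢
    simp only [pfPolar_add_left, pfPolar_add_mid, pfPolar_smul_left, pfPolar_smul_mid, e0, em,
      pfPolar_comm m (u 0)] at e ⊢
    have : r * pfPolar (u 0) m N = 0 := by linear_combination e / 2
    rw [(mul_eq_zero.mp this).resolve_left hr]
    ring
  obtain ⟨t, ht⟩ := hc.exists_eq_sum_of_pfPolar hβ (hW.decomposable 0).skew horth
  have hle : W ≤ Submodule.span ℂ (Set.range c.pt) := by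
    rw [← hsup]
    refine sup_le hVpt ?_
    rw [Submodule.span_singleton_le_iff_mem, Submodule.mem_span_range_iff_exists_fun]
    exact ⟨t, ht.symm⟩
  refine Submodule.eq_of_le_of_finrank_le hle ?_
  rw [finrank_span_eq_card c.linearIndependent_pt, hW5, Fintype.card_fin]

end Config

/-! ### ### The map `Φ₂` at `M` -/

namespace HomParam

/-- The linear map `z ↦ M(z)`. -/
def valueMap (q : HomParam) : (Fin 4 → ℂ) →ₗ[ℂ] Matrix (Fin 6) (Fin 6) ℂ :=
  ∑ i, (q.wDual i).smulRight (q.config.pt i)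

theorem valueMap_apply (q : HomParam) (z : Fin 4 → ℂ) : q.valueMap z = valueAt q.M z := by
  simp [valueMap, valueAt_M, wDual_apply]

theorem valueSpan_M (q : HomParam) : valueSpan q.M = LinearMap.range q.valueMap := by
  have : valueAt q.M = q.valueMap := funext fun z => (q.valueMap_apply z).symm
  rw [valueSpan, this, ← LinearMap.coe_range, Submodule.span_eq]

theorem eq_of_valueAt_eq_sum (q : HomParam) {z : Fin 4 → ℂ} {t : Fin 5 → ℂ}
    (h : valueAt q.M z = ∑ i, t i • q.config.pt i) (i : Fin 5) :
    MvPolynomial.eval z (q.w i) = t i := by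
  rw [valueAt_M, ← sub_eq_zero, ← Finset.sum_sub_distrib] at h
  simp only [← sub_smul] at h
  exact sub_eq_zero.mp (Fintype.linearIndependent_iff.mp q.config.linearIndependent_pt _ h i)

theorem valueMap_injective (q : HomParam) : Function.Injective q.valueMap := by
  rw [injective_iff_map_eq_zero]
  intro z hz
  rw [valueMap_apply] at hz
  have h := q.eq_of_valueAt_eq_sum (z := z) (t := 0) (by simp [hz])
  refine q.coordEquiv.map_eq_zero_iff.mp (funext fun i => ?_)
  rw [← eval_w_castSucc, h]
  rfl

theorem finrank_valueSpan_M (q : HomParam) : Module.finrank ℂ (valueSpan q.M) = 4 := by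
  rw [valueSpan_M, LinearMap.finrank_range_of_inj q.valueMap_injective, Module.finrank_fin_fun]

theorem valueSpan_M_le (q : HomParam) :
    valueSpan q.M ≤ Submodule.span ℂ (Set.range q.config.pt) := by
  rw [valueSpan, Submodule.span_le]
  rintro _ ⟨z, rfl⟩
  rw [valueAt_M]
  exact sum_mem fun i _ => Submodule.smul_mem _ _ (Submodule.subset_span ⟨i, rfl⟩)

theorem space_mem_valueSpan (q : HomParam) (i : Fin 4) :
    q.config.space q.β i ∈ valueSpan q.M := by
  refine Submodule.subset_span ⟨q.coordEquiv.symm (Pi.single i 1), ?_⟩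
  simp [valueAt_M_eq_space, Pi.single_apply]

/-- The coordinates of a value of `M` satisfy the relation between the `wᵢ`, while those of `uᵢ`
alone do not, since every coefficient of the relation is nonzero. -/
theorem pt_notMem_valueSpan (q : HomParam) (i : Fin 5) : q.config.pt i ∉ valueSpan q.M := by
  rw [valueSpan_M]
  rintro ⟨z, hz⟩
  rw [valueMap_apply] at hz
  have h := q.eq_of_valueAt_eq_sum (z := z) (t := Pi.single i 1) (by simp [hz, Pi.single_apply])
  have hs := q.sum_rel_mul_eval_w z
  simp only [h, Pi.single_apply, mul_ite, mul_one, mul_zero, Finset.sum_ite_eq', Finset.mem_univ,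
    if_true] at hs
  exact q.rel_ne i hs

theorem valueAt_mem_span_iff (q : HomParam) (i : Fin 5) (z : Fin 4 → ℂ) :
    valueAt q.M z ∈ Submodule.span ℂ (q.config.pt '' {j | j ≠ i}) ↔
      MvPolynomial.eval z (q.w i) = 0 := by
  have hrest : ∑ j ∈ Finset.univ.erase i, MvPolynomial.eval z (q.w j) • q.config.pt j ∈
      Submodule.span ℂ (q.config.pt '' {j | j ≠ i}) :=
    sum_mem fun j hj => Submodule.smul_mem _ _
      (Submodule.subset_span ⟨j, Finset.ne_of_mem_erase hj, rfl⟩)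
  rw [valueAt_M, ← Finset.add_sum_erase _ _ (Finset.mem_univ i), Submodule.add_mem_iff_left _ hrest]
  constructor
  · intro h
    by_contra h0
    exact q.config.linearIndependent_pt.notMem_span_image (s := {j | j ≠ i}) (by simp)
      ((Submodule.smul_mem_iff _ h0).mp h)
  · intro h
    rw [h, zero_smul]
    exact zero_mem _

theorem phi2Eq (q : HomParam) (hc : q.config.General) :
    Phi2Eq q.M q.surface q.pentahedron where
  mem_sm := q.M_mem_smLocus
  surface := q.isEquation_pf6
  finrank_valueSpan := q.finrank_valueSpan_M
  unique := by
    refine ⟨_, ⟨⟨_, hc.isFivePoints⟩, q.valueSpan_M_le⟩, ?_⟩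
    rintro W ⟨⟨u, hu⟩, hW⟩
    exact hc.eq_span_of_isFivePoints q.β_ne q.finrank_valueSpan_M q.valueSpan_M_le
      q.space_mem_valueSpan q.pt_notMem_valueSpan hu hW
  planes := ⟨_, _, hc.isFivePoints, q.valueSpan_M_le, by
    simp only [valueAt_mem_span_iff]
    rfl⟩
  mem_H := q.mem_inscribedPairs

end HomParam

/-! ### Smoothness of cubic forms -/

theorem eval_smul_of_isHomogeneous {f : Poly} {n : ℕ} (h : f.IsHomogeneous n) (r : ℂ)
    (z : Fin 4 → ℂ) : MvPolynomial.eval (r • z) f = r ^ n * MvPolynomial.eval z f := by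
  rw [MvPolynomial.eval_eq, MvPolynomial.eval_eq, Finset.mul_sum]
  refine Finset.sum_congr rfl fun d hd => ?_
  have hdeg : ∑ i ∈ d.support, d i = n := by
    have := h (MvPolynomial.mem_support_iff.mp hd)
    rwa [Finsupp.weight_apply, Finsupp.sum, Finset.sum_congr rfl fun i _ => by
      rw [Pi.one_apply, smul_eq_mul, mul_one]] at this
  simp only [Pi.smul_apply, smul_eq_mul, mul_pow, Finset.prod_mul_distrib,
    Finset.prod_pow_eq_pow_sum, hdeg]
  ring

theorem isHomogeneous_fiveForms_X (b : Fin 5 → ℂ) (i : Fin 5) :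
    (fiveForms b MvPolynomial.X i).IsHomogeneous 1 := by
  induction i using Fin.lastCases with
  | last =>
    simp only [fiveForms, Fin.snoc_last]
    exact MvPolynomial.IsHomogeneous.sum _ _ _ fun j _ => MvPolynomial.isHomogeneous_C_mul_X _ _
  | cast i => simpa [fiveForms] using MvPolynomial.isHomogeneous_X ℂ i

theorem isHomogeneous_tripleCubic {w : Fin 5 → Poly} (hw : ∀ i, (w i).IsHomogeneous 1)
    (a : Triple → ℂ) : (tripleCubic a w).IsHomogeneous 3 :=
  MvPolynomial.IsHomogeneous.sum _ _ _ fun _ _ => ((((hw _).C_mul _).mul (hw _)).mul (hw _))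

theorem continuous_eval_tripleCubic (w : Fin 5 → Poly) :
    Continuous fun x : (Triple → ℂ) × (Fin 4 → ℂ) =>
      MvPolynomial.eval x.2 (tripleCubic x.1 w) := by
  simp only [tripleCubic, map_sum, map_mul, MvPolynomial.eval_C]
  have h : ∀ i, Continuous fun x : (Triple → ℂ) × (Fin 4 → ℂ) => MvPolynomial.eval x.2 (w i) :=
    fun i => (MvPolynomial.continuous_eval (w i)).comp continuous_snd
  exact continuous_finsetSum _ fun t _ =>
    ((((continuous_apply t).comp continuous_fst).mul (h _)).mul (h _)).mul (h _)

theorem continuous_eval_pderiv_tripleCubic (w : Fin 5 → Poly) (i : Fin 4) :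
    Continuous fun x : (Triple → ℂ) × (Fin 4 → ℂ) =>
      MvPolynomial.eval x.2 (MvPolynomial.pderiv i (tripleCubic x.1 w)) := by
  simp only [tripleCubic, map_sum, mul_assoc, MvPolynomial.pderiv_C_mul, map_mul,
    MvPolynomial.eval_C]
  exact continuous_finsetSum _ fun t _ => ((continuous_apply t).comp continuous_fst).mul
    ((MvPolynomial.continuous_eval _).comp continuous_snd)

/-- Smoothness is an open condition on the coefficients. -/
theorem eventually_isSmoothForm_tripleCubic {w : Fin 5 → Poly} (hw : ∀ i, (w i).IsHomogeneous 1)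
    {a : Triple → ℂ} (ha : IsSmoothForm (tripleCubic a w)) :
    ∀ᶠ a' in nhds a, IsSmoothForm (tripleCubic a' w) := by
  -- Compactness of the unit sphere gives one neighbourhood valid for all unit vectors; homogeneity
  -- then extends the conclusion to every nonzero `z`.
  have hev := (isCompact_sphere (0 : Fin 4 → ℂ) 1).eventually_forall_of_forall_eventually
    (x₀ := a) (P := fun a' z => MvPolynomial.eval z (tripleCubic a' w) ≠ 0 ∨
      ∃ i, MvPolynomial.eval z (MvPolynomial.pderiv i (tripleCubic a' w)) ≠ 0) (by
    intro z hz
    have hz0 : z ≠ 0 := by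
      rintro rfl
      simp at hz
    by_cases h0 : MvPolynomial.eval z (tripleCubic a w) = 0
    · obtain ⟨i, hi⟩ := ha z hz0 h0
      have := (continuous_eval_pderiv_tripleCubic w i).continuousAt.eventually_ne (x := (a, z)) hi
      filter_upwards [this] with x hx using Or.inr ⟨i, hx⟩
    · have := (continuous_eval_tripleCubic w).continuousAt.eventually_ne (x := (a, z)) h0
      filter_upwards [this] with x hx using Or.inl hx)
  filter_upwards [hev] with a' h z hz h0
  have hn : ((‖z‖ : ℂ)) ≠ 0 := by simpa using hz
  have hf := isHomogeneous_tripleCubic hw a'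
  rcases h ((‖z‖ : ℂ)⁻¹ • z) (by simp [norm_smul, hz]) with h1 | ⟨i, hi⟩
  · rw [eval_smul_of_isHomogeneous hf, h0, mul_zero] at h1
    exact absurd rfl h1
  · rw [eval_smul_of_isHomogeneous hf.pderiv] at hi
    exact ⟨i, right_ne_zero_of_mul hi⟩

/-- The Clebsch diagonal cubic surface is smooth. -/
theorem isSmoothForm_clebsch :
    IsSmoothForm (tripleCubic 1 (fiveForms ![1, 1, 1, 1, -1] MvPolynomial.X)) := by
  -- The five forms sum to zero, so three times their third elementary symmetric function is the sum
  -- of their cubes.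
  have hf : MvPolynomial.C 3 * tripleCubic 1 (fiveForms ![1, 1, 1, 1, -1] MvPolynomial.X) =
      (∑ i, MvPolynomial.X i ^ 3 - (∑ i, MvPolynomial.X i) ^ 3 : Poly) := by
    have h0 : fiveForms ![1, 1, 1, 1, -1] MvPolynomial.X 0 = MvPolynomial.X 0 := rfl
    have h1 : fiveForms ![1, 1, 1, 1, -1] MvPolynomial.X 1 = MvPolynomial.X 1 := rfl
    have h2 : fiveForms ![1, 1, 1, 1, -1] MvPolynomial.X 2 = MvPolynomial.X 2 := rfl
    have h3 : fiveForms ![1, 1, 1, 1, -1] MvPolynomial.X 3 = MvPolynomial.X 3 := rfl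
    have h4 : fiveForms ![1, 1, 1, 1, -1] MvPolynomial.X 4 = -∑ i, MvPolynomial.X i := by
      change fiveForms ![1, 1, 1, 1, -1] MvPolynomial.X (Fin.last 4) = _
      simp only [fiveForms, Fin.snoc_last]
      simp [Fin.sum_univ_four]
      ring
    rw [tripleCubic_eq, h0, h1, h2, h3, h4]
    simp only [Pi.one_apply, MvPolynomial.C_1, Fin.sum_univ_four, map_ofNat]
    ring
  intro z hz h0
  by_contra hc
  push Not at hc
  have hg : ∀ i, z i ^ 2 = (∑ j, z j) ^ 2 := fun i => by
    have h := congrArg (fun f => MvPolynomial.eval z (MvPolynomial.pderiv i f)) hf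
    simp only [MvPolynomial.pderiv_C_mul, map_mul, hc i, mul_zero] at h
    simp [MvPolynomial.pderiv_X, Pi.single_apply] at h
    linear_combination -h / 3
  have hs : ∀ i, z i = ∑ j, z j ∨ z i = -∑ j, z j := fun i => sq_eq_sq_iff_eq_or_eq_neg.mp (hg i)
  -- All `zᵢ` equal `±s`, where `s` is their sum. A sum of four signs is even, so `s` is an even
  -- multiple of itself and vanishes.
  have hsum : ∑ j, z j = 0 := by
    have e := Fin.sum_univ_four z
    set s := ∑ j, z j
    rcases hs 0 with e0 | e0 <;> rcases hs 1 with e1 | e1 <;> rcases hs 2 with e2 | e2 <;>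
      rcases hs 3 with e3 | e3 <;> rw [e0, e1, e2, e3] at e <;> first
        | linear_combination e
        | linear_combination -e
        | linear_combination e / 3
        | linear_combination -e / 3
        | linear_combination e / 5
  exact hz (funext fun i => by simpa [hsum] using hg i)

/-! ### The dense open subset of the parameter space -/

/-- The coefficients `a_{ijk}` attached to `u, v, a₁₂₄, e₁, e₂`. -/
def coeffs {R : Type*} [CommRing R] (u v k e₁ e₂ : R) (t : Triple) : R :=
  if t.1 = (0, 2, 4) then u * v
  else if t.1 = (0, 3, 4) then 1 + u * v + u + v
  else if t.1 = (1, 2, 4) then k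
  else if t.1 = (1, 3, 4) then 1 + k - e₂
  else if t.1 = (2, 3, 4) then u * v + k - e₁
  else 1

theorem map_coeffs {R S : Type*} [CommRing R] [CommRing S] (f : R →+* S) (u v k e₁ e₂ : R)
    (t : Triple) : f (coeffs u v k e₁ e₂ t) = coeffs (f u) (f v) (f k) (f e₁) (f e₂) t := by
  simp only [coeffs]
  split_ifs <;> simp

theorem configOf_coeffs (c : Config) : configOf (coeffs c.u c.v c.k c.e₁ c.e₂) c.u = c := by
  obtain ⟨u, v, k, e₁, e₂⟩ := c
  simp only [configOf, coeffs]
  simp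
  ring

/-- Trading `a₀₂₄, a₀₃₄` for the roots `u, v` of the quadratic equation solves it. The pairs `(a,
u)` are thereby parametrized by five free numbers, which may be moved along straight lines. -/
theorem HomParam.coeffs_config (q : HomParam) :
    coeffs q.config.u q.config.v q.config.k q.config.e₁ q.config.e₂ = q.a := by
  have h := q.a024_eq
  funext t
  have ht : t.1.2.2 ≤ 3 ∨ t = ⟨(0, 1, 4), by decide⟩ ∨ t = ⟨(0, 2, 4), by decide⟩ ∨
      t = ⟨(0, 3, 4), by decide⟩ ∨ t = ⟨(1, 2, 4), by decide⟩ ∨ t = ⟨(1, 3, 4), by decide⟩ ∨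
      t = ⟨(2, 3, 4), by decide⟩ := by
    revert t; decide
  rcases ht with ht | rfl | rfl | rfl | rfl | rfl | rfl
  · rw [q.a_eq_one t ht, coeffs]
    have h4 : ∀ i j : Fin 5, t.1 ≠ (i, j, 4) := fun i j e => by
      rw [e] at ht
      exact absurd (show (4 : Fin 5) ≤ 3 from ht) (by decide)
    simp [h4]
  · rw [q.a014_eq]; simp [coeffs]
  · rw [h]; simp [coeffs]
  · simp [coeffs]
    rw [← h]
    simp only [config, configOf]
    ring
  · simp [coeffs, config, configOf]
  · simp [coeffs]
    simp only [config, configOf]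
    ring
  · simp [coeffs]
    rw [← h]
    simp only [config, configOf]
    ring

/-- The polynomial whose non-vanishing defines general configurations. -/
def Config.disc {R : Type*} [CommRing R] (u v k e₁ e₂ : R) : R :=
  u * v * (1 + u) * (1 + v) * k * (1 + k - e₂) * (u * v + k - e₁) *
    (u * ((v - u) * k - (e₁ + v * e₂) * e₂) - ((v - u) * (k * v) + (e₁ + v * e₂) * e₁))

theorem Config.general_iff (c : Config) :
    c.General ↔ Config.disc c.u c.v c.k c.e₁ c.e₂ ≠ 0 := by
  have hdet : c.sigma.det = c.u * ((c.v - c.u) * c.k - (c.e₁ + c.v * c.e₂) * c.e₂) -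
      ((c.v - c.u) * (c.k * c.v) + (c.e₁ + c.v * c.e₂) * c.e₁) := by
    rw [Matrix.det_fin_three]
    simp only [sigma, Matrix.of_apply, Matrix.cons_val]
    ring
  simp only [disc, ← hdet, mul_ne_zero_iff]
  constructor
  · rintro ⟨h1, h2, h3, h4, h5, h6, h7, h8⟩
    exact ⟨⟨⟨⟨⟨⟨⟨h1, h2⟩, h3⟩, h4⟩, h5⟩, h6⟩, h7⟩, h8⟩
  · rintro ⟨⟨⟨⟨⟨⟨⟨h1, h2⟩, h3⟩, h4⟩, h5⟩, h6⟩, h7⟩, h8⟩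
    exact ⟨h1, h2, h3, h4, h5, h6, h7, h8⟩

/-- The points of `PGL₄ × 𝓐'₉` whose five lines are in general position. -/
def generalLocus : Set ParamSpace := {p | (configOf p.2.1.1 p.2.1.2.2).General}

theorem toParam_mem_generalLocus (q : HomParam) : q.toParam ∈ generalLocus ↔ q.config.General :=
  Iff.rfl

open MvPolynomial in
/-- The equation of the complement of `generalLocus` in the homogeneous coordinates. -/
def discPoly : MvPolynomial ((Fin 4 × Fin 4) ⊕ Triple ⊕ Fin 5 ⊕ Unit) ℂ :=
  let a (t : Triple) : MvPolynomial ((Fin 4 × Fin 4) ⊕ Triple ⊕ Fin 5 ⊕ Unit) ℂ := X (.inr (.inl t))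
  let u : MvPolynomial ((Fin 4 × Fin 4) ⊕ Triple ⊕ Fin 5 ⊕ Unit) ℂ := X (.inr (.inr (.inr ())))
  Config.disc u (-(1 + a ⟨(0, 2, 4), by decide⟩ - a ⟨(0, 3, 4), by decide⟩) - u)
    (a ⟨(1, 2, 4), by decide⟩)
    (a ⟨(0, 2, 4), by decide⟩ + a ⟨(1, 2, 4), by decide⟩ - a ⟨(2, 3, 4), by decide⟩)
    (1 + a ⟨(1, 2, 4), by decide⟩ - a ⟨(1, 3, 4), by decide⟩)

theorem eval_discPoly (q : HomParam) : MvPolynomial.eval q.coords discPoly =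
    Config.disc q.config.u q.config.v q.config.k q.config.e₁ q.config.e₂ := by
  simp [discPoly, Config.disc, HomParam.coords, HomParam.config, configOf]

theorem isOpen_generalLocus : IsOpen generalLocus := by
  refine isOpen_coinduced.mpr ((@isOpen_induced_iff _ _ (zariskiTopology _) _ _).mpr
    ⟨{x | MvPolynomial.eval x discPoly ≠ 0}, TopologicalSpace.isOpen_generateFrom_of_mem ⟨_, rfl⟩,
      ?_⟩)
  ext q
  rw [Set.mem_preimage, Set.mem_ofPred_eq, eval_discPoly, ← Config.general_iff]
  rfl

theorem isTopologicalBasis_zariski (ι : Type) :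
    @TopologicalSpace.IsTopologicalBasis _ (zariskiTopology ι)
      (Set.range fun g : MvPolynomial ι ℂ => {x | MvPolynomial.eval x g ≠ 0}) := by
  let := zariskiTopology ι
  refine ⟨?_, ?_, rfl⟩
  · rintro _ ⟨f, rfl⟩ _ ⟨g, rfl⟩ x ⟨hf, hg⟩
    refine ⟨_, ⟨f * g, rfl⟩, ?_, fun y hy => ?_⟩
    · simpa using ⟨hf, hg⟩
    · simpa using hy
  · exact Set.eq_univ_of_forall fun x => ⟨_, ⟨1, rfl⟩, by simp⟩

theorem HomParam.toParam_surjective : Function.Surjective HomParam.toParam := by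
  rintro ⟨P, ⟨⟨a, b, u⟩, h⟩⟩
  obtain ⟨P, rfl⟩ := Matrix.ProjGenLinGroup.mk_surjective P
  have hb : Projectivization.mk ℂ b.rep b.rep_nonzero = b := b.mk_rep
  refine ⟨⟨P, a, b.rep, u, b.rep_nonzero, by rw [hb]; exact h⟩, ?_⟩
  simp only [toParam, hb]
  rfl

theorem HomParam.exists_mem_of_isOpen {V : Set ParamSpace} (hV : IsOpen V) {q : HomParam}
    (hq : q.toParam ∈ V) : ∃ g : MvPolynomial ((Fin 4 × Fin 4) ⊕ Triple ⊕ Fin 5 ⊕ Unit) ℂ,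
      MvPolynomial.eval q.coords g ≠ 0 ∧
      ∀ q' : HomParam, MvPolynomial.eval q'.coords g ≠ 0 → q'.toParam ∈ V := by
  obtain ⟨O, hO, hOV⟩ :=
    (@isOpen_induced_iff _ _ (zariskiTopology _) _ _).mp (isOpen_coinduced.mp hV)
  have hqO : q.coords ∈ O := by
    have : q ∈ toParam ⁻¹' V := hq
    rwa [← hOV] at this
  obtain ⟨_, ⟨g, rfl⟩, hg, hgO⟩ :=
    @TopologicalSpace.IsTopologicalBasis.exists_subset_of_mem_open _ (zariskiTopology _) _
      (isTopologicalBasis_zariski _) _ _ hqO hO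
  refine ⟨g, hg, fun q' hq' => ?_⟩
  have : q' ∈ coords ⁻¹' O := hgO hq'
  rwa [hOV] at this

theorem eval_aeval_polynomial {ι : Type} (p : ι → Polynomial ℂ) (g : MvPolynomial ι ℂ) (t : ℂ) :
    (MvPolynomial.aeval p g).eval t = MvPolynomial.eval (fun i => (p i).eval t) g := by
  induction g using MvPolynomial.induction_on with
  | C a => simp
  | add f g hf hg => simp [hf, hg]
  | mul_X f i hf => simp [hf]

/-- The polynomial of degree `1` with value `x` at `0` and `y` at `1`. -/
def segment (x y : ℂ) : Polynomial ℂ := Polynomial.C x + Polynomial.C (y - x) * Polynomial.X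

theorem eval_segment_zero (x y : ℂ) : (segment x y).eval 0 = x := by simp [segment]

theorem eval_segment_one (x y : ℂ) : (segment x y).eval 1 = y := by simp [segment]

theorem map_disc {R S : Type*} [CommRing R] [CommRing S] (f : R →+* S) (u v k e₁ e₂ : R) :
    f (Config.disc u v k e₁ e₂) = Config.disc (f u) (f v) (f k) (f e₁) (f e₂) := by
  simp [Config.disc]

/-- A basic open set around a point is given by a polynomial `g`. Along the line joining the
configuration of that point to a general one, `g` is nonzero at time `0` and the discriminant at
time `1`, so their product has finitely many roots. Times close to `0` in the classical topology,
off these roots, also keep the cubic smooth. -/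
theorem dense_generalLocus : Dense generalLocus := by
  rw [dense_iff_inter_open]
  rintro V hV ⟨x, hx⟩
  obtain ⟨q, rfl⟩ := HomParam.toParam_surjective x
  obtain ⟨g, hg, hgV⟩ := HomParam.exists_mem_of_isOpen hV hx
  -- The target `(u, v, k, e₁, e₂) = (1, 2, 1, 0, 1)` is general: its discriminant is `-108`.
  set u := segment q.config.u 1
  set v := segment q.config.v 2
  set k := segment q.config.k 1
  set e₁ := segment q.config.e₁ 0
  set e₂ := segment q.config.e₂ 1
  set p : (Fin 4 × Fin 4) ⊕ Triple ⊕ Fin 5 ⊕ Unit → Polynomial ℂ :=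
    Sum.elim (fun ij => Polynomial.C ((q.P : Matrix (Fin 4) (Fin 4) ℂ) ij.1 ij.2))
      (Sum.elim (coeffs u v k e₁ e₂)
        (Sum.elim (fun i => Polynomial.C (q.b i)) fun _ => u)) with hp
  set a : ℂ → Triple → ℂ := fun t => coeffs (u.eval t) (v.eval t) (k.eval t) (e₁.eval t) (e₂.eval t)
    with ha
  have ha0 : a 0 = q.a := by
    simp only [ha, u, v, k, e₁, e₂, eval_segment_zero, HomParam.coeffs_config]
  have hat : ∀ t s, (coeffs u v k e₁ e₂ s).eval t = a t s := fun t s =>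
    map_coeffs (Polynomial.evalRingHom t) _ _ _ _ _ s
  have hcont : Continuous a := by
    refine continuous_pi fun s => ?_
    simp only [← hat]
    exact Polynomial.continuous _
  have hp0 : (fun i => (p i).eval 0) = q.coords := by
    funext i
    rcases i with i | i | i | i
    · simp [hp, HomParam.coords]
    · simp only [hp, Sum.elim_inr, Sum.elim_inl, HomParam.coords, hat, ha0]
    · simp [hp, HomParam.coords]
    · simp only [hp, Sum.elim_inr, HomParam.coords]
      exact eval_segment_zero _ _
  set F := MvPolynomial.aeval p g * Config.disc u v k e₁ e₂ with hF
  have hF0 : F ≠ 0 := by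
    refine mul_ne_zero (fun h => ?_) (fun h => ?_)
    · have := eval_aeval_polynomial p g 0
      rw [h, hp0, Polynomial.eval_zero] at this
      exact hg this.symm
    · have := map_disc (Polynomial.evalRingHom 1) u v k e₁ e₂
      rw [h, map_zero] at this
      simp only [Polynomial.coe_evalRingHom, u, v, k, e₁, e₂, eval_segment_one] at this
      norm_num [Config.disc] at this
  have hFt : ∀ᶠ t in nhdsWithin (0 : ℂ) {0}ᶜ, F.eval t ≠ 0 := by
    have hfin : {t | F.IsRoot t}.Finite := Polynomial.finite_setOfPred_isRoot hF0
    have := (hfin.subset Set.sdiff_subset : ({t | F.IsRoot t} \ {0}).Finite).isClosed.isOpen_compl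
    filter_upwards [mem_nhdsWithin_of_mem_nhds (this.mem_nhds (x := (0 : ℂ)) (by simp)),
      self_mem_nhdsWithin] with t ht ht0 h
    exact ht ⟨h, ht0⟩
  have hsm : ∀ᶠ t in nhdsWithin (0 : ℂ) {0}ᶜ,
      IsSmoothForm (tripleCubic (a t)
        (fiveForms (Projectivization.mk ℂ q.b q.b_ne_zero).rep MvPolynomial.X)) := by
    have h0 := q.mem_A9'.2.2.2.1
    simp only [← ha0] at h0
    exact ((hcont.tendsto 0).mono_left nhdsWithin_le_nhds).eventually
      (eventually_isSmoothForm_tripleCubic (isHomogeneous_fiveForms_X _) h0)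
  obtain ⟨t, ht, hst⟩ := (hFt.and hsm).exists
  rw [hF, Polynomial.eval_mul, mul_ne_zero_iff, eval_aeval_polynomial] at ht
  have hd : Config.disc (u.eval t) (v.eval t) (k.eval t) (e₁.eval t) (e₂.eval t) ≠ 0 := by
    have := map_disc (Polynomial.evalRingHom t) u v k e₁ e₂
    simp only [Polynomial.coe_evalRingHom] at this
    rw [← this]
    exact ht.2
  let q' : HomParam := {
    P := q.P
    a := a t
    b := q.b
    u := u.eval t
    b_ne_zero := q.b_ne_zero
    mem_A9' := by
      refine ⟨by simp [ha, coeffs], fun s hs => ?_, q.mem_A9'.2.2.1, hst, ?_⟩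
      · have h4 : ∀ i j : Fin 5, s.1 ≠ (i, j, 4) := fun i j e => by
          rw [e] at hs
          exact absurd (show (4 : Fin 5) ≤ 3 from hs) (by decide)
        simp [ha, coeffs, h4]
      · simp [ha, coeffs]
        ring }
  have hq' : q'.coords = fun i => (p i).eval t := by
    funext i
    rcases i with i | i | i | i
    · simp [hp, HomParam.coords, q']
    · simp only [hp, Sum.elim_inr, Sum.elim_inl, HomParam.coords, hat, q']
    · simp [hp, HomParam.coords, q']
    · simp [hp, HomParam.coords, q']
  refine ⟨q'.toParam, hgV q' (by rw [hq']; exact ht.1), ?_⟩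
  rw [toParam_mem_generalLocus]
  have hcfg : q'.config = ⟨u.eval t, v.eval t, k.eval t, e₁.eval t, e₂.eval t⟩ :=
    configOf_coeffs ⟨u.eval t, v.eval t, k.eval t, e₁.eval t, e₂.eval t⟩
  rw [hcfg, Config.general_iff]
  exact hd

/-- The Clebsch diagonal cubic, with all `a_{ijk} = 1`: the equation for `u` becomes `u² + u + 1 =
0`, solved from a square root of `-3`. -/
theorem nonempty_paramSpace : Nonempty ParamSpace := by
  obtain ⟨s, hs⟩ := IsAlgClosed.exists_pow_nat_eq (-3 : ℂ) two_pos
  have hb : ![(1 : ℂ), 1, 1, 1, -1] ≠ 0 := fun h => one_ne_zero (congrFun h 0)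
  obtain ⟨r, hr⟩ := Projectivization.exists_smul_eq_mk_rep ℂ _ hb
  refine ⟨(1, ⟨(1, Projectivization.mk ℂ _ hb, (-1 + s) / 2), rfl, fun _ _ => rfl, fun i => ?_, ?_, ?_⟩)⟩
  · simp only [← hr]
    fin_cases i <;> simp [Units.smul_def]
  · simp only [← hr, Units.smul_def, fiveForms_smul _ r.ne_zero]
    exact isSmoothForm_clebsch
  · simp only [Pi.one_apply]
    linear_combination hs / 4

end PfaffianCubic

end

theorem mainTheorem4 :
    ∃ U : Set PfaffianCubic.ParamSpace, IsOpen U ∧ Dense U ∧ U.Nonempty ∧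
      ∀ q : PfaffianCubic.HomParam, q.toParam ∈ U →
        PfaffianCubic.pf6 q.M = -q.cubic ∧
        ∃ S : PfaffianCubic.CubicSurface, PfaffianCubic.IsEquation q.cubic S ∧
          PfaffianCubic.Phi1Eq q.M S q.pentahedron ∧
          PfaffianCubic.Phi2Eq q.M S q.pentahedron := by
  have := PfaffianCubic.nonempty_paramSpace
  refine ⟨_, PfaffianCubic.isOpen_generalLocus, PfaffianCubic.dense_generalLocus,
    PfaffianCubic.dense_generalLocus.nonempty, fun q hq => ?_⟩
  rw [PfaffianCubic.toParam_mem_generalLocus] at hq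
  exact ⟨q.pf6_M, q.surface, q.isEquation_cubic, q.phi1Eq hq, q.phi2Eq hq⟩
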